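/- A \emph{BY forest} $T=(T,S,\epsilon F)$ consists of a finite graph-theoretic forest $T$ with an edge-length function $l\colon E(T)\to\mathbb N=\{1,2,\dots\}$, a subgraph $S\subseteq T$, and a signed automorphism $\epsilon F=(F,\epsilon)$ of $(T,S)$: a length-preserving graph automorphism $F$ of $T$ with $F(S)=S$ together with a function $\epsilon\colon\pi_0(T\setminus S)\to\{\pm1\}$. Signed automorphisms form a finite group, where $(\epsilon'F')\circ(\epsilon F)$ has underlying automorphism $F'F$ and sign function $C\mapsto\epsilon(C)\epsilon'(FC)$. Let $\Lambda_T=\mathrm H_1(T,S,\mathbb Z)$ with the intersection length pairing, i.e. the restriction of the symmetric bilinear form on the free $\mathbb Z$-module on the edges of $T$ not in $S$ (each given an orientation) for which distinct edges are orthogonal and $\langle e,e\rangle=l(e)$. Let $\epsilon F$ act on $\Lambda_T$ by sending an oriented edge $\gamma$ lying in a component $C$ of $T\setminus S$ to $\epsilon(C)F(\gamma)$. The pairing induces an equivariant embedding $\Lambda_T\hookrightarrow\Lambda_T^\vee=\mathrm{Hom}(\Lambda_T,\mathbb Z)$, and the \emph{Tamagawa number} of $T$ is $c_T=\#(\Lambda_T^\vee/\Lambda_T)^{\epsilon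 F}$. The parity conditions are: (A) if two vertices of $T$ lie an odd distance apart, then at least one of them is either a leaf (degree $1$ vertex) in $S$ whose incident edge is not in $S$, or of degree $2$ and not in $S$, or of degree $2$ and in $S$ with all its incident edges in $S$; (B) no iterate of $F$ inverts an edge of $T$ of odd length. For $e,f\in\mathbb N$ let $T_{e,f}$ be the BY forest obtained from $T$ by multiplying all edge lengths by $e$ and replacing $\epsilon F$ by its $f$th power $(\epsilon F)^f$. \textbf{Theorem.} Let $T=(T,S,\epsilon F)$ be a BY forest satisfying parity conditions (A) and (B). Then there are constants $(a_d,r_d,s_d)\in\mathbb N\times\mathbb N_0\times\mathbb Z$ for $d\in\mathbb N$, equal to $(1,0,0)$ whenever $d$ does not divide the order of $\epsilon F$, such that for all $e,f\in\mathbb N$ \[c_{T_{e,f}}=\prod_{d\mid f}\left(a_d\,e^{r_d}\,\mathrm{hcf}(e,2)^{s_d}\right)^{\varphi(d)},\] where $\varphi$ is Euler's totient function. -/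

import Mathlib

/-! ### The connected components of the complement of a subgraph -/

namespace OpenComplement

variable {V : Type*} {G : SimpleGraph V} (S : G.Subgraph)

/-- The cells of the topological space `G ∖ S`: the vertices of `G` not in `S`, and the open edges
of `G` not in `S`. The space `G ∖ S` is the disjoint union of these cells. -/
def Cell : Type _ :=
  {v : V // v ∉ S.verts} ⊕ {e : Sym2 V // e ∈ G.edgeSet ∧ e ∉ S.edgeSet}

/-- The incidence graph on the cells of `G ∖ S`: a vertex not in `S` is joined to every open edge
having it as an endpoint. -/
def incidence : SimpleGraph (Cell S) where
  Adj x y := match x, y with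
    | .inl v, .inr e => v.1 ∈ e.1
    | .inr e, .inl v => v.1 ∈ e.1
    | _, _ => False
  symm := ⟨by rintro (x | x) (y | y) h <;> exact h⟩
  loopless := ⟨by rintro (x | x) h <;> exact h⟩

/-- The connected components `π₀(G ∖ S)`. Two cells lie in the same connected component of the
topological space `G ∖ S` if and only if they are linked by a chain of incidences. -/
def Components : Type _ := (incidence S).ConnectedComponent

end OpenComplement

/-- A pair `(T, S)`: an integrally metrised graph-theoretic forest `T` on the vertex type `V`
(each edge has a positive integer length), together with a subgraph `S` of `T`. -/
structure BYPair (V : Type*) where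
  graph : SimpleGraph V
  acyclic : graph.IsAcyclic
  len : graph.edgeSet → ℕ+
  sub : graph.Subgraph

namespace BYPair

variable {V : Type*} (P : BYPair V)

/-! ### Isometric automorphisms of the pair -/

/-- The group of isometric automorphisms `F` of the forest `T` which fix `S` setwise. -/
def isoGroup : Subgroup (P.graph ≃g P.graph) where
  carrier := {F | (∀ e, P.len (F.mapEdgeSet e) = P.len e) ∧
    (∀ v, F v ∈ P.sub.verts ↔ v ∈ P.sub.verts) ∧
    (∀ u v, P.sub.Adj (F u) (F v) ↔ P.sub.Adj u v)}
  one_mem' := by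
    refine ⟨fun e => ?_, fun v => Iff.rfl, fun u v => Iff.rfl⟩
    congr 1
    obtain ⟨e, he⟩ := e
    induction e with
    | h u v => rfl
  mul_mem' := by
    rintro F G ⟨hF1, hF2, hF3⟩ ⟨hG1, hG2, hG3⟩
    refine ⟨fun e => ?_, fun v => ?_, fun u v => ?_⟩
    · rw [← hG1 e, ← hF1 (G.mapEdgeSet e)]
      congr 1
      obtain ⟨e, he⟩ := e
      induction e with
      | h u v => rfl
    · exact (hF2 (G v)).trans (hG2 v)
    · exact (hF3 (G u) (G v)).trans (hG3 u v)
  inv_mem' := by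
    rintro F ⟨hF1, hF2, hF3⟩
    refine ⟨fun e => ?_, fun v => ?_, fun u v => ?_⟩
    · rw [← hF1 (SimpleGraph.Iso.mapEdgeSet F⁻¹ e)]
      congr 1
      exact F.mapEdgeSet.apply_symm_apply e
    · rw [← hF2]
      exact iff_of_eq (congrArg (· ∈ P.sub.verts) (F.apply_symm_apply v))
    · rw [← hF3]
      exact iff_of_eq (congrArg₂ P.sub.Adj (F.apply_symm_apply u) (F.apply_symm_apply v))

/-! ### The connected components of `T ∖ S` -/

/-- The (oriented) pair `(u, v)` spans an edge of `T` which is not an edge of `S`. -/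
def OpenEdge (u v : V) : Prop := P.graph.Adj u v ∧ ¬ P.sub.Adj u v

theorem OpenEdge.symm {P : BYPair V} {u v : V} (h : P.OpenEdge u v) : P.OpenEdge v u :=
  ⟨h.1.symm, fun h' => h.2 h'.symm⟩

/-- The connected components `π₀(T ∖ S)`. -/
abbrev Components : Type _ := OpenComplement.Components P.sub

/-- The component of `T ∖ S` containing an open edge. -/
def edgeComponent {u v : V} (h : P.OpenEdge u v) : P.Components :=
  (OpenComplement.incidence P.sub).connectedComponentMk
    (.inr ⟨s(u, v), h.1, fun h' => h.2 (SimpleGraph.Subgraph.mem_edgeSet.1 h')⟩)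

/-- The component of `T ∖ S` containing a vertex not in `S`. -/
def vertexComponent {v : V} (h : v ∉ P.sub.verts) : P.Components :=
  (OpenComplement.incidence P.sub).connectedComponentMk (.inl ⟨v, h⟩)

theorem edgeComponent_symm {u v : V} (h : P.OpenEdge u v) :
    P.edgeComponent h.symm = P.edgeComponent h := by
  unfold edgeComponent
  congr 3
  exact Sym2.eq_swap

theorem edgeComponent_eq {u v : V} (h : P.OpenEdge u v) (hv : v ∉ P.sub.verts) :
    P.edgeComponent h = P.vertexComponent hv := by
  refine SimpleGraph.ConnectedComponent.sound (SimpleGraph.Adj.reachable ?_)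
  exact Sym2.mem_mk_right u v

variable {P}

theorem isoGroup_openEdge (F : P.isoGroup) {u v : V} :
    P.OpenEdge (F.1 u) (F.1 v) ↔ P.OpenEdge u v := by
  unfold OpenEdge
  rw [F.2.2.2 u v, F.1.map_adj_iff]

/-- The map on cells of `T ∖ S` induced by an isometric automorphism of `(T, S)`. -/
def cellMap (F : P.isoGroup) : OpenComplement.Cell P.sub → OpenComplement.Cell P.sub
  | .inl v => .inl ⟨F.1 v.1, fun h => v.2 ((F.2.2.1 v.1).1 h)⟩
  | .inr e => .inr ⟨Sym2.map F.1 e.1, by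
      obtain ⟨e, he⟩ := e
      induction e with
      | h u v =>
        exact ⟨F.1.map_adj_iff.2 he.1, fun h => he.2 ((F.2.2.2 u v).1 h)⟩⟩

/-- The induced endomorphism of the incidence graph. -/
def incidenceHom (F : P.isoGroup) : OpenComplement.incidence P.sub →g OpenComplement.incidence P.sub where
  toFun := cellMap F
  map_rel' := by
    rintro (x | x) (y | y) h
    · exact h
    · exact Sym2.mem_map.2 ⟨_, h, rfl⟩
    · exact Sym2.mem_map.2 ⟨_, h, rfl⟩
    · exact h

/-- Isometric automorphisms of `(T, S)` act on `π₀(T ∖ S)`. -/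
instance : MulAction P.isoGroup P.Components where
  smul F C := SimpleGraph.ConnectedComponent.map (incidenceHom F) C
  one_smul C := by
    induction C using SimpleGraph.ConnectedComponent.ind with
    | h x =>
      refine congrArg (OpenComplement.incidence P.sub).connectedComponentMk ?_
      rcases x with x | x
      · rfl
      · exact congrArg Sum.inr (Subtype.ext (congrFun Sym2.map_id x.1))
  mul_smul F G C := by
    induction C using SimpleGraph.ConnectedComponent.ind with
    | h x =>
      refine congrArg (OpenComplement.incidence P.sub).connectedComponentMk ?_
      rcases x with x | x
      · rfl
      · exact congrArg Sum.inr (Subtype.ext (congrFun (Sym2.map_comp (g := F.1) (f := G.1)) x.1))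

theorem smul_edgeComponent (F : P.isoGroup) {u v : V} (h : P.OpenEdge u v) :
    F • P.edgeComponent h = P.edgeComponent ((isoGroup_openEdge F).2 h) := rfl

variable (P)

/-! ### Signed automorphisms -/

/-- A signed automorphism `εF` of the pair `(T, S)`: an isometric automorphism `F` of `(T, S)`
and a sign function `ε : π₀(T ∖ S) → {±1}`. -/
@[ext] structure SignedAut where
  iso : P.isoGroup
  sign : P.Components → ℤˣ

variable {P}

/-- Signed automorphisms form a group: the composite `ε'F' ∘ εF` has underlying automorphism `F'F`
and sign function `C ↦ ε(C) ε'(FC)`. -/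
instance : Group P.SignedAut where
  mul σ' σ := ⟨σ'.iso * σ.iso, fun C => σ.sign C * σ'.sign (σ.iso • C)⟩
  one := ⟨1, fun _ => 1⟩
  inv σ := ⟨σ.iso⁻¹, fun C => (σ.sign (σ.iso⁻¹ • C))⁻¹⟩
  mul_assoc a b c := by
    refine SignedAut.ext (mul_assoc _ _ _) (funext fun C => ?_)
    change c.sign C * (b.sign (c.iso • C) * a.sign (b.iso • c.iso • C)) =
      c.sign C * b.sign (c.iso • C) * a.sign ((b.iso * c.iso) • C)
    rw [mul_smul, mul_assoc]
  one_mul a := by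
    refine SignedAut.ext (one_mul _) (funext fun C => ?_)
    exact mul_one _
  mul_one a := by
    refine SignedAut.ext (mul_one _) (funext fun C => ?_)
    change 1 * a.sign ((1 : P.isoGroup) • C) = a.sign C
    rw [one_smul, one_mul]
  inv_mul_cancel a := by
    refine SignedAut.ext (inv_mul_cancel _) (funext fun C => ?_)
    change a.sign C * (a.sign (a.iso⁻¹ • a.iso • C))⁻¹ = 1
    rw [inv_smul_smul, mul_inv_cancel]

theorem mul_iso (σ τ : P.SignedAut) : (σ * τ).iso = σ.iso * τ.iso := rfl

theorem mul_sign (σ τ : P.SignedAut) (C : P.Components) :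
    (σ * τ).sign C = τ.sign C * σ.sign (τ.iso • C) := rfl

theorem one_iso : (1 : P.SignedAut).iso = 1 := rfl

theorem one_sign (C : P.Components) : (1 : P.SignedAut).sign C = 1 := rfl

open Classical in
/-- The sign by which a signed automorphism acts on the edge `uv` (with value `0` if `uv` is not an
edge of `T` outside `S`). -/
noncomputable def SignedAut.edgeSign (σ : P.SignedAut) (u v : V) : ℤ :=
  if h : P.OpenEdge u v then (σ.sign (P.edgeComponent h) : ℤ) else 0

theorem SignedAut.edgeSign_of (σ : P.SignedAut) {u v : V} (h : P.OpenEdge u v) :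
    σ.edgeSign u v = (σ.sign (P.edgeComponent h) : ℤ) := dif_pos h

theorem SignedAut.edgeSign_symm (σ : P.SignedAut) (u v : V) :
    σ.edgeSign v u = σ.edgeSign u v := by
  by_cases h : P.OpenEdge u v
  · rw [σ.edgeSign_of h, σ.edgeSign_of h.symm, edgeComponent_symm]
  · have h' : ¬ P.OpenEdge v u := fun h' => h h'.symm
    simp [edgeSign, h, h']

theorem SignedAut.edgeSign_mul_self (σ : P.SignedAut) {u v : V} (h : P.OpenEdge u v) :
    σ.edgeSign u v * σ.edgeSign u v = 1 := by
  rw [σ.edgeSign_of h, ← Units.val_mul, Int.units_mul_self, Units.val_one]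

/-! ### The relative homology lattice `H₁(T, S; ℤ)` -/

variable (P)

/-- The relative `1`-chains `C₁(T, S; ℤ)`: the free abelian group on the oriented edges of `T` not
in `S`, modulo the relation identifying the reversal of an edge with its negative. An element is
recorded by its coefficient `c u v` along each oriented edge `u → v`. -/
def chains : Submodule ℤ (V → V → ℤ) where
  carrier := {c | (∀ u v, c v u = - c u v) ∧ ∀ u v, ¬ P.OpenEdge u v → c u v = 0}
  add_mem' := by
    rintro a b ⟨ha, ha'⟩ ⟨hb, hb'⟩
    refine ⟨fun u v => ?_, fun u v h => ?_⟩
    · simp only [Pi.add_apply, ha u v, hb u v]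
      ring
    · simp only [Pi.add_apply, ha' u v h, hb' u v h, add_zero]
  zero_mem' := ⟨fun _ _ => neg_zero.symm, fun _ _ _ => rfl⟩
  smul_mem' := by
    rintro k a ⟨ha, ha'⟩
    refine ⟨fun u v => ?_, fun u v h => ?_⟩
    · simp only [Pi.smul_apply, ha u v, smul_neg]
    · simp only [Pi.smul_apply, ha' u v h, smul_zero]

/-- The action of a signed automorphism `εF` on relative `1`-chains: an oriented edge `u → v` in a
component `C` of `T ∖ S` is sent to `ε(C)` times the oriented edge `F u → F v`. -/
noncomputable def chainRep : Representation ℤ P.SignedAut P.chains where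
  toFun σ :=
    { toFun := fun c => ⟨fun u v => σ.edgeSign (σ.iso.1.symm u) (σ.iso.1.symm v) *
          c.1 (σ.iso.1.symm u) (σ.iso.1.symm v), by
        refine ⟨fun u v => ?_, fun u v h => ?_⟩
        · beta_reduce
          rw [σ.edgeSign_symm, c.2.1, mul_neg]
        · beta_reduce
          rw [c.2.2, mul_zero]
          rwa [← isoGroup_openEdge σ.iso, RelIso.apply_symm_apply, RelIso.apply_symm_apply]⟩
      map_add' := fun a b => Subtype.ext (funext fun u => funext fun v => mul_add _ _ _)
      map_smul' := fun k a => Subtype.ext (funext fun u => funext fun v => by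
        simp only [Submodule.coe_smul, Pi.smul_apply, smul_eq_mul, RingHom.id_apply]
        ring) }
  map_one' := by
    refine LinearMap.ext fun c => Subtype.ext (funext fun u => funext fun v => ?_)
    change (1 : P.SignedAut).edgeSign u v * c.1 u v = c.1 u v
    by_cases h : P.OpenEdge u v
    · rw [SignedAut.edgeSign_of _ h, one_sign, Units.val_one, one_mul]
    · rw [c.2.2 u v h, mul_zero]
  map_mul' σ τ := by
    refine LinearMap.ext fun c => Subtype.ext (funext fun u => funext fun v => ?_)
    change (σ * τ).edgeSign (τ.iso.1.symm (σ.iso.1.symm u)) (τ.iso.1.symm (σ.iso.1.symm v)) *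
        c.1 (τ.iso.1.symm (σ.iso.1.symm u)) (τ.iso.1.symm (σ.iso.1.symm v)) =
      σ.edgeSign (σ.iso.1.symm u) (σ.iso.1.symm v) *
        (τ.edgeSign (τ.iso.1.symm (σ.iso.1.symm u)) (τ.iso.1.symm (σ.iso.1.symm v)) *
        c.1 (τ.iso.1.symm (σ.iso.1.symm u)) (τ.iso.1.symm (σ.iso.1.symm v)))
    obtain ⟨x, hx⟩ : ∃ x, x = τ.iso.1.symm (σ.iso.1.symm u) := ⟨_, rfl⟩
    obtain ⟨y, hy⟩ : ∃ y, y = τ.iso.1.symm (σ.iso.1.symm v) := ⟨_, rfl⟩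
    have hx' : σ.iso.1.symm u = τ.iso.1 x := by rw [hx, RelIso.apply_symm_apply]
    have hy' : σ.iso.1.symm v = τ.iso.1 y := by rw [hy, RelIso.apply_symm_apply]
    rw [← hx, ← hy, hx', hy']
    by_cases h : P.OpenEdge x y
    · rw [SignedAut.edgeSign_of _ h, SignedAut.edgeSign_of _ h,
        SignedAut.edgeSign_of _ ((isoGroup_openEdge τ.iso).2 h), mul_sign, Units.val_mul,
        smul_edgeComponent]
      ring
    · rw [c.2.2 x y h]
      ring

theorem chainRep_apply (σ : P.SignedAut) (c : P.chains) (u v : V) :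
    (P.chainRep σ c).1 (σ.iso.1 u) (σ.iso.1 v) = σ.edgeSign u v * c.1 u v := by
  change σ.edgeSign (σ.iso.1.symm (σ.iso.1 u)) (σ.iso.1.symm (σ.iso.1 v)) *
    c.1 (σ.iso.1.symm (σ.iso.1 u)) (σ.iso.1.symm (σ.iso.1 v)) = _
  rw [RelIso.symm_apply_apply, RelIso.symm_apply_apply]

variable [Fintype V]

/-- The boundary map `C₁(T, S; ℤ) → C₀(T, S; ℤ)`, sending the oriented edge `u → v` to `v - u`;
here `C₀(T, S; ℤ)` is the free abelian group on the vertices of `T` not in `S`. -/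
def boundary : P.chains →ₗ[ℤ] ({v : V // v ∉ P.sub.verts} → ℤ) where
  toFun c v := ∑ u, c.1 u v.1
  map_add' a b := by
    funext v
    exact Finset.sum_add_distrib
  map_smul' k a := by
    funext v
    exact (Finset.mul_sum _ _ _).symm

/-- The relative homology lattice `Λ_T = H₁(T, S; ℤ)`. (There are no `2`-chains, so this is the
kernel of the boundary map.) -/
def lattice : Submodule ℤ P.chains := LinearMap.ker P.boundary

open Classical in
/-- The intersection length pairing on relative `1`-chains: the symmetric bilinear form for which
distinct edges are orthogonal and each edge `e` outside `S` has `⟨e, e⟩ = l(e)`. -/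
noncomputable def chainPairing : P.chains →ₗ[ℤ] P.chains →ₗ[ℤ] ℤ :=
  LinearMap.mk₂ ℤ
    (fun a b => ∑ e : P.graph.edgeSet, (P.len e : ℤ) *
      Sym2.lift ⟨fun u v => a.1 u v * b.1 u v, fun u v => by
        beta_reduce
        rw [a.2.1 v u, b.2.1 v u, neg_mul_neg]⟩ e.1)
    (by
      intro a a' b
      rw [← Finset.sum_add_distrib]
      refine Finset.sum_congr rfl fun e _ => ?_
      obtain ⟨e, he⟩ := e
      induction e with
      | h u v => simp only [Sym2.lift_mk, Submodule.coe_add, Pi.add_apply]; ring)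
    (by
      intro k a b
      rw [smul_eq_mul, Finset.mul_sum]
      refine Finset.sum_congr rfl fun e _ => ?_
      obtain ⟨e, he⟩ := e
      induction e with
      | h u v => simp only [Sym2.lift_mk, Submodule.coe_smul, Pi.smul_apply, smul_eq_mul]; ring)
    (by
      intro a b b'
      rw [← Finset.sum_add_distrib]
      refine Finset.sum_congr rfl fun e _ => ?_
      obtain ⟨e, he⟩ := e
      induction e with
      | h u v => simp only [Sym2.lift_mk, Submodule.coe_add, Pi.add_apply]; ring)
    (by
      intro k a b
      rw [smul_eq_mul, Finset.mul_sum]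
      refine Finset.sum_congr rfl fun e _ => ?_
      obtain ⟨e, he⟩ := e
      induction e with
      | h u v => simp only [Sym2.lift_mk, Submodule.coe_smul, Pi.smul_apply, smul_eq_mul]; ring)

/-- The map `Λ_T → Λ_T^∨ = Hom(Λ_T, ℤ)` induced by the intersection length pairing. -/
noncomputable def toDual : P.lattice →ₗ[ℤ] Module.Dual ℤ P.lattice :=
  P.chainPairing.domRestrict₁₂ P.lattice P.lattice

/-- The geometric Néron component group `Λ_T^∨ / Λ_T`. -/
abbrev GeometricNeronGroup : Type _ :=
  Module.Dual ℤ P.lattice ⧸ LinearMap.range P.toDual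

/-! ### The action of signed automorphisms -/

theorem chainRep_mem_lattice (σ : P.SignedAut) (c : P.chains) (hc : c ∈ P.lattice) :
    P.chainRep σ c ∈ P.lattice := by
  refine LinearMap.mem_ker.2 (funext fun ⟨w, hw⟩ => ?_)
  obtain ⟨v, rfl⟩ := σ.iso.1.surjective w
  have hv : v ∉ P.sub.verts := fun h => hw ((σ.iso.2.2.1 v).2 h)
  have h0 : ∑ u, c.1 u v = 0 := congrFun (LinearMap.mem_ker.1 hc) ⟨v, hv⟩
  change ∑ u, (P.chainRep σ c).1 u (σ.iso.1 v) = 0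
  rw [← Equiv.sum_comp σ.iso.1.toEquiv]
  have h1 : ∀ u, (P.chainRep σ c).1 (σ.iso.1.toEquiv u) (σ.iso.1 v) =
      (σ.sign (P.vertexComponent hv) : ℤ) * c.1 u v := by
    intro u
    refine (P.chainRep_apply σ c u v).trans ?_
    by_cases h : P.OpenEdge u v
    · rw [σ.edgeSign_of h, P.edgeComponent_eq h hv]
    · rw [c.2.2 u v h, mul_zero, mul_zero]
  rw [Finset.sum_congr rfl fun u _ => h1 u, ← Finset.mul_sum, h0, mul_zero]

theorem chainPairing_isometry (σ : P.SignedAut) (a b : P.chains) :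
    P.chainPairing (P.chainRep σ a) (P.chainRep σ b) = P.chainPairing a b := by
  classical
  simp only [chainPairing, LinearMap.mk₂_apply]
  symm
  refine Fintype.sum_equiv σ.iso.1.mapEdgeSet _ _ fun e => ?_
  rw [σ.iso.2.1 e]
  congr 1
  obtain ⟨e, he⟩ := e
  induction e with
  | h u v =>
    change a.1 u v * b.1 u v = (P.chainRep σ a).1 (σ.iso.1 u) (σ.iso.1 v) *
      (P.chainRep σ b).1 (σ.iso.1 u) (σ.iso.1 v)
    rw [chainRep_apply, chainRep_apply]
    by_cases h : P.OpenEdge u v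
    · rw [mul_mul_mul_comm, σ.edgeSign_mul_self h, one_mul]
    · rw [a.2.2 u v h]
      ring

/-- The action of signed automorphisms on the relative homology lattice `Λ_T`. -/
noncomputable def latticeRep : Representation ℤ P.SignedAut P.lattice where
  toFun σ := (P.chainRep σ).restrict (P.chainRep_mem_lattice σ)
  map_one' := by
    refine LinearMap.ext fun c => Subtype.ext ?_
    exact LinearMap.congr_fun (map_one P.chainRep) c.1
  map_mul' σ τ := by
    refine LinearMap.ext fun c => Subtype.ext ?_
    exact LinearMap.congr_fun (map_mul P.chainRep σ τ) c.1

theorem toDual_equivariant (σ : P.SignedAut) (a : P.lattice) :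
    P.toDual (P.latticeRep σ a) = P.latticeRep.dual σ (P.toDual a) := by
  refine LinearMap.ext fun b => ?_
  change P.toDual (P.latticeRep σ a) b = P.toDual a (P.latticeRep σ⁻¹ b)
  have hb : b = P.latticeRep σ (P.latticeRep σ⁻¹ b) := by
    rw [← Module.End.mul_apply, ← map_mul, mul_inv_cancel, map_one, Module.End.one_apply]
  conv_lhs => rw [hb]
  exact P.chainPairing_isometry σ a.1 (P.latticeRep σ⁻¹ b).1

/-- The action of signed automorphisms on the geometric Néron component group `Λ_T^∨ / Λ_T`
induced by the (contragredient) action on `Λ_T^∨`. -/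
noncomputable def neronRep : Representation ℤ P.SignedAut P.GeometricNeronGroup :=
  P.latticeRep.dual.quotient (LinearMap.range P.toDual) (by
    rintro σ _ ⟨a, rfl⟩
    exact ⟨P.latticeRep σ a, P.toDual_equivariant σ a⟩)

end BYPair

/-- A BY forest `(T, S, εF)`: an integrally metrised forest `T`, a subgraph `S` and a signed
automorphism `εF` of `(T, S)`. -/
structure BYForest (V : Type*) extends BYPair V where
  aut : toBYPair.SignedAut

namespace BYForest

variable {V : Type*}

/-- The Néron component group of `T`: the elements of `Λ_T^∨ / Λ_T` fixed by `εF`. -/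
noncomputable def neronGroup [Fintype V] (T : BYForest V) :
    Submodule ℤ T.toBYPair.GeometricNeronGroup :=
  LinearMap.ker (T.toBYPair.neronRep T.aut - LinearMap.id)

/-- The Tamagawa number `c_T`, the order of the Néron component group of `T`. -/
noncomputable def tamagawaNumber [Fintype V] (T : BYForest V) : ℕ :=
  Nat.card T.neronGroup

/-- The length of a walk in `T`. As `T` is a forest, the distance between two vertices in the same
component is the length of the unique path between them. -/
def walkLength (T : BYForest V) {u v : V} (p : T.graph.Walk u v) : ℕ :=
  (p.darts.map fun d => (T.len ⟨d.edge, d.edge_mem⟩ : ℕ)).sum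

open Classical in
/-- The three kinds of exceptional vertices in parity condition (A):
* a leaf in `S` whose incident edge is not in `S`;
* a vertex of degree `2` not in `S`;
* a vertex of degree `2` in the interior of `S`, i.e. in `S` with all incident edges in `S`. -/
def Exceptional [Fintype V] (T : BYForest V) (v : V) : Prop :=
  (T.graph.degree v = 1 ∧ v ∈ T.sub.verts ∧ ∀ u, T.graph.Adj v u → ¬ T.sub.Adj v u) ∨
  (T.graph.degree v = 2 ∧ v ∉ T.sub.verts) ∨
  (T.graph.degree v = 2 ∧ v ∈ T.sub.verts ∧ ∀ u, T.graph.Adj v u → T.sub.Adj v u)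

/-- Parity condition (A): if two vertices lie an odd distance apart, then at least one of them is
exceptional. -/
def ParityA [Fintype V] (T : BYForest V) : Prop :=
  ∀ (u v : V) (p : T.graph.Walk u v), p.IsPath → Odd (T.walkLength p) →
    T.Exceptional u ∨ T.Exceptional v

/-- Parity condition (B): no iterate of `F` inverts any edge of odd length. -/
def ParityB (T : BYForest V) : Prop :=
  ∀ (n : ℕ) (u v : V) (h : T.graph.Adj u v),
    (T.aut.iso ^ n).1 u = v → (T.aut.iso ^ n).1 v = u → ¬ Odd (T.len ⟨s(u, v), h⟩ : ℕ)

end BYForest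

/-! ### Scaling edge-lengths -/

namespace BYPair

variable {V : Type*} (P : BYPair V)

/-- The pair `(eT, eS)` obtained by multiplying all edge-lengths by `e`. -/
def scale (e : ℕ+) : BYPair V where
  graph := P.graph
  acyclic := P.acyclic
  len x := e * P.len x
  sub := P.sub

variable {P}

/-- A signed automorphism `εF` of `(T, S)`, viewed as a signed automorphism of `(eT, eS)`. -/
def SignedAut.scale (e : ℕ+) (σ : P.SignedAut) : (P.scale e).SignedAut where
  iso := ⟨σ.iso.1, fun x => congrArg (e * ·) (σ.iso.2.1 x), σ.iso.2.2⟩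
  sign := σ.sign

end BYPair

/-- The BY forest `T_{e,f} = (eT, eS, (εF)^f)`. -/
def BYForest.tower {V : Type*} (T : BYForest V) (e f : ℕ+) : BYForest V where
  toBYPair := T.toBYPair.scale e
  aut := (T.aut ^ (f : ℕ)).scale e

/-! ### Matrices supported on rooted forests -/

/-! Let `X` be the set of open cells of `T ∖ S` lying in components of `T` that meet `S`; the other
components carry no relative cycles. Let `N` be the boundary matrix from edges to vertices in `X`,
and `ℓ` the diagonal of edge lengths. Then `Λ = ker N`, and `N` is onto because a walk into `S`
bounds its starting point. Hence `Λ^∨/Λ` is equivariantly the cokernel of the symmetric saddle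
matrix `M = (ℓ, Nᵀ; N, 0)` on `ℤ^X`, and `εF` becomes a signed permutation of `X` commuting with
`M`. The group is finite, so invariants may be replaced by coinvariants
(`BYForest.tamagawaNumber_tower`).

The coinvariants of `ℤ^X` under a signed permutation are a sum of one `ℤ` for every orbit of total
sign `1` (good) and one `ℤ/2` for every orbit of total sign `-1` (bad). There is no nonzero map `ℤ/2
→ ℤ`, so `M` acts on them in block triangular form, and the coinvariants of its cokernel have order
`|det A| · #ker D`, where `A` is the integral block on good orbits and `D` the block over `𝔽₂` on
bad orbits (`card_coinvariants`).

The graph of `M` is a subdivided forest with an invariant height function, so `A` and `D` can be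
eliminated from the leaves without fill-in. An orbit meeting `k` children of a given element
contributes `k / pivot`, exactly what those `k` children contribute one by one. The pivot of an
orbit is therefore that of any of its elements, computed from `M` alone and independent of `f`. So
`det A` is a product of pivots over good orbits of the `f`th power, and `#ker D` is `2` to the
number of zero pivots minus the number of infinite ones over bad orbits.

What remains is to count orbits. An orbit of length `n` and sign `u` breaks under the `f`th power
into `gcd(n, f)` orbits; those of total sign `1` are counted by the sum of `φ(d)` over the divisors
`d` of `f` whose primitive roots of unity are roots of `X^n - u`. This turns both factors into
products over `d ∣ f` with exponents `φ(d)` (`IsForestForm.det_goodMatrix_pow`,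
`IsForestForm.card_ker_badMatrix_pow`).

Replacing `ℓ` by `eℓ` multiplies each determinant by a power of `e`, because the graph is bipartite
and the diagonal vanishes at the vertices; the `𝔽₂` part sees only the parity of `e`. Finally `a_d`
is an integer because the denominator of the `𝔽₂` factor is the order of a quotient of a cokernel
whose order is the corresponding determinant (`IsForestForm.exists_det_rootMatrix`). -/

theorem card_quotient_range_mulVecLin {n : Type*} [Fintype n] [DecidableEq n] (A : Matrix n n ℤ)
    (hA : A.det ≠ 0) :
    Nat.card ((n → ℤ) ⧸ LinearMap.range A.mulVecLin) = A.det.natAbs := by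
  have hinj : Function.Injective A.mulVecLin := by
    rw [← LinearMap.ker_eq_bot, LinearMap.ker_eq_bot']
    intro v hv
    exact Matrix.eq_zero_of_mulVec_eq_zero hA hv
  have h := Submodule.natAbs_det_equiv (LinearMap.range A.mulVecLin)
    (LinearEquiv.ofInjective A.mulVecLin hinj)
  rw [← h]
  have h2 : (LinearMap.range A.mulVecLin).subtype ∘ₗ
      ((LinearEquiv.ofInjective A.mulVecLin hinj : (n → ℤ) ≃ₗ[ℤ] _) : (n → ℤ) →ₗ[ℤ] _) =
      Matrix.toLin' A := by
    ext; rfl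
  change Int.natAbs (LinearMap.det ((LinearMap.range A.mulVecLin).subtype ∘ₗ
      ((LinearEquiv.ofInjective A.mulVecLin hinj : (n → ℤ) ≃ₗ[ℤ] _) : (n → ℤ) →ₗ[ℤ] _))) = _
  rw [h2, LinearMap.det_toLin']

/-- Unitriangularity is expressed by a height function rather than a linear order, since distinct
indices may share a height. -/
theorem Matrix.det_one_add_of_strictUpper {Y K : Type*} [Fintype Y] [DecidableEq Y] [CommRing K]
    (h : Y → ℕ) (R : Matrix Y Y K) (hR : ∀ x y, h y ≤ h x → R x y = 0) : (1 + R).det = 1 := by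
  have hb : (1 + R).BlockTriangular h := by
    intro x y hxy
    rw [Matrix.add_apply, hR x y hxy.le, add_zero, Matrix.one_apply_ne]
    rintro rfl
    exact lt_irrefl _ hxy
  rw [hb.det]
  refine Finset.prod_eq_one fun k _ => ?_
  have h1 : (1 + R).toSquareBlock h k = 1 := by
    ext ⟨x, hx⟩ ⟨y, hy⟩
    simp only [Matrix.toSquareBlock_def, Matrix.of_apply, Matrix.add_apply,
      hR x y (hy.trans hx.symm).le, add_zero, Matrix.one_apply, Subtype.mk.injEq]
  rw [h1, Matrix.det_one]

/-- The off-diagonal support of the matrix `N` is a forest rooted by `h`: adjacent indices have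
different heights, and each index is adjacent to at most one index of greater height. -/
structure Matrix.IsRooted {Y K : Type*} [Zero K] (h : Y → ℕ) (N : Matrix Y Y K) : Prop where
  symm : ∀ x y, N x y ≠ 0 → N y x ≠ 0
  ne : ∀ x y, N x y ≠ 0 → x ≠ y → h x ≠ h y
  uniq : ∀ x y z, h x < h y → h x < h z → N x y ≠ 0 → N x z ≠ 0 → y = z

/-- Elimination by increasing height has no fill-in: an index has at most one neighbour above it, so
eliminating it changes only the diagonal entry of that neighbour. The outcome is an explicit
factorisation of `N` with diagonal part `p`. -/
theorem Matrix.IsRooted.det_eq_prod {Y K : Type*} [Fintype Y] [DecidableEq Y] [Field K]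
    {h : Y → ℕ} {N : Matrix Y Y K} (hN : N.IsRooted h) (p : Y → K) (hp : ∀ x, p x ≠ 0)
    (hrec : ∀ x, p x = N x x - ∑ y with h y < h x, N x y * N y x / p y) :
    N.det = ∏ x, p x := by
  let R : Matrix Y Y K := Matrix.of fun x z => if h z < h x then N x z / p z else 0
  let R' : Matrix Y Y K := Matrix.of fun z x => if h z < h x then N z x / p z else 0
  have hfac : N = (1 + R) * Matrix.diagonal p * (1 + R') := by
    ext x y
    have h1 : ((1 + R) * Matrix.diagonal p * (1 + R')) x y =
        Matrix.diagonal p x y + R x y * p y + p x * R' x y + ∑ z, R x z * p z * R' z y := by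
      rw [add_mul, mul_add, mul_one, add_mul, one_mul]
      simp only [Matrix.add_apply, Matrix.mul_apply (M := R * Matrix.diagonal p),
        Matrix.mul_diagonal, Matrix.diagonal_mul]
      ring
    rw [h1]
    by_cases hxy : x = y
    · subst hxy
      simp only [R, R', Matrix.of_apply, lt_irrefl, if_false, zero_mul, mul_zero, add_zero,
        Matrix.diagonal_apply_eq]
      rw [hrec x, Finset.sum_filter]
      have : ∀ z, (if h z < h x then N x z / p z else 0) * p z *
          (if h z < h x then N z x / p z else 0) =
          if h z < h x then N x z * N z x / p z else 0 := by
        intro z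
        split_ifs
        · field_simp [hp z]
        · simp
      simp only [this, sub_add_cancel]
    -- A nonzero term would give `z` two distinct neighbours `x`, `y` of greater height. This is the
    -- absence of fill-in.
    · have hz : ∑ z, R x z * p z * R' z y = 0 := by
        refine Finset.sum_eq_zero fun z _ => ?_
        simp only [R, R', Matrix.of_apply]
        split_ifs with h1 h2
        · by_cases ha : N x z = 0
          · simp [ha]
          by_cases hb : N z y = 0
          · simp [hb]
          exact absurd (hN.uniq z x y h1 h2 (hN.symm _ _ ha) hb) hxy
        all_goals simp
      rw [hz, Matrix.diagonal_apply_ne _ hxy]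
      simp only [R, R', Matrix.of_apply]
      rcases lt_trichotomy (h x) (h y) with hl | hl | hl
      · rw [if_neg hl.not_gt, if_pos hl]
        field_simp [hp x]
        ring
      · rw [if_neg hl.ge.not_gt, if_neg hl.le.not_gt]
        simp only [zero_mul, mul_zero, add_zero]
        by_contra hne
        exact hN.ne x y hne hxy hl
      · rw [if_pos hl, if_neg hl.not_gt]
        field_simp [hp y]
        ring
  have hR : (1 + R).det = 1 := by
    rw [← Matrix.det_transpose, Matrix.transpose_add, Matrix.transpose_one]
    refine Matrix.det_one_add_of_strictUpper h _ fun x y hxy => ?_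
    simp only [R, Matrix.transpose_apply, Matrix.of_apply, if_neg hxy.not_gt]
  have hR' : (1 + R').det = 1 :=
    Matrix.det_one_add_of_strictUpper h _ fun x y hxy => by
      simp only [R', Matrix.of_apply, if_neg hxy.not_gt]
  rw [hfac, Matrix.det_mul, Matrix.det_mul, hR, hR', Matrix.det_diagonal, one_mul, mul_one]

theorem ZMod.two_eq_one_of_ne_zero : ∀ {a : ZMod 2}, a ≠ 0 → a = 1 := by decide

/-- The exponent of `2` contributed to the size of a kernel over `𝔽₂` by a pivot, where `none`
stands for an infinite pivot. -/
def pivotExp : Option (ZMod 2) → ℤ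
  | none => -1
  | some a => if a = 0 then 1 else 0

/-- The recursion relation for the pivots over `𝔽₂` of a rooted matrix, at the index `x`. -/
def IsPivotTwo {Y : Type*} (h : Y → ℕ) (N : Matrix Y Y (ZMod 2)) (s : Finset Y)
    (p : Y → Option (ZMod 2)) (x : Y) : Prop :=
  ((∃ y ∈ s, h y < h x ∧ N x y ≠ 0 ∧ p y = some 0) → p x = none) ∧
  ((¬ ∃ y ∈ s, h y < h x ∧ N x y ≠ 0 ∧ p y = some 0) →
    p x = some (N x x + ∑ y ∈ s with h y < h x ∧ p y = some 1, N x y))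

/-- The same elimination over `𝔽₂`, where pivots may vanish and cannot be perturbed away. A zero
pivot makes the pivot above it infinite; an infinite pivot has inverse zero and so does not affect
its own parent. The matrix varies in the induction because a pivot `1` modifies a diagonal entry,
while `p` stays fixed. -/
theorem card_ker_two_aux {Y : Type*} [Fintype Y] [DecidableEq Y] (h : Y → ℕ)
    (p : Y → Option (ZMod 2)) (n : ℕ) : ∀ (s : Finset Y) (N : Matrix Y Y (ZMod 2)), s.card = n →
    (∀ x y, N x y = N y x) → (∀ x ∈ s, ∀ y ∈ s, x ≠ y → N x y ≠ 0 → h x ≠ h y) →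
    (∀ x ∈ s, ∀ y ∈ s, ∀ z ∈ s, h x < h y → h x < h z → N x y ≠ 0 → N x z ≠ 0 → y = z) →
    (∀ x ∈ s, IsPivotTwo h N s p x) →
    (Nat.card {v : Y → ZMod 2 // (∀ y ∉ s, v y = 0) ∧ ∀ x ∈ s, ∑ y ∈ s, N x y * v y = 0} : ℚ) =
      ∏ x ∈ s, (2 : ℚ) ^ pivotExp (p x) := by
  induction n using Nat.strong_induction_on with
  | _ n ih =>
  intro s N hs hsym hne huniq hrec
  rcases s.eq_empty_or_nonempty with rfl | hsne
  · have : Unique {v : Y → ZMod 2 // (∀ y ∉ (∅ : Finset Y), v y = 0) ∧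
        ∀ x ∈ (∅ : Finset Y), ∑ y ∈ (∅ : Finset Y), N x y * v y = 0} :=
      ⟨⟨⟨0, by simp⟩⟩, fun v => Subtype.ext (funext fun y => v.2.1 y (by simp))⟩
    rw [Nat.card_unique, Finset.prod_empty, Nat.cast_one]
  obtain ⟨x, hx, hmin⟩ := s.exists_min_image h hsne
  have hup : ∀ y ∈ s, y ≠ x → N x y ≠ 0 → h x < h y := fun y hy hyx hN =>
    lt_of_le_of_ne (hmin y hy) (hne x hx y hy hyx.symm hN)
  have hpx : p x = some (N x x) := by
    have h1 := (hrec x hx).2 (by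
      rintro ⟨y, hy, hlt, -⟩
      exact absurd (hmin y hy) hlt.not_ge)
    rw [h1, Finset.sum_eq_zero, add_zero]
    intro y hy
    rw [Finset.mem_filter] at hy
    exact absurd (hmin y hy.1) hy.2.1.not_ge
  have hsplit : ∀ (f : Y → ZMod 2), ∑ y ∈ s, f y = f x + ∑ y ∈ s.erase x, f y := fun f =>
    (Finset.add_sum_erase s f hx).symm
  have hcard : (s.erase x).card < n := hs ▸ Finset.card_erase_lt_of_mem hx
  have hprod := Finset.mul_prod_erase s (fun x => (2 : ℚ) ^ pivotExp (p x)) hx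
  rw [← hprod]
  by_cases hxx : N x x = 0
  · by_cases hnb : ∃ q ∈ s, q ≠ x ∧ N x q ≠ 0
    -- Zero pivot at `x` with parent `q`: row `x` forces `v q = 0`, and row `q` then determines `v
    -- x`. Both indices are removed at once, and their factors `2` and `2⁻¹` cancel.
    · obtain ⟨q, hq, hqx, hNq⟩ := hnb
      have hlt := hup q hq hqx hNq
      have honly : ∀ y ∈ s, y ≠ q → N x y = 0 := by
        intro y hy hyq
        by_contra hN
        have hyx : y ≠ x := by rintro rfl; exact hN hxx
        exact hyq (huniq x hx y hy q hq (hup y hy hyx hN) hlt hN hNq)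
      have hpq : p q = none := (hrec q hq).1 ⟨x, hx, hlt, hsym x q ▸ hNq, by rw [hpx, hxx]⟩
      have hq' : q ∈ s.erase x := Finset.mem_erase.2 ⟨hqx, hq⟩
      set t := (s.erase x).erase q with ht
      have hts : ∀ y ∈ t, y ∈ s ∧ y ≠ x ∧ y ≠ q := fun y hy => by
        simp only [ht, Finset.mem_erase] at hy
        exact ⟨hy.2.2, hy.2.1, hy.1⟩
      have hts' : ∀ y, y ∈ t ↔ y ∈ s ∧ y ≠ x ∧ y ≠ q := fun y => by
        simp only [ht, Finset.mem_erase]; tauto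
      have hsplit2 : ∀ (f : Y → ZMod 2), ∑ y ∈ s, f y = f x + f q + ∑ y ∈ t, f y := fun f => by
        rw [hsplit, ← Finset.add_sum_erase _ f hq', add_assoc]
      have hN1 : N x q = 1 := ZMod.two_eq_one_of_ne_zero hNq
      have hIH := ih t.card (lt_of_le_of_lt (Finset.card_le_card (Finset.erase_subset _ _)) hcard)
        t N rfl hsym (fun y hy z hz => hne y (hts y hy).1 z (hts z hz).1)
        (fun y hy z hz w hw => huniq y (hts y hy).1 z (hts z hz).1 w (hts w hw).1) (by
          intro y hy
          obtain ⟨hys, hyx, hyq⟩ := hts y hy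
          have hyx0 : N y x = 0 := by rw [hsym]; exact honly y hys hyq
          have hiff : (∃ z ∈ t, h z < h y ∧ N y z ≠ 0 ∧ p z = some 0) ↔
              ∃ z ∈ s, h z < h y ∧ N y z ≠ 0 ∧ p z = some 0 := by
            constructor
            · rintro ⟨z, hz, hz'⟩
              exact ⟨z, (hts z hz).1, hz'⟩
            · rintro ⟨z, hz, hz1, hz2, hz3⟩
              refine ⟨z, (hts' z).2 ⟨hz, ?_, ?_⟩, hz1, hz2, hz3⟩
              · rintro rfl; exact hz2 hyx0
              · rintro rfl; rw [hpq] at hz3; cases hz3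
          have h1 := hrec y hys
          unfold IsPivotTwo at h1 ⊢
          rw [hiff]
          refine ⟨h1.1, fun h2 => ?_⟩
          rw [h1.2 h2, Finset.sum_filter, Finset.sum_filter, hsplit2]
          simp [hyx0, hpq])
      rw [← Finset.mul_prod_erase _ _ hq', hpx, hpq, hxx, ← ht, ← hIH, ← mul_assoc]
      have h2 : (2 : ℚ) ^ pivotExp (some 0) * (2 : ℚ) ^ pivotExp none = 1 := by
        simp [pivotExp]
      rw [h2, one_mul]
      norm_cast
      refine Nat.card_congr
        { toFun := fun v => ⟨fun y => if y ∈ t then v.1 y else 0, fun y hy => if_neg hy, ?_⟩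
          invFun := fun w => ⟨fun y => if y = x then ∑ z ∈ t, N q z * w.1 z else w.1 y, ?_, ?_⟩
          left_inv := ?_
          right_inv := ?_ }
      · intro y hy
        obtain ⟨hys, hyx, hyq⟩ := hts y hy
        have hvq : v.1 q = 0 := by
          have := v.2.2 x hx
          rwa [hsplit2, hxx, hN1, zero_mul, zero_add, one_mul, Finset.sum_eq_zero, add_zero] at this
          intro z hz
          rw [honly z (hts z hz).1 (hts z hz).2.2, zero_mul]
        have h1 := v.2.2 y hys
        rw [hsplit2, hvq, hsym y x, honly y hys hyq, zero_mul, mul_zero, zero_add, zero_add] at h1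
        exact (Finset.sum_congr rfl fun z hz => congrArg (N y z * ·) (if_pos hz)).trans h1
      · intro y hy
        have hyx : y ≠ x := by rintro rfl; exact hy hx
        simp only [if_neg hyx]
        exact w.2.1 y fun h' => hy (hts y h').1
      · intro y hy
        have hwq : w.1 q = 0 := w.2.1 q fun h' => (hts q h').2.2 rfl
        rw [hsplit2]
        have h3 : ∑ z ∈ t, N y z * (if z = x then ∑ z ∈ t, N q z * w.1 z else w.1 z) =
            ∑ z ∈ t, N y z * w.1 z :=
          Finset.sum_congr rfl fun z hz => by rw [if_neg (hts z hz).2.1]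
        simp only [if_true, if_neg hqx, hwq, mul_zero, add_zero, h3]
        by_cases hyq : y = q
        · subst hyq
          rw [hsym y x, hN1, one_mul]
          exact CharTwo.add_self_eq_zero _
        by_cases hyx : y = x
        · subst hyx
          rw [hxx, zero_mul, zero_add]
          refine Finset.sum_eq_zero fun z hz => ?_
          rw [honly z (hts z hz).1 (hts z hz).2.2, zero_mul]
        · rw [hsym y x, honly y hy hyq, zero_mul, zero_add]
          exact w.2.2 y ((hts' y).2 ⟨hy, hyx, hyq⟩)
      · intro v
        refine Subtype.ext (funext fun y => ?_)
        have hvq : v.1 q = 0 := by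
          have := v.2.2 x hx
          rwa [hsplit2, hxx, hN1, zero_mul, zero_add, one_mul, Finset.sum_eq_zero, add_zero] at this
          intro z hz
          rw [honly z (hts z hz).1 (hts z hz).2.2, zero_mul]
        by_cases hyx : y = x
        · subst hyx
          simp only [if_true]
          have h1 := v.2.2 q hq
          rw [hsplit2, hvq, hsym q y, hN1, one_mul, mul_zero, add_zero,
            CharTwo.add_eq_zero] at h1
          rw [h1]
          exact Finset.sum_congr rfl fun z hz => by rw [if_pos hz]
        · simp only [if_neg hyx]
          split_ifs with hyt
          · rfl
          · by_cases hyq : y = q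
            · rw [hyq, hvq]
            · exact (v.2.1 y fun hys => hyt ((hts' y).2 ⟨hys, hyx, hyq⟩)).symm
      · intro w
        refine Subtype.ext (funext fun y => ?_)
        by_cases hyt : y ∈ t
        · simp only [if_pos hyt, if_neg (hts y hyt).2.1]
        · simp only [if_neg hyt]
          exact (w.2.1 y hyt).symm
    -- Here the row and column of `x` vanish, so `v x` is free and accounts for a factor `2`.
    · have hnb : ∀ y ∈ s, N x y = 0 := by
        intro y hy
        by_cases hyx : y = x
        · rw [hyx, hxx]
        · by_contra hN
          exact hnb ⟨y, hy, hyx, hN⟩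
      have hIH := ih _ hcard (s.erase x) N rfl hsym
        (fun y hy z hz => hne y (Finset.mem_of_mem_erase hy) z (Finset.mem_of_mem_erase hz))
        (fun y hy z hz w hw => huniq y (Finset.mem_of_mem_erase hy) z (Finset.mem_of_mem_erase hz)
          w (Finset.mem_of_mem_erase hw)) (by
          intro y hy
          have hys := Finset.mem_of_mem_erase hy
          have hyx0 : N y x = 0 := by rw [hsym]; exact hnb y hys
          have hiff : (∃ z ∈ s.erase x, h z < h y ∧ N y z ≠ 0 ∧ p z = some 0) ↔
              ∃ z ∈ s, h z < h y ∧ N y z ≠ 0 ∧ p z = some 0 := by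
            constructor
            · rintro ⟨z, hz, hz'⟩
              exact ⟨z, Finset.mem_of_mem_erase hz, hz'⟩
            · rintro ⟨z, hz, hz1, hz2, hz3⟩
              refine ⟨z, Finset.mem_erase.2 ⟨?_, hz⟩, hz1, hz2, hz3⟩
              rintro rfl; exact hz2 hyx0
          have h1 := hrec y hys
          unfold IsPivotTwo at h1 ⊢
          rw [hiff]
          refine ⟨h1.1, fun h2 => ?_⟩
          rw [h1.2 h2, Finset.sum_filter, Finset.sum_filter, hsplit]
          simp [hyx0])
      rw [hpx, hxx, ← hIH]
      have h2 : (2 : ℚ) ^ pivotExp (some 0) = ((Nat.card (ZMod 2) : ℕ) : ℚ) := by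
        simp [pivotExp]
      rw [h2]
      norm_cast
      rw [← Nat.card_prod]
      refine Nat.card_congr
        { toFun := fun v => ⟨v.1 x, fun y => if y = x then 0 else v.1 y, ?_, ?_⟩
          invFun := fun w => ⟨fun y => if y = x then w.1 else w.2.1 y, ?_, ?_⟩
          left_inv := ?_
          right_inv := ?_ }
      · intro y hy
        dsimp only
        split_ifs with hyx
        · rfl
        · exact v.2.1 y fun hys => hy (Finset.mem_erase.2 ⟨hyx, hys⟩)
      · intro y hy
        have h1 := v.2.2 y (Finset.mem_of_mem_erase hy)
        rw [hsplit, hsym y x, hnb y (Finset.mem_of_mem_erase hy), zero_mul, zero_add] at h1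
        exact (Finset.sum_congr rfl fun z hz =>
          congrArg (N y z * ·) (if_neg (Finset.ne_of_mem_erase hz))).trans h1
      · intro y hy
        have hyx : y ≠ x := by rintro rfl; exact hy hx
        simp only [if_neg hyx]
        exact w.2.2.1 y fun h' => hy (Finset.mem_of_mem_erase h')
      · intro y hy
        rw [hsplit, hsym y x, hnb y hy, zero_mul, zero_add]
        by_cases hyx : y = x
        · subst hyx
          exact Finset.sum_eq_zero fun z hz => by
            rw [hnb z (Finset.mem_of_mem_erase hz), zero_mul]
        · exact (Finset.sum_congr rfl fun z hz => congrArg (N y z * ·)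
            (if_neg (Finset.ne_of_mem_erase hz))).trans
              (w.2.2.2 y (Finset.mem_erase.2 ⟨hyx, hy⟩))
      · intro v
        refine Subtype.ext (funext fun y => ?_)
        by_cases hyx : y = x <;> simp [hyx]
      · intro w
        refine Prod.ext (by simp) (Subtype.ext (funext fun y => ?_))
        by_cases hyx : y = x
        · subst hyx
          simp only [if_true]
          exact (w.2.2.1 y (Finset.notMem_erase y s)).symm
        · simp [hyx]
  · have hxx : N x x = 1 := ZMod.two_eq_one_of_ne_zero hxx
    -- The Schur complement of the pivot `1` at `x`. By uniqueness of the parent it differs from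
    -- `N`, away from `x`, only in the diagonal entry of that parent, so the recursion for `p`
    -- survives.
    set N' : Matrix Y Y (ZMod 2) := Matrix.of fun y z => N y z + N y x * N x z with hN'
    have hoff : ∀ y ∈ s.erase x, ∀ z ∈ s.erase x, y ≠ z → N' y z = N y z := by
      intro y hy z hz hyz
      rw [Finset.mem_erase] at hy hz
      have : N y x * N x z = 0 := by
        by_contra hmul
        have h1 : N x y ≠ 0 := hsym x y ▸ left_ne_zero_of_mul hmul
        have h2 := right_ne_zero_of_mul hmul
        exact hyz (huniq x hx y hy.2 z hz.2 (hup y hy.2 hy.1 h1) (hup z hz.2 hz.1 h2) h1 h2)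
      simp [hN', this]
    have hIH := ih _ hcard (s.erase x) N' rfl
      (fun y z => by simp only [hN', Matrix.of_apply, hsym z y, hsym z x, hsym x y]; ring)
      (fun y hy z hz hyz => by
        rw [hoff y hy z hz hyz]
        exact hne y (Finset.mem_of_mem_erase hy) z (Finset.mem_of_mem_erase hz) hyz)
      (fun y hy z hz w hw hyz hyw => by
        rw [hoff y hy z hz (by rintro rfl; exact lt_irrefl _ hyz),
          hoff y hy w hw (by rintro rfl; exact lt_irrefl _ hyw)]
        exact huniq y (Finset.mem_of_mem_erase hy) z (Finset.mem_of_mem_erase hz)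
          w (Finset.mem_of_mem_erase hw) hyz hyw) (by
        intro y hy
        have hys := Finset.mem_of_mem_erase hy
        have hyx := Finset.ne_of_mem_erase hy
        have hiff : (∃ z ∈ s.erase x, h z < h y ∧ N' y z ≠ 0 ∧ p z = some 0) ↔
            ∃ z ∈ s, h z < h y ∧ N y z ≠ 0 ∧ p z = some 0 := by
          constructor
          · rintro ⟨z, hz, hz1, hz2, hz3⟩
            refine ⟨z, Finset.mem_of_mem_erase hz, hz1, ?_, hz3⟩
            rwa [← hoff y hy z hz (by rintro rfl; exact lt_irrefl _ hz1)]
          · rintro ⟨z, hz, hz1, hz2, hz3⟩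
            have hzx : z ∈ s.erase x := by
              refine Finset.mem_erase.2 ⟨?_, hz⟩
              rintro rfl
              rw [hpx, hxx] at hz3
              cases hz3
            refine ⟨z, hzx, hz1, ?_, hz3⟩
            rwa [hoff y hy z hzx (by rintro rfl; exact lt_irrefl _ hz1)]
        have h1 := hrec y hys
        unfold IsPivotTwo at h1 ⊢
        rw [hiff]
        refine ⟨h1.1, fun h2 => ?_⟩
        rw [h1.2 h2, Finset.sum_filter, Finset.sum_filter, hsplit]
        have h3 : (if h x < h y ∧ p x = some 1 then N y x else 0) = N y x * N x y := by
          rw [hpx, hxx, hsym x y]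
          by_cases h0 : N y x = 0
          · simp [h0]
          · have hlt := hup y hys hyx (hsym x y ▸ h0)
            simp [hlt, ZMod.two_eq_one_of_ne_zero h0]
        have h4 : ∑ z ∈ s.erase x, (if h z < h y ∧ p z = some 1 then N' y z else 0) =
            ∑ z ∈ s.erase x, (if h z < h y ∧ p z = some 1 then N y z else 0) := by
          refine Finset.sum_congr rfl fun z hz => ?_
          split_ifs with hlt
          · exact hoff y hy z hz (by rintro rfl; exact lt_irrefl _ hlt.1)
          · rfl
        rw [h3, h4, ← add_assoc]
        rfl)
    rw [hpx, hxx, ← hIH]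
    have h2 : (2 : ℚ) ^ pivotExp (some 1) = 1 := by simp [pivotExp]
    rw [h2, one_mul]
    norm_cast
    have hN's : ∀ (v : Y → ZMod 2) y, ∑ z ∈ s.erase x, N' y z * v z =
        ∑ z ∈ s.erase x, N y z * v z + N y x * ∑ z ∈ s.erase x, N x z * v z := by
      intro v y
      rw [Finset.mul_sum, ← Finset.sum_add_distrib]
      exact Finset.sum_congr rfl fun z _ => by simp only [hN', Matrix.of_apply]; ring
    have hupd : ∀ (v : Y → ZMod 2) y a, ∑ z ∈ s.erase x, N y z * (if z = x then a else v z) =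
        ∑ z ∈ s.erase x, N y z * v z := fun v y a =>
      Finset.sum_congr rfl fun z hz => by rw [if_neg (Finset.ne_of_mem_erase hz)]
    have hupd' : ∀ (v : Y → ZMod 2) y a, ∑ z ∈ s.erase x, N' y z * (if z = x then a else v z) =
        ∑ z ∈ s.erase x, N' y z * v z := fun v y a =>
      Finset.sum_congr rfl fun z hz => by rw [if_neg (Finset.ne_of_mem_erase hz)]
    have hvx : ∀ v : Y → ZMod 2, ∑ y ∈ s, N x y * v y = 0 →
        v x = ∑ z ∈ s.erase x, N x z * v z := by
      intro v hv
      rwa [hsplit, hxx, one_mul, CharTwo.add_eq_zero] at hv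
    refine Nat.card_congr
      { toFun := fun v => ⟨fun y => if y = x then 0 else v.1 y, ?_, ?_⟩
        invFun := fun w => ⟨fun y => if y = x then ∑ z ∈ s.erase x, N x z * w.1 z else w.1 y, ?_, ?_⟩
        left_inv := ?_
        right_inv := ?_ }
    · intro y hy
      dsimp only
      split_ifs with hyx
      · rfl
      · exact v.2.1 y fun hys => hy (Finset.mem_erase.2 ⟨hyx, hys⟩)
    · intro y hy
      have h1 := v.2.2 y (Finset.mem_of_mem_erase hy)
      rw [hupd', hN's, ← hvx v.1 (v.2.2 x hx), add_comm, ← hsplit fun z => N y z * v.1 z, h1]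
    · intro y hy
      have hyx : y ≠ x := by rintro rfl; exact hy hx
      simp only [if_neg hyx]
      exact w.2.1 y fun h' => hy (Finset.mem_of_mem_erase h')
    · intro y hy
      rw [hsplit, hupd]
      dsimp only
      rw [if_pos rfl]
      by_cases hyx : y = x
      · subst hyx
        rw [hxx, one_mul]
        exact CharTwo.add_self_eq_zero _
      · have h1 := w.2.2 y (Finset.mem_erase.2 ⟨hyx, hy⟩)
        rwa [hN's, add_comm] at h1
    · intro v
      refine Subtype.ext (funext fun y => ?_)
      by_cases hyx : y = x
      · subst hyx
        simp only [if_true]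
        rw [hupd]
        exact (hvx v.1 (v.2.2 y hx)).symm
      · simp [hyx]
    · intro w
      refine Subtype.ext (funext fun y => ?_)
      by_cases hyx : y = x
      · subst hyx
        simp only [if_true]
        exact (w.2.1 y (Finset.notMem_erase y s)).symm
      · simp [hyx]

theorem Matrix.IsRooted.card_ker_two {Y : Type*} [Fintype Y] [DecidableEq Y] {h : Y → ℕ}
    {N : Matrix Y Y (ZMod 2)} (hN : N.IsRooted h) (p : Y → Option (ZMod 2))
    (hrec : ∀ x, IsPivotTwo h N Finset.univ p x) :
    (Nat.card (LinearMap.ker N.mulVecLin) : ℚ) = ∏ x, (2 : ℚ) ^ pivotExp (p x) := by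
  have hsym : ∀ x y, N x y = N y x := by
    intro x y
    by_cases h0 : N x y = 0
    · by_cases h1 : N y x = 0
      · rw [h0, h1]
      · exact absurd h0 (hN.symm _ _ h1)
    · rw [ZMod.two_eq_one_of_ne_zero h0, ZMod.two_eq_one_of_ne_zero (hN.symm _ _ h0)]
  rw [← card_ker_two_aux h p _ Finset.univ N rfl hsym (fun x _ y _ h1 h2 => hN.ne x y h2 h1)
    (fun x _ y _ z _ => hN.uniq x y z) (fun x _ => hrec x)]
  norm_cast
  refine Nat.card_congr (Equiv.subtypeEquivRight fun v => ?_)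
  rw [LinearMap.mem_ker, Matrix.mulVecLin_apply, funext_iff]
  simp [Matrix.mulVec, dotProduct]

/-! ### Signed permutations and their orbits -/

open Equiv.Perm in
/-- The orbits of a permutation. -/
def PermOrbit {X : Type*} (τ : Equiv.Perm X) : Type _ := Quotient (SameCycle.setoid τ)

namespace PermOrbit

variable {X : Type*} {τ : Equiv.Perm X}

/-- The orbit of an element. -/
def mk (τ : Equiv.Perm X) (x : X) : PermOrbit τ := Quotient.mk (Equiv.Perm.SameCycle.setoid τ) x

/-- A representative of an orbit. -/
noncomputable def rep (o : PermOrbit τ) : X := Quotient.out o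

@[simp] theorem mk_rep (o : PermOrbit τ) : mk τ o.rep = o := Quotient.out_eq o

noncomputable instance [Fintype X] : Fintype (PermOrbit τ) := by
  classical exact inferInstanceAs (Fintype (Quotient (Equiv.Perm.SameCycle.setoid τ)))

noncomputable instance : DecidableEq (PermOrbit τ) := Classical.decEq _

theorem mk_eq_iff {x y : X} : mk τ x = mk τ y ↔ τ.SameCycle x y := Quotient.eq

theorem mk_pow (k : ℕ) (x : X) : mk τ ((τ ^ k) x) = mk τ x :=
  mk_eq_iff.2 (Equiv.Perm.sameCycle_pow_left.2 (Equiv.Perm.SameCycle.refl _ _))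

@[simp] theorem mk_apply (x : X) : mk τ (τ x) = mk τ x := mk_pow 1 x

theorem exists_pow [Finite X] {x y : X} (h : mk τ x = mk τ y) : ∃ k : ℕ, (τ ^ k) x = y :=
  (mk_eq_iff.1 h).exists_nat_pow_eq

theorem eq_of_invariant [Finite X] {α : Type*} {F : X → α} (hF : ∀ x, F (τ x) = F x) {x y : X}
    (h : mk τ x = mk τ y) : F x = F y := by
  obtain ⟨k, rfl⟩ := exists_pow h
  clear h
  induction k with
  | zero => rfl
  | succ k ih => rw [pow_succ', Equiv.Perm.mul_apply, hF, ← ih]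

end PermOrbit

theorem Equiv.Perm.pow_apply_eq_self_iff {X : Type*} (τ : Equiv.Perm X) (k : ℕ) (x : X) :
    (τ ^ k) x = x ↔ Function.minimalPeriod τ x ∣ k := by
  rw [← Function.isPeriodicPt_iff_minimalPeriod_dvd, Function.IsPeriodicPt, Function.IsFixedPt,
    ← Equiv.Perm.coe_pow]

section Period

variable {X : Type*} [Fintype X] (τ : Equiv.Perm X)

theorem Equiv.Perm.minimalPeriod_pos (x : X) : 0 < Function.minimalPeriod τ x := by
  refine Function.IsPeriodicPt.minimalPeriod_pos (orderOf_pos τ) ?_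
  rw [Function.IsPeriodicPt, Function.IsFixedPt, ← Equiv.Perm.coe_pow, pow_orderOf_eq_one]
  rfl

theorem Equiv.Perm.minimalPeriod_apply_self (x : X) :
    Function.minimalPeriod τ (τ x) = Function.minimalPeriod τ x :=
  Function.minimalPeriod_apply
    (Function.minimalPeriod_pos_iff_mem_periodicPts.1 (τ.minimalPeriod_pos x))

theorem Equiv.Perm.minimalPeriod_eq_of_orbit {x y : X} (h : PermOrbit.mk τ x = PermOrbit.mk τ y) :
    Function.minimalPeriod τ x = Function.minimalPeriod τ y :=
  PermOrbit.eq_of_invariant (F := fun x => Function.minimalPeriod τ x)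
    τ.minimalPeriod_apply_self h

theorem PermOrbit.card_fiber (x : X) :
    (Finset.univ.filter fun y => PermOrbit.mk τ y = PermOrbit.mk τ x).card =
      Function.minimalPeriod τ x := by
  classical
  have : (Finset.univ.filter fun y => PermOrbit.mk τ y = PermOrbit.mk τ x) =
      (Finset.range (Function.minimalPeriod τ x)).image fun i => τ^[i] x := by
    ext y
    simp only [Finset.mem_filter, Finset.mem_univ, true_and, Finset.mem_image, Finset.mem_range]
    constructor
    · intro h
      obtain ⟨k, rfl⟩ := PermOrbit.exists_pow h.symm
      refine ⟨k % Function.minimalPeriod τ x, Nat.mod_lt _ (τ.minimalPeriod_pos x), ?_⟩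
      rw [Function.iterate_mod_minimalPeriod_eq, Equiv.Perm.coe_pow]
    · rintro ⟨i, -, rfl⟩
      rw [← Equiv.Perm.coe_pow, PermOrbit.mk_pow]
  rw [this, Finset.card_image_of_injOn, Finset.card_range]
  intro i hi j hj hij
  exact Function.iterate_injOn_Iio_minimalPeriod (by simpa using hi) (by simpa using hj) hij

end Period

/-! ### Signs accumulated along the orbits of a signed permutation. -/

section SignProd

variable {X : Type*} (τ : Equiv.Perm X) (θ : X → ℤˣ)

/-- The sign by which the `k`-th power of the signed permutation `(τ, θ)` acts at `x`. -/
def signProd (k : ℕ) (x : X) : ℤˣ := ∏ i ∈ Finset.range k, θ ((τ ^ i) x)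

@[simp] theorem signProd_zero (x : X) : signProd τ θ 0 x = 1 := rfl

@[simp] theorem signProd_one (x : X) : signProd τ θ 1 x = θ x := by simp [signProd]

theorem signProd_add (k l : ℕ) (x : X) :
    signProd τ θ (k + l) x = signProd τ θ k x * signProd τ θ l ((τ ^ k) x) := by
  rw [signProd, Finset.prod_range_add]
  refine congrArg (_ * ·) (Finset.prod_congr rfl fun i _ => ?_)
  rw [← Equiv.Perm.mul_apply, ← pow_add, add_comm]

theorem signProd_succ' (k : ℕ) (x : X) :
    signProd τ θ (k + 1) x = θ x * signProd τ θ k (τ x) := by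
  rw [add_comm, signProd_add, signProd_one, pow_one]

theorem signProd_pow (f k : ℕ) (x : X) :
    signProd (τ ^ f) (signProd τ θ f) k x = signProd τ θ (f * k) x := by
  induction k with
  | zero => rfl
  | succ k ih => rw [signProd_add, ih, signProd_one, mul_add, mul_one, signProd_add, ← pow_mul]

theorem signProd_mul_of_fixed {k : ℕ} {x : X} (h : (τ ^ k) x = x) (m : ℕ) :
    signProd τ θ (k * m) x = signProd τ θ k x ^ m := by
  induction m with
  | zero => simp
  | succ m ih =>
    have : (τ ^ (k * m)) x = x := by
      rw [pow_mul]
      exact Function.IsFixedPt.perm_pow h m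
    rw [mul_add, mul_one, signProd_add, ih, this, pow_succ]

/-- The total sign of the signed permutation `(τ, θ)` around the orbit of `x`. -/
noncomputable def orbitSign (x : X) : ℤˣ := signProd τ θ (Function.minimalPeriod τ x) x

theorem signProd_eq_orbitSign_pow [Fintype X] {x : X} {k : ℕ}
    (h : Function.minimalPeriod τ x ∣ k) :
    signProd τ θ k x = orbitSign τ θ x ^ (k / Function.minimalPeriod τ x) := by
  obtain ⟨m, rfl⟩ := h
  rw [Nat.mul_div_cancel_left _ (τ.minimalPeriod_pos x), orbitSign, signProd_mul_of_fixed]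
  exact (τ.pow_apply_eq_self_iff _ _).2 dvd_rfl

theorem orbitSign_apply [Fintype X] (x : X) : orbitSign τ θ (τ x) = orbitSign τ θ x := by
  have h1 := signProd_succ' τ θ (Function.minimalPeriod τ x) x
  have h2 := signProd_add τ θ (Function.minimalPeriod τ x) 1 x
  rw [(τ.pow_apply_eq_self_iff _ _).2 dvd_rfl, signProd_one, h1, mul_comm] at h2
  rw [orbitSign, orbitSign, τ.minimalPeriod_apply_self]
  exact mul_right_cancel h2

theorem orbitSign_eq_of_orbit [Fintype X] {x y : X} (h : PermOrbit.mk τ x = PermOrbit.mk τ y) :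
    orbitSign τ θ x = orbitSign τ θ y :=
  PermOrbit.eq_of_invariant (orbitSign_apply τ θ) h

/-- Two runs with the same endpoint differ by full turns round the orbit, each of sign `1`. This
makes `orbitGauge` independent of the chosen exponent. -/
theorem signProd_eq_of_pow_eq [Fintype X] {x : X} (hx : orbitSign τ θ x = 1) {k l : ℕ}
    (h : (τ ^ k) x = (τ ^ l) x) : signProd τ θ k x = signProd τ θ l x := by
  wlog hkl : k ≤ l generalizing k l
  · exact (this h.symm (le_of_not_ge hkl)).symm
  obtain ⟨m, rfl⟩ := Nat.exists_eq_add_of_le hkl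
  rw [pow_add, Equiv.Perm.mul_apply, EmbeddingLike.apply_eq_iff_eq, eq_comm,
    τ.pow_apply_eq_self_iff] at h
  have h1 : (τ ^ m) x = x := (τ.pow_apply_eq_self_iff _ _).2 h
  rw [add_comm, signProd_add, h1, signProd_eq_orbitSign_pow τ θ h, hx, one_pow, one_mul]

/-- The linear automorphism sending the basis vector at `x` to `θ x` times that at `τ x`. -/
def signedPerm : (X → ℤ) →ₗ[ℤ] (X → ℤ) where
  toFun u x := (θ (τ.symm x) : ℤ) * u (τ.symm x)
  map_add' u v := funext fun x => mul_add _ _ _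
  map_smul' k u := funext fun x => by
    simp only [Pi.smul_apply, smul_eq_mul, RingHom.id_apply]
    ring

theorem signedPerm_apply (u : X → ℤ) (x : X) :
    signedPerm τ θ u (τ x) = (θ x : ℤ) * u x := by
  simp [signedPerm]

theorem signedPerm_pow (k : ℕ) :
    signedPerm τ θ ^ k = signedPerm (τ ^ k) (signProd τ θ k) := by
  induction k with
  | zero =>
    refine LinearMap.ext fun u => funext fun x => ?_
    rw [pow_zero, Module.End.one_apply]
    change u x = ((1 : ℤˣ) : ℤ) * u x
    simp
  | succ k ih =>
    refine LinearMap.ext fun u => funext fun x => ?_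
    obtain ⟨y, rfl⟩ := (τ ^ (k + 1)).surjective x
    rw [signedPerm_apply, pow_succ', Module.End.mul_apply, ih, pow_succ', Equiv.Perm.mul_apply,
      signedPerm_apply, signedPerm_apply, signProd_add, signProd_one]
    push_cast
    ring

/-- A coherent choice of signs along the orbits of total sign `1`, extended by zero. -/
noncomputable def orbitGauge [Fintype X] (x : X) : ℤ :=
  if orbitSign τ θ x = 1 then
    (signProd τ θ (PermOrbit.exists_pow (PermOrbit.mk_rep (PermOrbit.mk τ x))).choose
      (PermOrbit.mk τ x).rep : ℤ)
  else 0

theorem orbitGauge_of_ne [Fintype X] {x : X} (h : orbitSign τ θ x ≠ 1) : orbitGauge τ θ x = 0 :=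
  if_neg h

theorem orbitGauge_pow_rep [Fintype X] (o : PermOrbit τ) (h : orbitSign τ θ o.rep = 1) (k : ℕ) :
    orbitGauge τ θ ((τ ^ k) o.rep) = (signProd τ θ k o.rep : ℤ) := by
  have h1 : PermOrbit.mk τ ((τ ^ k) o.rep) = o := by rw [PermOrbit.mk_pow, PermOrbit.mk_rep]
  have h2 : orbitSign τ θ ((τ ^ k) o.rep) = 1 := by
    rw [← h]
    exact orbitSign_eq_of_orbit τ θ (PermOrbit.mk_pow k _)
  rw [orbitGauge, if_pos h2]
  have h3 := (PermOrbit.exists_pow (PermOrbit.mk_rep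
    (PermOrbit.mk τ ((τ ^ k) o.rep)))).choose_spec
  generalize (PermOrbit.exists_pow (PermOrbit.mk_rep
    (PermOrbit.mk τ ((τ ^ k) o.rep)))).choose = l at h3 ⊢
  rw [h1] at h3 ⊢
  rw [signProd_eq_of_pow_eq τ θ h h3]

theorem orbitGauge_rep [Fintype X] (o : PermOrbit τ) (h : orbitSign τ θ o.rep = 1) :
    orbitGauge τ θ o.rep = 1 :=
  (orbitGauge_pow_rep τ θ o h 0).trans (by simp)

/-- Conjugating by the gauge removes the signs on good orbits. Extension by zero makes the relation
hold on bad orbits too, so later sums need no case distinction. -/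
theorem orbitGauge_apply [Fintype X] (x : X) :
    orbitGauge τ θ (τ x) = θ x * orbitGauge τ θ x := by
  by_cases h : orbitSign τ θ x = 1
  · obtain ⟨k, hk⟩ := PermOrbit.exists_pow (PermOrbit.mk_rep (PermOrbit.mk τ x))
    have h' : orbitSign τ θ (PermOrbit.mk τ x).rep = 1 := by
      rw [← h]
      exact orbitSign_eq_of_orbit τ θ (PermOrbit.mk_rep _)
    have h1 := orbitGauge_pow_rep τ θ _ h' k
    have h2 := orbitGauge_pow_rep τ θ _ h' (k + 1)
    rw [hk] at h1
    rw [pow_succ', Equiv.Perm.mul_apply, signProd_add, signProd_one, hk] at h2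
    rw [h2, h1, Units.val_mul, mul_comm]
  · rw [orbitGauge_of_ne τ θ h, orbitGauge_of_ne τ θ (by rwa [orbitSign_apply]), mul_zero]

theorem orbitGauge_mul_self [Fintype X] {x : X} (h : orbitSign τ θ x = 1) :
    orbitGauge τ θ x * orbitGauge τ θ x = 1 := by
  rw [orbitGauge, if_pos h, ← Units.val_mul, Int.units_mul_self, Units.val_one]

end SignProd

/-! ### Coinvariants under a signed permutation, and the matrices induced on them. -/

section OrbitMatrix

variable {X : Type*} [Fintype X] (τ : Equiv.Perm X) (θ : X → ℤˣ)

theorem PermOrbit.sum_fiber_apply {A : Type*} [AddCommMonoid A] (o : PermOrbit τ) (f : X → A) :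
    ∑ y with PermOrbit.mk τ y = o, f (τ y) = ∑ y with PermOrbit.mk τ y = o, f y := by
  rw [Finset.sum_filter, Finset.sum_filter,
    ← Equiv.sum_comp τ fun y => if PermOrbit.mk τ y = o then f y else 0]
  simp only [PermOrbit.mk_apply]

/-- The orbits around which the total sign is `1`. -/
abbrev GoodOrbit : Type _ := {o : PermOrbit τ // orbitSign τ θ o.rep = 1}

/-- The orbits around which the total sign is `-1`. -/
abbrev BadOrbit : Type _ := {o : PermOrbit τ // ¬ orbitSign τ θ o.rep = 1}

theorem orbitSign_rep (x : X) : orbitSign τ θ (PermOrbit.mk τ x).rep = orbitSign τ θ x :=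
  orbitSign_eq_of_orbit τ θ (PermOrbit.mk_rep _)

theorem orbitSign_of_mk_eq {o : PermOrbit τ} {x : X} (h : PermOrbit.mk τ x = o) :
    orbitSign τ θ x = orbitSign τ θ o.rep := by
  rw [← h, orbitSign_rep]

theorem sum_goodOrbit_add_badOrbit {A : Type*} [AddCommMonoid A] (f : X → A) :
    ∑ o : GoodOrbit τ θ, ∑ x with PermOrbit.mk τ x = o, f x +
      ∑ o : BadOrbit τ θ, ∑ x with PermOrbit.mk τ x = o, f x = ∑ x, f x := by
  rw [Fintype.sum_subtype_add_sum_subtype (fun o : PermOrbit τ => orbitSign τ θ o.rep = 1)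
    (fun o : PermOrbit τ => ∑ x with PermOrbit.mk τ x = o, f x), Finset.sum_fiberwise]

/-- The matrix induced on orbits by an invariant matrix. -/
noncomputable def orbitMatrix {R : Type*} [AddCommMonoid R] (M : Matrix X X R) :
    Matrix (PermOrbit τ) (PermOrbit τ) R :=
  Matrix.of fun o' o => ∑ y with PermOrbit.mk τ y = o', M y o.rep

theorem orbitMatrix_mk {R : Type*} [AddCommMonoid R] {M : Matrix X X R}
    (hM : ∀ x y, M (τ x) (τ y) = M x y) (o : PermOrbit τ) (x : X) :
    orbitMatrix τ M o (PermOrbit.mk τ x) = ∑ y with PermOrbit.mk τ y = o, M y x := by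
  refine PermOrbit.eq_of_invariant
    (F := fun x => ∑ y with PermOrbit.mk τ y = o, M y x) (fun x => ?_) (PermOrbit.mk_rep _)
  rw [← PermOrbit.sum_fiber_apply]
  simp only [hM]

/-- The integer matrix induced on the orbits of total sign `1`. -/
noncomputable def goodMatrix (M : Matrix X X ℤ) : Matrix (GoodOrbit τ θ) (GoodOrbit τ θ) ℤ :=
  (orbitMatrix τ (Matrix.of fun y x => orbitGauge τ θ y * M y x * orbitGauge τ θ x)).submatrix
    Subtype.val Subtype.val

/-- The matrix over `𝔽₂` induced on the orbits of total sign `-1`. -/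
noncomputable def badMatrix (M : Matrix X X ℤ) : Matrix (BadOrbit τ θ) (BadOrbit τ θ) (ZMod 2) :=
  (orbitMatrix τ (M.map (Int.cast : ℤ → ZMod 2))).submatrix Subtype.val Subtype.val

/-- The projection to the coinvariants along orbits of total sign `1`. -/
noncomputable def goodProj : (X → ℤ) →ₗ[ℤ] (GoodOrbit τ θ → ℤ) where
  toFun u o := ∑ y with PermOrbit.mk τ y = o.1, orbitGauge τ θ y * u y
  map_add' u v := funext fun o => by simp [mul_add, Finset.sum_add_distrib]
  map_smul' k u := funext fun o => by
    simp only [Pi.smul_apply, smul_eq_mul, RingHom.id_apply, Finset.mul_sum]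
    exact Finset.sum_congr rfl fun y _ => by ring

/-- The projection to the coinvariants along orbits of total sign `-1`. -/
noncomputable def badProj : (X → ℤ) →ₗ[ℤ] (BadOrbit τ θ → ZMod 2) where
  toFun u o := ∑ y with PermOrbit.mk τ y = o.1, (u y : ZMod 2)
  map_add' u v := funext fun o => by simp [Finset.sum_add_distrib]
  map_smul' k u := funext fun o => by
    simp [Finset.mul_sum]

theorem goodProj_signedPerm (u : X → ℤ) :
    goodProj τ θ (signedPerm τ θ u) = goodProj τ θ u := by
  funext o
  change ∑ y with _ = _, _ = ∑ y with _ = _, _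
  rw [← PermOrbit.sum_fiber_apply]
  refine Finset.sum_congr rfl fun y _ => ?_
  rw [signedPerm_apply, orbitGauge_apply]
  have : (θ y : ℤ) * θ y = 1 := by rw [← Units.val_mul, Int.units_mul_self, Units.val_one]
  linear_combination (orbitGauge τ θ y * u y) * this

theorem ZMod.intCast_units_two (a : ℤˣ) : ((a : ℤ) : ZMod 2) = 1 := by
  rcases Int.units_eq_one_or a with rfl | rfl <;> decide

theorem badProj_signedPerm (u : X → ℤ) :
    badProj τ θ (signedPerm τ θ u) = badProj τ θ u := by
  funext o
  change ∑ y with _ = _, _ = ∑ y with _ = _, _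
  rw [← PermOrbit.sum_fiber_apply]
  refine Finset.sum_congr rfl fun y _ => ?_
  rw [signedPerm_apply, Int.cast_mul, ZMod.intCast_units_two, one_mul]

variable {τ θ} {M : Matrix X X ℤ} (hM : ∀ x y, M (τ x) (τ y) = θ x * θ y * M x y)
include hM

omit [Fintype X] in
theorem equivariant_pow (k : ℕ) (x y : X) :
    M ((τ ^ k) x) ((τ ^ k) y) = signProd τ θ k x * signProd τ θ k y * M x y := by
  induction k with
  | zero => simp
  | succ k ih =>
    rw [pow_succ', Equiv.Perm.mul_apply, Equiv.Perm.mul_apply, hM, ih, signProd_add, signProd_add,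
      signProd_one, signProd_one]
    push_cast
    ring

/-- As a function of `x` the sum transforms by `θ`, so one turn round the orbit of `x` replaces it
by its negative. This is the vanishing of the block from bad orbits to good ones. -/
theorem orbitGauge_sum_eq_zero (o : PermOrbit τ) {x : X} (hx : orbitSign τ θ x ≠ 1) :
    ∑ y with PermOrbit.mk τ y = o, orbitGauge τ θ y * M y x = 0 := by
  set g : X → ℤ := fun x => ∑ y with PermOrbit.mk τ y = o, orbitGauge τ θ y * M y x with hg
  have h1 : ∀ x, g (τ x) = θ x * g x := by
    intro x
    simp only [hg]
    rw [← PermOrbit.sum_fiber_apply, Finset.mul_sum]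
    refine Finset.sum_congr rfl fun y _ => ?_
    rw [hM, orbitGauge_apply]
    have : (θ y : ℤ) * θ y = 1 := by rw [← Units.val_mul, Int.units_mul_self, Units.val_one]
    linear_combination (orbitGauge τ θ y * M y x * θ x) * this
  have h2 : ∀ k : ℕ, g ((τ ^ k) x) = signProd τ θ k x * g x := by
    intro k
    induction k with
    | zero => simp
    | succ k ih =>
      rw [pow_succ', Equiv.Perm.mul_apply, h1, ih, signProd_add, signProd_one]
      push_cast
      ring
  have h3 := h2 (Function.minimalPeriod τ x)
  rw [(τ.pow_apply_eq_self_iff _ _).2 dvd_rfl] at h3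
  change g x = (orbitSign τ θ x : ℤ) * g x at h3
  rw [(Int.units_eq_one_or _).resolve_left hx] at h3
  change g x = 0
  push_cast at h3
  linarith

theorem orbitGauge_conj_invariant (x y : X) :
    (Matrix.of fun y x => orbitGauge τ θ y * M y x * orbitGauge τ θ x) (τ x) (τ y) =
    (Matrix.of fun y x => orbitGauge τ θ y * M y x * orbitGauge τ θ x) x y := by
  simp only [Matrix.of_apply]
  rw [hM, orbitGauge_apply, orbitGauge_apply]
  have h1 : (θ x : ℤ) * θ x = 1 := by rw [← Units.val_mul, Int.units_mul_self, Units.val_one]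
  have h2 : (θ y : ℤ) * θ y = 1 := by rw [← Units.val_mul, Int.units_mul_self, Units.val_one]
  linear_combination (orbitGauge τ θ x * M x y * orbitGauge τ θ y * θ y * θ y) * h1 +
    (orbitGauge τ θ x * M x y * orbitGauge τ θ y) * h2

omit [Fintype X] in
theorem map_two_invariant (x y : X) :
    M.map (Int.cast : ℤ → ZMod 2) (τ x) (τ y) = M.map (Int.cast : ℤ → ZMod 2) x y := by
  simp only [Matrix.map_apply, hM, Int.cast_mul, ZMod.intCast_units_two, one_mul]

/-- The good coordinates of `M u` involve only the good coordinates of `u`: the bad orbits drop out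
by `orbitGauge_sum_eq_zero`, and on a good orbit the gauge squares to `1`. -/
theorem goodProj_mulVec (u : X → ℤ) :
    goodProj τ θ (M.mulVec u) = (goodMatrix τ θ M).mulVec (goodProj τ θ u) := by
  funext o
  have h1 : goodProj τ θ (M.mulVec u) o =
      ∑ x, (∑ y with PermOrbit.mk τ y = o.1, orbitGauge τ θ y * M y x) * u x := by
    simp only [goodProj, LinearMap.coe_mk, AddHom.coe_mk, Matrix.mulVec, dotProduct,
      Finset.mul_sum, Finset.sum_mul]
    rw [Finset.sum_comm]
    simp only [mul_assoc]
  rw [h1, ← sum_goodOrbit_add_badOrbit τ θ, Finset.sum_eq_zero (s := Finset.univ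
    (α := BadOrbit τ θ)), add_zero]
  · simp only [Matrix.mulVec, dotProduct]
    refine Finset.sum_congr rfl fun o' _ => ?_
    simp only [goodProj, LinearMap.coe_mk, AddHom.coe_mk, Finset.mul_sum]
    refine Finset.sum_congr rfl fun x hx => ?_
    rw [Finset.mem_filter] at hx
    rw [goodMatrix, Matrix.submatrix_apply, ← hx.2,
      orbitMatrix_mk τ (orbitGauge_conj_invariant hM)]
    simp only [Matrix.of_apply]
    rw [← Finset.sum_mul]
    have h2 := orbitGauge_mul_self τ θ (x := x) (by
      rw [orbitSign_of_mk_eq τ θ hx.2]; exact o'.2)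
    linear_combination (-(∑ y with PermOrbit.mk τ y = o.1, orbitGauge τ θ y * M y x) * u x) * h2
  · intro o' _
    refine Finset.sum_eq_zero fun x hx => ?_
    rw [Finset.mem_filter] at hx
    rw [orbitGauge_sum_eq_zero hM, zero_mul]
    rw [orbitSign_of_mk_eq τ θ hx.2]
    exact o'.2

/-- The block from good to bad orbits need not vanish, whence the hypothesis on `u`: modulo `2` the
sum of `u` over a good orbit is its good coordinate. -/
theorem badProj_mulVec {u : X → ℤ} (hu : goodProj τ θ u = 0) :
    badProj τ θ (M.mulVec u) = (badMatrix τ θ M).mulVec (badProj τ θ u) := by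
  funext o
  have h1 : badProj τ θ (M.mulVec u) o =
      ∑ x, orbitMatrix τ (M.map (Int.cast : ℤ → ZMod 2)) o.1 (PermOrbit.mk τ x) *
        (u x : ZMod 2) := by
    simp only [orbitMatrix_mk τ (map_two_invariant hM)]
    simp only [badProj, LinearMap.coe_mk, AddHom.coe_mk, Matrix.mulVec, dotProduct,
      Int.cast_sum, Finset.sum_mul]
    rw [Finset.sum_comm]
    simp
  rw [h1, ← sum_goodOrbit_add_badOrbit τ θ, Finset.sum_eq_zero (s := Finset.univ
    (α := GoodOrbit τ θ)), zero_add]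
  · simp only [Matrix.mulVec, dotProduct]
    refine Finset.sum_congr rfl fun o' _ => ?_
    simp only [badProj, LinearMap.coe_mk, AddHom.coe_mk, Finset.mul_sum]
    refine Finset.sum_congr rfl fun x hx => ?_
    rw [Finset.mem_filter] at hx
    rw [hx.2]
    rfl
  · intro o' _
    have h2 : ∑ x with PermOrbit.mk τ x = o'.1, (u x : ZMod 2) = 0 := by
      have h3 : goodProj τ θ u o' = 0 := congrFun hu o'
      have h4 : ((goodProj τ θ u o' : ℤ) : ZMod 2) = 0 := by rw [h3, Int.cast_zero]
      rw [← h4]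
      simp only [goodProj, LinearMap.coe_mk, AddHom.coe_mk, Int.cast_sum, Int.cast_mul]
      refine Finset.sum_congr rfl fun x hx => ?_
      rw [Finset.mem_filter] at hx
      rw [orbitGauge, if_pos (by rw [orbitSign_of_mk_eq τ θ hx.2]; exact o'.2),
        ZMod.intCast_units_two, one_mul]
    rw [← mul_zero (orbitMatrix τ (M.map (Int.cast : ℤ → ZMod 2)) o.1 o'.1), ← h2, Finset.mul_sum]
    refine Finset.sum_congr rfl fun x hx => ?_
    rw [Finset.mem_filter] at hx
    rw [hx.2]

omit hM

variable (τ θ)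

omit [Fintype X] in
theorem mk_single_pow [DecidableEq X] (k : ℕ) (x : X) :
    (LinearMap.range (signedPerm τ θ - 1)).mkQ (Pi.single ((τ ^ k) x) 1) =
      (signProd τ θ k x : ℤ) • (LinearMap.range (signedPerm τ θ - 1)).mkQ (Pi.single x 1) := by
  induction k with
  | zero => simp
  | succ k ih =>
    have h1 : ∀ y, (LinearMap.range (signedPerm τ θ - 1)).mkQ (Pi.single (τ y) 1) =
        (θ y : ℤ) • (LinearMap.range (signedPerm τ θ - 1)).mkQ (Pi.single y 1) := by
      intro y
      have h2 : signedPerm τ θ (Pi.single y 1) = (θ y : ℤ) • Pi.single (τ y) 1 := by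
        funext z
        obtain ⟨w, rfl⟩ := τ.surjective z
        rw [signedPerm_apply]
        by_cases hwy : w = y
        · subst hwy; simp
        · simp [hwy]
      have h3 : (LinearMap.range (signedPerm τ θ - 1)).mkQ
          (signedPerm τ θ (Pi.single y 1) - Pi.single y 1) = 0 :=
        (Submodule.Quotient.mk_eq_zero _).2 ⟨Pi.single y 1, rfl⟩
      rw [map_sub, h2, sub_eq_zero, map_smul] at h3
      rw [← h3, smul_smul, ← Units.val_mul, Int.units_mul_self, Units.val_one, one_smul]
    rw [pow_succ', Equiv.Perm.mul_apply, h1, ih, smul_smul, signProd_add, signProd_one,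
      mul_comm, ← Units.val_mul]

/-- In the quotient the basis vectors of one orbit agree up to sign, and a total sign `-1` makes
their common class killed by `2`. So the two projections detect all coinvariants. -/
theorem mem_range_signedPerm_sub_one {u : X → ℤ} (hg : goodProj τ θ u = 0)
    (hb : badProj τ θ u = 0) : u ∈ LinearMap.range (signedPerm τ θ - 1) := by
  classical
  set π := (LinearMap.range (signedPerm τ θ - 1)).mkQ with hπ
  have hu : π u = 0 := by
    have h0 : u = ∑ x, u x • Pi.single x (1 : ℤ) := by
      funext y
      simp [Finset.sum_apply, Pi.single_apply]
    rw [h0, map_sum, ← sum_goodOrbit_add_badOrbit τ θ, Finset.sum_eq_zero, Finset.sum_eq_zero,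
      add_zero]
    · rintro ⟨o, ho⟩ -
      have h2 : (2 : ℤ) • π (Pi.single o.rep 1) = 0 := by
        have h3 := mk_single_pow τ θ (Function.minimalPeriod τ o.rep) o.rep
        rw [(τ.pow_apply_eq_self_iff _ _).2 dvd_rfl] at h3
        change π _ = (orbitSign τ θ o.rep : ℤ) • π _ at h3
        rw [(Int.units_eq_one_or _).resolve_left ho, Units.val_neg, Units.val_one, neg_smul,
          one_smul] at h3
        rw [two_smul]
        nth_rewrite 1 [h3]
        simp
      have h4 : ∀ x, PermOrbit.mk τ x = o → π (Pi.single x 1) = π (Pi.single o.rep 1) := by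
        intro x hx
        obtain ⟨k, rfl⟩ := PermOrbit.exists_pow ((PermOrbit.mk_rep o).trans hx.symm)
        rw [hπ, mk_single_pow, ← hπ]
        rcases Int.units_eq_one_or (signProd τ θ k o.rep) with h | h
        · rw [h]; simp
        · rw [h, Units.val_neg, Units.val_one, neg_smul, one_smul, neg_eq_iff_add_eq_zero,
            ← two_smul ℤ, h2]
      have h5 : ((∑ x with PermOrbit.mk τ x = o, u x : ℤ) : ZMod 2) = 0 := by
        rw [Int.cast_sum]
        exact congrFun hb ⟨o, ho⟩
      rw [ZMod.intCast_zmod_eq_zero_iff_dvd] at h5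
      obtain ⟨m, hm⟩ := h5
      rw [Finset.sum_congr rfl fun x hx => by
        rw [map_smul, h4 x (Finset.mem_filter.1 hx).2], ← Finset.sum_smul, hm]
      push_cast
      rw [mul_comm, mul_smul, h2, smul_zero]
    · rintro ⟨o, ho⟩ -
      have h4 : ∀ x, PermOrbit.mk τ x = o →
          π (Pi.single x 1) = orbitGauge τ θ x • π (Pi.single o.rep 1) := by
        intro x hx
        obtain ⟨k, rfl⟩ := PermOrbit.exists_pow ((PermOrbit.mk_rep o).trans hx.symm)
        rw [hπ, mk_single_pow, orbitGauge_pow_rep τ θ o ho]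
      rw [Finset.sum_congr rfl fun x hx => by
        rw [map_smul, h4 x (Finset.mem_filter.1 hx).2, smul_smul, mul_comm], ← Finset.sum_smul]
      have h5 : ∑ x with PermOrbit.mk τ x = o, orbitGauge τ θ x * u x = 0 := congrFun hg ⟨o, ho⟩
      rw [h5, zero_smul]
  exact (Submodule.Quotient.mk_eq_zero _).1 hu

theorem exists_proj_eq (z : GoodOrbit τ θ → ℤ) (w : BadOrbit τ θ → ZMod 2) :
    ∃ u, goodProj τ θ u = z ∧ badProj τ θ u = w := by
  classical
  have hrep : ∀ (o : PermOrbit τ) (y : X), PermOrbit.mk τ y = o →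
      ((PermOrbit.mk τ y).rep = y ↔ y = o.rep) := by
    rintro o y rfl
    exact eq_comm
  refine ⟨fun y => if (PermOrbit.mk τ y).rep = y then
    (if h : orbitSign τ θ (PermOrbit.mk τ y).rep = 1 then z ⟨_, h⟩
      else ((w ⟨PermOrbit.mk τ y, h⟩).val : ℤ)) else 0, ?_, ?_⟩
  · funext ⟨o, ho⟩
    simp only [goodProj, LinearMap.coe_mk, AddHom.coe_mk]
    rw [Finset.sum_eq_single o.rep]
    · simp [ho, orbitGauge_rep τ θ o ho]
    · intro y hy hne
      rw [Finset.mem_filter] at hy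
      rw [if_neg (mt (hrep o y hy.2).1 hne), mul_zero]
    · simp
  · funext ⟨o, ho⟩
    simp only [badProj, LinearMap.coe_mk, AddHom.coe_mk]
    rw [Finset.sum_eq_single o.rep]
    · simp [ho]
    · intro y hy hne
      rw [Finset.mem_filter] at hy
      rw [if_neg (mt (hrep o y hy.2).1 hne), Int.cast_zero]
    · simp

/-- Kernel and cokernel of an endomorphism of a finite group have equal order, both being the order
of the group divided by that of the image. Applied to `ρ - 1`, this trades invariants for
coinvariants. -/
theorem LinearMap.index_range_eq_card_ker {A : Type*} [AddCommGroup A] [Finite A]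
    (f : A →ₗ[ℤ] A) : (LinearMap.range f).toAddSubgroup.index = Nat.card (LinearMap.ker f) := by
  have h1 := (LinearMap.range f).toAddSubgroup.card_mul_index
  have h2 := (LinearMap.ker f).toAddSubgroup.card_mul_index
  have h3 : (LinearMap.ker f).toAddSubgroup.index = Nat.card (LinearMap.range f) :=
    AddSubgroup.index_ker f.toAddMonoidHom
  rw [h3] at h2
  have h4 : 0 < Nat.card (LinearMap.range f) := Nat.card_pos
  refine Nat.eq_of_mul_eq_mul_left h4 ?_
  rw [mul_comm _ (Nat.card (LinearMap.ker f))]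
  exact h1.trans h2.symm

variable {τ θ}
include hM

/-- The order of the coinvariants of the cokernel of an equivariant matrix. -/
theorem card_coinvariants (hdet : (goodMatrix τ θ M).det ≠ 0) :
    Nat.card ((X → ℤ) ⧸ (LinearMap.range M.mulVecLin ⊔ LinearMap.range (signedPerm τ θ - 1))) =
      (goodMatrix τ θ M).det.natAbs * Nat.card (LinearMap.ker (badMatrix τ θ M).mulVecLin) := by
  set N := LinearMap.range M.mulVecLin ⊔ LinearMap.range (signedPerm τ θ - 1) with hN
  set A := goodMatrix τ θ M
  set D := badMatrix τ θ M
  set K := LinearMap.ker (goodProj τ θ) with hK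
  have hsg : Function.Surjective (goodProj τ θ) := fun z =>
    let ⟨u, hu, _⟩ := exists_proj_eq τ θ z 0
    ⟨u, hu⟩
  -- The index of `N` is split through `N ⊔ K`, with `K` the kernel of the good projection: the
  -- upper step sees only `A`, the lower one only `D`.
  have hNK : N ⊔ K = (LinearMap.range A.mulVecLin).comap (goodProj τ θ) := by
    refine le_antisymm (sup_le (sup_le ?_ ?_) ?_) ?_
    · rintro _ ⟨u, rfl⟩
      exact ⟨goodProj τ θ u, (goodProj_mulVec hM u).symm⟩
    · rintro _ ⟨u, rfl⟩
      refine ⟨0, ?_⟩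
      simp [goodProj_signedPerm]
    · intro u hu
      exact ⟨0, by rw [map_zero, LinearMap.mem_ker.1 hu]⟩
    · rintro u ⟨z, hz⟩
      obtain ⟨v, rfl⟩ := hsg z
      have h1 : u = M.mulVecLin v + (u - M.mulVecLin v) := by abel
      rw [h1]
      refine Submodule.add_mem_sup (Submodule.mem_sup_left ⟨v, rfl⟩) ?_
      rw [hK, LinearMap.mem_ker, map_sub, ← hz, sub_eq_zero]
      exact (goodProj_mulVec hM v).symm
  -- Injectivity of `A` enters here: if the good coordinates of `M v` vanish, so do those of `v`,
  -- and `badProj_mulVec` applies to `v`.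
  have hNK' : N ⊓ K = (LinearMap.range (D.mulVecLin.restrictScalars ℤ)).comap (badProj τ θ) ⊓ K := by
    ext u
    simp only [Submodule.mem_inf, Submodule.mem_comap]
    refine and_congr_left fun huK => ?_
    rw [hK, LinearMap.mem_ker] at huK
    constructor
    · intro hu
      obtain ⟨_, ⟨v, rfl⟩, _, ⟨v', rfl⟩, rfl⟩ := Submodule.mem_sup.1 hu
      have h1 : goodProj τ θ v = 0 := by
        rw [map_add, LinearMap.sub_apply, map_sub, Module.End.one_apply, goodProj_signedPerm,
          sub_self, add_zero, Matrix.mulVecLin_apply, goodProj_mulVec hM] at huK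
        exact Matrix.eq_zero_of_mulVec_eq_zero hdet huK
      refine ⟨badProj τ θ v, ?_⟩
      rw [map_add, LinearMap.sub_apply, map_sub, Module.End.one_apply, badProj_signedPerm,
          sub_self, add_zero, Matrix.mulVecLin_apply, badProj_mulVec hM h1]
      rfl
    · rintro ⟨w, hw⟩
      obtain ⟨v, hv, rfl⟩ := exists_proj_eq τ θ 0 w
      have h1 : u = M.mulVecLin v + (u - M.mulVecLin v) := by abel
      rw [h1]
      refine Submodule.add_mem_sup ⟨v, rfl⟩ (mem_range_signedPerm_sub_one τ θ ?_ ?_)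
      · rw [map_sub, huK, Matrix.mulVecLin_apply, goodProj_mulVec hM, hv]
        simp
      · rw [map_sub, ← hw, Matrix.mulVecLin_apply, badProj_mulVec hM hv]
        exact sub_self _
  have h1 : (N ⊔ K).toAddSubgroup.index = A.det.natAbs := by
    rw [← card_quotient_range_mulVecLin A hdet, hNK]
    exact (LinearMap.range A.mulVecLin).toAddSubgroup.index_comap_of_surjective
      (f := (goodProj τ θ).toAddMonoidHom) hsg
  have h2 : N.toAddSubgroup.relIndex (N ⊔ K).toAddSubgroup = Nat.card (LinearMap.ker D.mulVecLin) := by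
    rw [Submodule.sup_toAddSubgroup N K, AddSubgroup.relIndex_sup_left,
      ← AddSubgroup.inf_relIndex_right, show N.toAddSubgroup ⊓ K.toAddSubgroup = (N ⊓ K).toAddSubgroup from rfl, hNK',
      show ∀ L : Submodule ℤ (X → ℤ), (L ⊓ K).toAddSubgroup = L.toAddSubgroup ⊓ K.toAddSubgroup
        from fun _ => rfl, AddSubgroup.inf_relIndex_right]
    have h3 := AddSubgroup.relIndex_comap (f := (badProj τ θ).toAddMonoidHom)
      (LinearMap.range (D.mulVecLin.restrictScalars ℤ)).toAddSubgroup K.toAddSubgroup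
    have h4 : K.toAddSubgroup.map (badProj τ θ).toAddMonoidHom = ⊤ := by
      refine eq_top_iff.2 fun w _ => ?_
      obtain ⟨v, hv, hw⟩ := exists_proj_eq τ θ 0 w
      exact ⟨v, hv, hw⟩
    rw [h4, AddSubgroup.relIndex_top_right, LinearMap.index_range_eq_card_ker] at h3
    exact h3
  calc _ = N.toAddSubgroup.index := rfl
    _ = N.toAddSubgroup.relIndex (N ⊔ K).toAddSubgroup * (N ⊔ K).toAddSubgroup.index :=
      (AddSubgroup.relIndex_mul_index (Submodule.toAddSubgroup_mono le_sup_left)).symm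
    _ = _ := by rw [h1, h2, mul_comm]

end OrbitMatrix

/-! ### Equivariant matrices supported on rooted forests -/

/-- `M` is a symmetric integer matrix, equivariant for the signed permutation `(τ, θ)`, whose
off-diagonal entries are `0` or `±1` and are supported on a forest rooted by the invariant height
function `h`. -/
structure IsForestForm {X : Type*} (τ : Equiv.Perm X) (θ : X → ℤˣ) (h : X → ℕ)
    (M : Matrix X X ℤ) : Prop where
  symm : ∀ x y, M x y = M y x
  equivariant : ∀ x y, M (τ x) (τ y) = θ x * θ y * M x y
  height : ∀ x, h (τ x) = h x
  ne : ∀ x y, M x y ≠ 0 → x ≠ y → h x ≠ h y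
  uniq : ∀ x y z, h x < h y → h x < h z → M x y ≠ 0 → M x z ≠ 0 → y = z
  unit : ∀ x y, x ≠ y → M x y ≠ 0 → M x y * M x y = 1

/-- The number of elements of the orbit `o'` adjacent to the representative of `o`. -/
noncomputable def childCount {X : Type*} [Fintype X] {τ : Equiv.Perm X} (M : Matrix X X ℤ)
    (o o' : PermOrbit τ) : ℕ :=
  (Finset.univ.filter fun y => PermOrbit.mk τ y = o' ∧ M o.rep y ≠ 0).card

/-- `N` is a matrix on a set of orbits of `τ` which is diagonally similar to the matrix induced by
`M`, up to signs. -/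
structure IsOrbitForm {X R : Type*} [Fintype X] [CommRing R] {τ : Equiv.Perm X} (h : X → ℕ)
    (M : Matrix X X ℤ) {P : PermOrbit τ → Prop} (N : Matrix {o // P o} {o // P o} R) : Prop where
  rooted : N.IsRooted fun o => h o.1.rep
  diag : ∀ o, N o o = M o.1.rep o.1.rep
  prod : ∀ o o', h o'.1.rep < h o.1.rep → N o o' * N o' o = childCount M o.1 o'.1

namespace IsForestForm

variable {X : Type*} {τ : Equiv.Perm X} {θ : X → ℤˣ} {h : X → ℕ} {M : Matrix X X ℤ}

theorem height_pow (F : IsForestForm τ θ h M) (k : ℕ) (x : X) : h ((τ ^ k) x) = h x := by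
  induction k with
  | zero => rfl
  | succ k ih => rw [pow_succ', Equiv.Perm.mul_apply, F.height, ih]

theorem pow [Fintype X] (F : IsForestForm τ θ h M) (f : ℕ) :
    IsForestForm (τ ^ f) (signProd τ θ f) h M where
  symm := F.symm
  equivariant := equivariant_pow F.equivariant f
  height := F.height_pow f
  ne := F.ne
  uniq := F.uniq
  unit := F.unit

theorem ne_zero_symm (F : IsForestForm τ θ h M) {x y : X} (hxy : M x y ≠ 0) : M y x ≠ 0 :=
  F.symm x y ▸ hxy

theorem ne_zero_apply (F : IsForestForm τ θ h M) {x y : X} :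
    M (τ x) (τ y) ≠ 0 ↔ M x y ≠ 0 := by
  rw [F.equivariant]
  simp

theorem ne_zero_pow (F : IsForestForm τ θ h M) (k : ℕ) {x y : X} :
    M ((τ ^ k) x) ((τ ^ k) y) ≠ 0 ↔ M x y ≠ 0 := by
  induction k with
  | zero => rfl
  | succ k ih => rw [pow_succ', Equiv.Perm.mul_apply, Equiv.Perm.mul_apply, F.ne_zero_apply, ih]

theorem parent_unique (F : IsForestForm τ θ h M) {x x' y : X} (hx : h y < h x) (hx' : h y < h x')
    (hM : M x y ≠ 0) (hM' : M x' y ≠ 0) : x = x' :=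
  F.uniq y x x' hx hx' (F.ne_zero_symm hM) (F.ne_zero_symm hM')

variable [Fintype X]

theorem height_eq (F : IsForestForm τ θ h M) {x y : X} (hxy : PermOrbit.mk τ x = PermOrbit.mk τ y) :
    h x = h y :=
  PermOrbit.eq_of_invariant F.height hxy

theorem height_rep (F : IsForestForm τ θ h M) (x : X) : h (PermOrbit.mk τ x).rep = h x :=
  F.height_eq (PermOrbit.mk_rep _)

theorem diag_eq (F : IsForestForm τ θ h M) {x y : X} (hxy : PermOrbit.mk τ x = PermOrbit.mk τ y) :
    M x x = M y y := by
  refine PermOrbit.eq_of_invariant (F := fun x => M x x) (fun x => ?_) hxy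
  rw [F.equivariant, ← Units.val_mul, Int.units_mul_self, Units.val_one, one_mul]

/-- The number of neighbours in a given orbit is constant along orbits. -/
theorem card_adj_eq (F : IsForestForm τ θ h M) {x x' : X}
    (hx : PermOrbit.mk τ x = PermOrbit.mk τ x') (o : PermOrbit τ) :
    (Finset.univ.filter fun y => PermOrbit.mk τ y = o ∧ M x y ≠ 0).card =
    (Finset.univ.filter fun y => PermOrbit.mk τ y = o ∧ M x' y ≠ 0).card := by
  refine PermOrbit.eq_of_invariant (F := fun x =>
    (Finset.univ.filter fun y => PermOrbit.mk τ y = o ∧ M x y ≠ 0).card) (fun x => ?_) hx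
  refine (Finset.card_bij (fun y _ => τ y) ?_ ?_ ?_).symm
  · intro y hy
    simp only [Finset.mem_filter, Finset.mem_univ, true_and] at hy ⊢
    rwa [PermOrbit.mk_apply, F.ne_zero_apply]
  · intro y _ z _ hyz
    exact τ.injective hyz
  · intro y hy
    obtain ⟨z, rfl⟩ := τ.surjective y
    simp only [Finset.mem_filter, Finset.mem_univ, true_and] at hy
    rw [PermOrbit.mk_apply, F.ne_zero_apply] at hy
    exact ⟨z, by simpa using hy, rfl⟩

theorem childCount_mk (F : IsForestForm τ θ h M) (x : X) (o : PermOrbit τ) :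
    childCount M (PermOrbit.mk τ x) o =
      (Finset.univ.filter fun y => PermOrbit.mk τ y = o ∧ M x y ≠ 0).card :=
  F.card_adj_eq (PermOrbit.mk_rep _) o

theorem childCount_ne_zero (F : IsForestForm τ θ h M) {x y : X} (hxy : M x y ≠ 0) :
    childCount M (PermOrbit.mk τ x) (PermOrbit.mk τ y) ≠ 0 := by
  rw [F.childCount_mk]
  exact Finset.card_ne_zero.2 ⟨y, by simpa using hxy⟩

/-- The period and the sign of a child in terms of those of its parent. -/
theorem child_period (F : IsForestForm τ θ h M) {x y : X} (hyx : h y < h x) (hxy : M x y ≠ 0) :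
    Function.minimalPeriod τ y =
      childCount M (PermOrbit.mk τ x) (PermOrbit.mk τ y) * Function.minimalPeriod τ x ∧
    orbitSign τ θ y =
      orbitSign τ θ x ^ childCount M (PermOrbit.mk τ x) (PermOrbit.mk τ y) := by
  classical
  set k := childCount M (PermOrbit.mk τ x) (PermOrbit.mk τ y) with hk
  have hper : Function.minimalPeriod τ y = k * Function.minimalPeriod τ x := by
    -- Adjacent pairs between the two orbits are counted twice: each element above has `k` children,
    -- each element below exactly one parent.
    have h1 : ∑ x' with PermOrbit.mk τ x' = PermOrbit.mk τ x,
        (Finset.univ.filter fun y' => PermOrbit.mk τ y' = PermOrbit.mk τ y ∧ M x' y' ≠ 0).card =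
        k * Function.minimalPeriod τ x := by
      rw [Finset.sum_const_nat (m := k), PermOrbit.card_fiber, mul_comm]
      intro x' hx'
      rw [hk, F.childCount_mk]
      exact F.card_adj_eq (Finset.mem_filter.1 hx').2 _
    have h2 : ∑ y' with PermOrbit.mk τ y' = PermOrbit.mk τ y,
        (Finset.univ.filter fun x' => PermOrbit.mk τ x' = PermOrbit.mk τ x ∧ M x' y' ≠ 0).card =
        Function.minimalPeriod τ y := by
      rw [Finset.sum_const_nat (m := 1), PermOrbit.card_fiber, mul_one]
      intro y' hy'
      obtain ⟨j, rfl⟩ := PermOrbit.exists_pow (Finset.mem_filter.1 hy').2.symm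
      rw [Finset.card_eq_one]
      refine ⟨(τ ^ j) x, Finset.ext fun x' => ?_⟩
      simp only [Finset.mem_filter, Finset.mem_univ, true_and, Finset.mem_singleton]
      constructor
      · rintro ⟨hx', hM⟩
        refine F.parent_unique ?_ ?_ hM ((F.ne_zero_pow j).2 hxy)
        · rw [F.height_pow, F.height_eq hx']
          exact hyx
        · rwa [F.height_pow, F.height_pow]
      · rintro rfl
        exact ⟨PermOrbit.mk_pow _ _, (F.ne_zero_pow j).2 hxy⟩
    rw [← h1, ← h2]
    simp only [← Finset.filter_filter]
    convert (Finset.sum_card_bipartiteAbove_eq_sum_card_bipartiteBelow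
      (s := Finset.univ.filter fun x' => PermOrbit.mk τ x' = PermOrbit.mk τ x)
      (t := Finset.univ.filter fun y' => PermOrbit.mk τ y' = PermOrbit.mk τ y)
      fun a b => M a b ≠ 0).symm <;>
    · ext
      simp [Finset.bipartiteBelow, Finset.bipartiteAbove]
  refine ⟨hper, ?_⟩
  -- After one period of `y` both `x` and `y` have returned; since `M x y ≠ 0` their accumulated
  -- signs agree, and `x` has then made `k` turns.
  have h1 := equivariant_pow F.equivariant (Function.minimalPeriod τ y) x y
  rw [(τ.pow_apply_eq_self_iff _ _).2 dvd_rfl, (τ.pow_apply_eq_self_iff _ x).2 ⟨k, by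
    rw [hper, mul_comm]⟩] at h1
  have h2 : ((signProd τ θ (Function.minimalPeriod τ y) x *
      signProd τ θ (Function.minimalPeriod τ y) y : ℤˣ) : ℤ) = 1 := by
    rw [Units.val_mul]
    exact mul_right_cancel₀ hxy (by rw [← h1, one_mul])
  rw [Units.val_eq_one, mul_eq_one_iff_eq_inv, Int.units_inv_eq_self] at h2
  rw [orbitSign, ← h2, hper, mul_comm, signProd_mul_of_fixed]
  · rfl
  · exact (τ.pow_apply_eq_self_iff _ _).2 dvd_rfl

theorem good_of_child (F : IsForestForm τ θ h M) {x y : X} (hyx : h y < h x) (hxy : M x y ≠ 0)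
    (hx : orbitSign τ θ x = 1) : orbitSign τ θ y = 1 := by
  rw [(F.child_period hyx hxy).2, hx, one_pow]

/-- The sign of the child is a `childCount`th power, which could not be `-1` for an even exponent.
Counts between bad orbits are thus `1` in `𝔽₂`, and reduction modulo `2` loses no edge of the
forest. -/
theorem odd_childCount (F : IsForestForm τ θ h M) {x y : X} (hyx : h y < h x) (hxy : M x y ≠ 0)
    (hy : orbitSign τ θ y ≠ 1) : Odd (childCount M (PermOrbit.mk τ x) (PermOrbit.mk τ y)) := by
  rw [(F.child_period hyx hxy).2] at hy
  by_contra hodd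
  rw [Nat.not_odd_iff_even] at hodd
  obtain ⟨m, hm⟩ := hodd
  exact hy (by rw [hm, ← two_mul, pow_mul, Int.units_sq, one_pow])

/-- Good children of a bad orbit are invisible modulo `2`; this is used for the integrality in
`exists_det_rootMatrix`. -/
theorem even_childCount (F : IsForestForm τ θ h M) {x y : X} (hyx : h y < h x) (hxy : M x y ≠ 0)
    (hx : orbitSign τ θ x ≠ 1) (hy : orbitSign τ θ y = 1) :
    Even (childCount M (PermOrbit.mk τ x) (PermOrbit.mk τ y)) := by
  rw [(F.child_period hyx hxy).2] at hy
  by_contra hodd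
  rw [Nat.not_even_iff_odd] at hodd
  rw [(Int.units_eq_one_or _).resolve_left hx, hodd.neg_one_pow] at hy
  exact absurd hy (by decide)

theorem exists_of_childCount_ne_zero {o o' : PermOrbit τ} (hc : childCount M o o' ≠ 0) :
    ∃ y, PermOrbit.mk τ y = o' ∧ M o.rep y ≠ 0 := by
  obtain ⟨y, hy⟩ := Finset.card_ne_zero.1 hc
  exact ⟨y, by simpa using hy⟩

theorem childCount_ne_zero_symm (F : IsForestForm τ θ h M) {o o' : PermOrbit τ}
    (hc : childCount M o o' ≠ 0) : childCount M o' o ≠ 0 := by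
  obtain ⟨y, rfl, hy⟩ := exists_of_childCount_ne_zero hc
  have := F.childCount_ne_zero (F.ne_zero_symm hy)
  rwa [PermOrbit.mk_rep] at this

theorem ne_of_childCount (F : IsForestForm τ θ h M) {o o' : PermOrbit τ}
    (hc : childCount M o o' ≠ 0) (ho : o ≠ o') : h o.rep ≠ h o'.rep := by
  obtain ⟨y, rfl, hy⟩ := exists_of_childCount_ne_zero hc
  rw [F.height_rep]
  refine F.ne _ _ hy ?_
  rintro h1
  exact ho (by rw [← h1, PermOrbit.mk_rep])

theorem uniq_of_childCount (F : IsForestForm τ θ h M) {o o' o'' : PermOrbit τ}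
    (h1 : h o.rep < h o'.rep) (h2 : h o.rep < h o''.rep) (hc1 : childCount M o o' ≠ 0)
    (hc2 : childCount M o o'' ≠ 0) : o' = o'' := by
  obtain ⟨y, rfl, hy⟩ := exists_of_childCount_ne_zero hc1
  obtain ⟨z, rfl, hz⟩ := exists_of_childCount_ne_zero hc2
  rw [F.height_rep] at h1 h2
  rw [F.uniq _ y z h1 h2 hy hz]

/-- A criterion for a matrix to be an orbit form. -/
theorem isOrbitForm {R : Type*} [CommRing R] (F : IsForestForm τ θ h M)
    {P : PermOrbit τ → Prop} {N : Matrix {o // P o} {o // P o} R}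
    (hdiag : ∀ o, N o o = M o.1.rep o.1.rep)
    (hprod : ∀ o o', h o'.1.rep < h o.1.rep → N o o' * N o' o = childCount M o.1 o'.1)
    (hadj : ∀ o o', o ≠ o' → N o o' ≠ 0 → childCount M o.1 o'.1 ≠ 0)
    (hcast : ∀ o o' : {o // P o}, h o'.1.rep < h o.1.rep → childCount M o.1 o'.1 ≠ 0 →
      (childCount M o.1 o'.1 : R) ≠ 0) : IsOrbitForm h M N where
  diag := hdiag
  prod := hprod
  rooted :=
    { symm := by
        intro o o' hN
        by_cases hoo : o = o'
        · exact hoo ▸ hN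
        have hc := hadj o o' hoo hN
        rcases lt_or_gt_of_ne (F.ne_of_childCount hc fun h1 => hoo (Subtype.ext h1)) with hl | hl
        · have h1 := hcast o' o hl (F.childCount_ne_zero_symm hc)
          rw [← hprod o' o hl] at h1
          exact left_ne_zero_of_mul h1
        · have h1 := hcast o o' hl hc
          rw [← hprod o o' hl] at h1
          exact right_ne_zero_of_mul h1
      ne := fun o o' hN hoo =>
        F.ne_of_childCount (hadj o o' hoo hN) fun h1 => hoo (Subtype.ext h1)
      uniq := fun o o' o'' h1 h2 hN1 hN2 => Subtype.ext <|
        F.uniq_of_childCount h1 h2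
          (hadj o o' (by rintro rfl; exact lt_irrefl _ h1) hN1)
          (hadj o o'' (by rintro rfl; exact lt_irrefl _ h2) hN2) }

/-- The matrix induced on orbits by an unsigned invariant matrix is an orbit form. -/
theorem isOrbitForm_orbitMatrix {R : Type*} [CommRing R] (F : IsForestForm τ θ h M)
    {P : PermOrbit τ → Prop} (M' : Matrix X X R) (hinv : ∀ x y, M' (τ x) (τ y) = M' x y)
    (hadj : ∀ x y, P (PermOrbit.mk τ x) → P (PermOrbit.mk τ y) → (M' x y ≠ 0 → M x y ≠ 0))
    (hprod : ∀ x y, P (PermOrbit.mk τ x) → P (PermOrbit.mk τ y) → x ≠ y → M x y ≠ 0 →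
      M' x y * M' y x = 1)
    (hdiag : ∀ x, P (PermOrbit.mk τ x) → M' x x = M x x)
    (hcast : ∀ o o' : {o // P o}, h o'.1.rep < h o.1.rep → childCount M o.1 o'.1 ≠ 0 →
      (childCount M o.1 o'.1 : R) ≠ 0) :
    IsOrbitForm h M ((orbitMatrix τ M').submatrix (Subtype.val : {o // P o} → _) Subtype.val) := by
  refine F.isOrbitForm ?_ ?_ ?_ hcast
  · intro o
    rw [Matrix.submatrix_apply, orbitMatrix, Matrix.of_apply, Finset.sum_eq_single o.1.rep]
    · exact hdiag _ (by rw [PermOrbit.mk_rep]; exact o.2)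
    · intro y hy hne
      by_contra hM'
      rw [Finset.mem_filter] at hy
      refine F.ne y o.1.rep (hadj _ _ ?_ ?_ hM') hne (F.height_eq ?_)
      · rw [hy.2]; exact o.2
      · rw [PermOrbit.mk_rep]; exact o.2
      · rw [hy.2, PermOrbit.mk_rep]
    · simp
  · intro o o' hlt
    rw [Matrix.submatrix_apply, Matrix.submatrix_apply]
    nth_rewrite 2 [orbitMatrix]
    rw [Matrix.of_apply, Finset.mul_sum, childCount, Finset.card_filter, Nat.cast_sum,
      Finset.sum_filter]
    refine Finset.sum_congr rfl fun y _ => ?_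
    by_cases hy : PermOrbit.mk τ y = o'.1
    · have hPy : P (PermOrbit.mk τ y) := by rw [hy]; exact o'.2
      have hPo : P (PermOrbit.mk τ o.1.rep) := by rw [PermOrbit.mk_rep]; exact o.2
      have hyo : h y < h o.1.rep := by rwa [← F.height_rep, hy]
      by_cases hMy : M o.1.rep y = 0
      · rw [if_pos hy, if_neg (by simp [hMy])]
        have : M' y o.1.rep = 0 := by
          by_contra h0
          exact F.ne_zero_symm (hadj _ _ hPy hPo h0) hMy
        rw [this, mul_zero, Nat.cast_zero]
      -- The opposite entry is a sum over the orbit of the parent, in which `o.rep` is the only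
      -- element adjacent to `y`. Each child therefore contributes `1` to the product.
      · rw [if_pos hy, if_pos ⟨hy, hMy⟩, ← hy, orbitMatrix_mk τ hinv,
          Finset.sum_eq_single o.1.rep, Nat.cast_one]
        · exact hprod _ _ hPo hPy (by rintro rfl; exact lt_irrefl _ hyo) hMy
        · intro z hz hne
          rw [Finset.mem_filter] at hz
          by_contra hM'
          refine hne (F.parent_unique (y := y) ?_ hyo (hadj _ _ ?_ hPy hM') hMy)
          · rwa [← F.height_rep z, hz.2]
          · rw [hz.2]; exact o.2
        · simp
    · rw [if_neg hy, if_neg fun h1 => hy h1.1, Nat.cast_zero]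
  · intro o o' _ hN
    rw [Matrix.submatrix_apply, orbitMatrix, Matrix.of_apply] at hN
    obtain ⟨y, hy, hM'⟩ := Finset.exists_ne_zero_of_sum_ne_zero hN
    rw [Finset.mem_filter] at hy
    have h1 := F.childCount_ne_zero (hadj _ _ (by rw [hy.2]; exact o.2)
      (by rw [PermOrbit.mk_rep]; exact o'.2) hM')
    rwa [hy.2, PermOrbit.mk_rep] at h1

theorem isOrbitForm_goodMatrix (F : IsForestForm τ θ h M) :
    IsOrbitForm h M (goodMatrix τ θ M) := by
  have hs : ∀ x, orbitSign τ θ (PermOrbit.mk τ x).rep = 1 →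
      orbitGauge τ θ x * orbitGauge τ θ x = 1 := fun x hx =>
    orbitGauge_mul_self τ θ (by rwa [← orbitSign_rep])
  refine F.isOrbitForm_orbitMatrix _ (orbitGauge_conj_invariant F.equivariant) ?_ ?_ ?_ ?_
  · intro x y _ _ hM
    exact right_ne_zero_of_mul (left_ne_zero_of_mul hM)
  · intro x y hx hy hxy hM
    simp only [Matrix.of_apply]
    have h1 := F.unit x y hxy hM
    rw [F.symm y x]
    linear_combination (orbitGauge τ θ y * orbitGauge τ θ y * M x y * M x y) * hs x hx +
      (M x y * M x y) * hs y hy + h1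
  · intro x hx
    simp only [Matrix.of_apply, Int.cast_id]
    linear_combination M x x * hs x hx
  · intro o o' _ hc
    exact_mod_cast hc

omit [Fintype X] in
theorem intCast_two_ne_zero (F : IsForestForm τ θ h M) {x y : X} (hxy : x ≠ y) (hM : M x y ≠ 0) :
    (M x y : ZMod 2) = 1 := by
  rcases mul_self_eq_one_iff.1 (F.unit x y hxy hM) with h1 | h1 <;> rw [h1] <;> decide

theorem natCast_childCount (F : IsForestForm τ θ h M) {o o' : PermOrbit τ}
    (ho' : orbitSign τ θ o'.rep ≠ 1) (hl : h o'.rep < h o.rep) (hc : childCount M o o' ≠ 0) :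
    (childCount M o o' : ZMod 2) = 1 := by
  obtain ⟨y, rfl, hy⟩ := exists_of_childCount_ne_zero hc
  rw [F.height_rep] at hl
  have h1 := F.odd_childCount hl hy (by rwa [← orbitSign_rep])
  rw [PermOrbit.mk_rep] at h1
  exact (ZMod.natCast_eq_one_iff_odd).2 h1

theorem isOrbitForm_badMatrix (F : IsForestForm τ θ h M) :
    IsOrbitForm h M (badMatrix τ θ M) := by
  refine F.isOrbitForm_orbitMatrix _ (map_two_invariant F.equivariant) ?_ ?_ ?_ ?_
  · intro x y _ _ hM hM0
    exact hM (by rw [Matrix.map_apply, hM0, Int.cast_zero])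
  · intro x y hx hy hxy hM
    rw [Matrix.map_apply, Matrix.map_apply, F.symm y x, F.intCast_two_ne_zero hxy hM, one_mul]
  · intro x hx
    rw [Matrix.map_apply]
  · intro o o' hl hc
    rw [F.natCast_childCount o'.2 hl hc]
    exact one_ne_zero

end IsForestForm

/-! ### Pivots -/

section Pivots

variable {X : Type*} [Fintype X]

theorem sum_subtype_lt {A : Type*} [AddCommMonoid A] (h : X → ℕ) (x : X) (f : X → A) :
    ∑ y : {y // h y < h x}, f y = ∑ y with h y < h x, f y :=
  (Finset.sum_subtype _ (by simp) f).symm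

/-- The pivots over `ℚ` of the matrix `M + t`, eliminating indices by increasing height. -/
noncomputable def ratPivot (h : X → ℕ) (M : Matrix X X ℤ) (t : ℚ) (x : X) : ℚ :=
  (M x x : ℚ) + t - ∑ y : {y // h y < h x}, if M x y.1 ≠ 0 then (ratPivot h M t y.1)⁻¹ else 0
termination_by h x
decreasing_by exact y.2

theorem ratPivot_eq (h : X → ℕ) (M : Matrix X X ℤ) (t : ℚ) (x : X) :
    ratPivot h M t x =
      (M x x : ℚ) + t - ∑ y with h y < h x ∧ M x y ≠ 0, (ratPivot h M t y)⁻¹ := by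
  rw [ratPivot, ← Finset.filter_filter, Finset.sum_filter,
    sum_subtype_lt h x fun y => if M x y ≠ 0 then (ratPivot h M t y)⁻¹ else 0]

/-- For large `t`, all rational pivots are nonzero. -/
theorem exists_ratPivot_ne_zero (h : X → ℕ) (M : Matrix X X ℤ) :
    ∃ b : ℕ, ∀ t : ℕ, b ≤ t → ∀ x, ratPivot h M t x ≠ 0 := by
  -- This bound keeps every pivot at least `1`: inductively each inverse subtracted is at most `1`,
  -- and there are at most `Fintype.card X` of them.
  refine ⟨1 + Fintype.card X + ∑ x, (M x x).natAbs, fun t ht x => ?_⟩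
  suffices ∀ n x, h x = n → 1 ≤ ratPivot h M t x by
    exact (lt_of_lt_of_le one_pos (this _ x rfl)).ne'
  intro n
  induction n using Nat.strong_induction_on with
  | _ n ih =>
  rintro x rfl
  rw [ratPivot_eq]
  have h1 : ∑ y with h y < h x ∧ M x y ≠ 0, (ratPivot h M t y)⁻¹ ≤ Fintype.card X := by
    calc _ ≤ ∑ y with h y < h x ∧ M x y ≠ 0, (1 : ℚ) := by
          refine Finset.sum_le_sum fun y hy => ?_
          exact inv_le_one_of_one_le₀ (ih _ (Finset.mem_filter.1 hy).2.1 y rfl)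
      _ ≤ _ := by
          rw [Finset.sum_const, nsmul_eq_mul, mul_one]
          exact_mod_cast Finset.card_le_univ _
  have h2 : ((M x x).natAbs : ℚ) ≤ ((∑ x, (M x x).natAbs : ℕ) : ℚ) := by
    exact_mod_cast Finset.single_le_sum (f := fun x => (M x x).natAbs) (fun _ _ => Nat.zero_le _)
      (Finset.mem_univ x)
  have h3 : -((M x x).natAbs : ℚ) ≤ (M x x : ℚ) := by
    have : -((M x x).natAbs : ℤ) ≤ M x x := by omega
    exact_mod_cast this
  have h4 : ((1 + Fintype.card X + ∑ x, (M x x).natAbs : ℕ) : ℚ) ≤ (t : ℚ) := by exact_mod_cast ht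
  push_cast at h4 h2
  linarith

open Classical in
/-- The pivots over `𝔽₂` of the restriction of the matrix `M` to the indices satisfying `Bad`,
eliminating indices by increasing height; `none` stands for an infinite pivot. -/
noncomputable def twoPivot (h : X → ℕ) (M : Matrix X X ℤ) (Bad : X → Prop) (x : X) :
    Option (ZMod 2) :=
  if ∃ y : {y // h y < h x}, M x y.1 ≠ 0 ∧ Bad y.1 ∧ twoPivot h M Bad y.1 = some 0 then none
  else some ((M x x : ZMod 2) + ∑ y : {y // h y < h x},
    if M x y.1 ≠ 0 ∧ Bad y.1 ∧ twoPivot h M Bad y.1 = some 1 then 1 else 0)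
termination_by h x
decreasing_by all_goals exact (‹{y // h y < h x}›).2

theorem twoPivot_eq_none {h : X → ℕ} {M : Matrix X X ℤ} {Bad : X → Prop} {x y : X}
    (hyx : h y < h x) (hM : M x y ≠ 0) (hy : Bad y) (hp : twoPivot h M Bad y = some 0) :
    twoPivot h M Bad x = none := by
  rw [twoPivot, if_pos ⟨⟨y, hyx⟩, hM, hy, hp⟩]

open Classical in
theorem twoPivot_eq_some {h : X → ℕ} {M : Matrix X X ℤ} {Bad : X → Prop} {x : X}
    (hx : ∀ y, h y < h x → M x y ≠ 0 → Bad y → twoPivot h M Bad y ≠ some 0) :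
    twoPivot h M Bad x = some ((M x x : ZMod 2) +
      ∑ y, if h y < h x ∧ M x y ≠ 0 ∧ Bad y ∧ twoPivot h M Bad y = some 1 then 1 else 0) := by
  rw [twoPivot, if_neg]
  · rw [sum_subtype_lt h x fun y =>
      if M x y ≠ 0 ∧ Bad y ∧ twoPivot h M Bad y = some 1 then (1 : ZMod 2) else 0,
      Finset.sum_filter]
    simp only [ite_and]
  · rintro ⟨y, h1, h2, h3⟩
    exact hx _ y.2 h1 h2 h3

/-- Only the support below the diagonal and the diagonal modulo `2` enter the recursion. Hence the
dependence on `e` is through its parity. -/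
theorem twoPivot_congr {h : X → ℕ} {M M' : Matrix X X ℤ} {Bad : X → Prop}
    (hoff : ∀ x y, h y < h x → (M x y ≠ 0 ↔ M' x y ≠ 0))
    (hdiag : ∀ x, (M x x : ZMod 2) = M' x x) (x : X) :
    twoPivot h M Bad x = twoPivot h M' Bad x := by
  suffices ∀ n x, h x = n → twoPivot h M Bad x = twoPivot h M' Bad x from this _ x rfl
  intro n
  induction n using Nat.strong_induction_on with
  | _ n ih =>
  rintro x rfl
  by_cases hex : ∃ y, h y < h x ∧ M x y ≠ 0 ∧ Bad y ∧ twoPivot h M Bad y = some 0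
  · obtain ⟨y, h1, h2, h3, h4⟩ := hex
    rw [twoPivot_eq_none h1 h2 h3 h4,
      twoPivot_eq_none h1 ((hoff x y h1).1 h2) h3 (ih _ h1 y rfl ▸ h4)]
  · push Not at hex
    rw [twoPivot_eq_some hex, twoPivot_eq_some]
    · rw [hdiag]
      congr 2
      refine Finset.sum_congr rfl fun y _ => ?_
      have hiff : (h y < h x ∧ M x y ≠ 0 ∧ Bad y ∧ twoPivot h M Bad y = some 1) ↔
          (h y < h x ∧ M' x y ≠ 0 ∧ Bad y ∧ twoPivot h M' Bad y = some 1) :=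
        and_congr_right fun hy => by rw [ih _ hy y rfl, hoff x y hy]
      by_cases hc : h y < h x ∧ M x y ≠ 0 ∧ Bad y ∧ twoPivot h M Bad y = some 1
      · rw [if_pos hc, if_pos (hiff.1 hc)]
      · rw [if_neg hc, if_neg (mt hiff.2 hc)]
    · intro y h1 h2 h3
      rw [← ih _ h1 y rfl]
      exact hex y h1 ((hoff x y h1).2 h2) h3

theorem sum_orbit_subtype {τ : Equiv.Perm X} {A : Type*} [AddCommMonoid A]
    (P : PermOrbit τ → Prop) [DecidablePred P] (f : X → A)
    (hf : ∀ x, ¬ P (PermOrbit.mk τ x) → f x = 0) :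
    ∑ x, f x = ∑ o : {o // P o}, ∑ x with PermOrbit.mk τ x = o, f x := by
  rw [← Finset.sum_fiberwise Finset.univ (PermOrbit.mk τ) f,
    ← Fintype.sum_subtype_add_sum_subtype P, Finset.sum_eq_zero (s := Finset.univ
      (α := {o // ¬ P o})), add_zero]
  intro o _
  refine Finset.sum_eq_zero fun x hx => hf x ?_
  rw [(Finset.mem_filter.1 hx).2]
  exact o.2

namespace IsForestForm

variable {τ : Equiv.Perm X} {θ : X → ℤˣ} {h : X → ℕ} {M : Matrix X X ℤ}

theorem ratPivot_apply (F : IsForestForm τ θ h M) (t : ℚ) (x : X) :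
    ratPivot h M t (τ x) = ratPivot h M t x := by
  suffices ∀ n x, h x = n → ratPivot h M t (τ x) = ratPivot h M t x from this _ x rfl
  intro n
  induction n using Nat.strong_induction_on with
  | _ n ih =>
  rintro x rfl
  rw [ratPivot_eq, ratPivot_eq, F.diag_eq (PermOrbit.mk_apply x), Finset.sum_filter,
    Finset.sum_filter]
  congr 1
  rw [← Equiv.sum_comp τ]
  refine Finset.sum_congr rfl fun y _ => ?_
  have hiff : (h (τ y) < h (τ x) ∧ M (τ x) (τ y) ≠ 0) ↔ (h y < h x ∧ M x y ≠ 0) := by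
    rw [F.height, F.height, F.ne_zero_apply]
  by_cases hy : h y < h x ∧ M x y ≠ 0
  · rw [if_pos hy, if_pos (hiff.2 hy), ih _ hy.1 y rfl]
  · rw [if_neg hy, if_neg (mt hiff.1 hy)]

theorem twoPivot_apply (F : IsForestForm τ θ h M) {Bad : X → Prop}
    (hBad : ∀ x, Bad (τ x) ↔ Bad x) (x : X) :
    twoPivot h M Bad (τ x) = twoPivot h M Bad x := by
  suffices ∀ n x, h x = n → twoPivot h M Bad (τ x) = twoPivot h M Bad x from this _ x rfl
  intro n
  induction n using Nat.strong_induction_on with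
  | _ n ih =>
  rintro x rfl
  by_cases hex : ∃ y, h y < h x ∧ M x y ≠ 0 ∧ Bad y ∧ twoPivot h M Bad y = some 0
  · obtain ⟨y, h1, h2, h3, h4⟩ := hex
    rw [twoPivot_eq_none h1 h2 h3 h4]
    refine twoPivot_eq_none (y := τ y) ?_ (F.ne_zero_apply.2 h2) ((hBad y).2 h3) ?_
    · rwa [F.height, F.height]
    · rw [ih _ h1 y rfl, h4]
  · push Not at hex
    rw [twoPivot_eq_some hex, twoPivot_eq_some]
    · rw [F.diag_eq (PermOrbit.mk_apply x)]
      congr 2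
      rw [← Equiv.sum_comp τ]
      refine Finset.sum_congr rfl fun y _ => ?_
      have hiff : (h (τ y) < h (τ x) ∧ M (τ x) (τ y) ≠ 0 ∧ Bad (τ y) ∧
          twoPivot h M Bad (τ y) = some 1) ↔
          (h y < h x ∧ M x y ≠ 0 ∧ Bad y ∧ twoPivot h M Bad y = some 1) := by
        rw [F.height, F.height, F.ne_zero_apply, hBad]
        exact and_congr_right fun hy => by rw [ih _ hy y rfl]
      by_cases hc : h y < h x ∧ M x y ≠ 0 ∧ Bad y ∧ twoPivot h M Bad y = some 1
      · rw [if_pos hc, if_pos (hiff.2 hc)]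
      · rw [if_neg hc, if_neg (mt hiff.1 hc)]
    · intro y h1 h2 h3
      obtain ⟨z, rfl⟩ := τ.surjective y
      rw [F.height, F.height] at h1
      rw [ih _ h1 z rfl]
      exact hex z h1 (F.ne_zero_apply.1 h2) ((hBad z).1 h3)

/-- The determinant of a shifted orbit form as a product of pivots. -/
theorem det_add_smul_one (F : IsForestForm τ θ h M) {P : PermOrbit τ → Prop} [DecidablePred P]
    (hP : ∀ x y, P (PermOrbit.mk τ x) → h y < h x → M x y ≠ 0 → P (PermOrbit.mk τ y))
    {N : Matrix {o // P o} {o // P o} ℚ} (hN : IsOrbitForm h M N) (t : ℚ)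
    (ht : ∀ x, ratPivot h M t x ≠ 0) :
    (N + t • (1 : Matrix {o // P o} {o // P o} ℚ)).det =
      ∏ o : {o // P o}, ratPivot h M t o.1.rep := by
  have hoff : ∀ o o', o ≠ o' → (N + t • (1 : Matrix {o // P o} {o // P o} ℚ)) o o' = N o o' := by
    intro o o' hoo
    simp [Matrix.one_apply_ne hoo]
  have hr : (N + t • (1 : Matrix {o // P o} {o // P o} ℚ)).IsRooted fun o => h o.1.rep :=
    { symm := by
        intro o o' h1
        by_cases hoo : o = o'
        · exact hoo ▸ h1
        · rw [hoff _ _ hoo] at h1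
          rw [hoff _ _ (Ne.symm hoo)]
          exact hN.rooted.symm _ _ h1
      ne := fun o o' h1 hoo => hN.rooted.ne o o' (by rwa [hoff _ _ hoo] at h1) hoo
      uniq := by
        intro o o' o'' h1 h2 h3 h4
        rw [hoff _ _ (by rintro rfl; exact lt_irrefl _ h1)] at h3
        rw [hoff _ _ (by rintro rfl; exact lt_irrefl _ h2)] at h4
        exact hN.rooted.uniq o o' o'' h1 h2 h3 h4 }
  refine hr.det_eq_prod (fun o => ratPivot h M t o.1.rep) (fun o => ht _) fun o => ?_
  have h1 : (N + t • (1 : Matrix {o // P o} {o // P o} ℚ)) o o = M o.1.rep o.1.rep + t := by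
    simp [hN.diag]
  rw [ratPivot_eq, h1]
  congr 1
  -- An orbit `o'` contributes `childCount / pivot`, which is the sum of the inverse pivots of the
  -- children of `o.rep` in `o'`. So the orbit recursion is the elementwise recursion of `ratPivot`,
  -- grouped by orbits.
  rw [Finset.sum_filter, sum_orbit_subtype (τ := τ) (X := X) P, Finset.sum_filter]
  · refine Finset.sum_congr rfl fun o' _ => ?_
    split_ifs with hl
    · have hoo : o ≠ o' := by rintro rfl; exact lt_irrefl _ hl
      rw [hoff _ _ hoo, hoff _ _ hoo.symm, hN.prod o o' hl, childCount, Finset.card_filter,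
        Nat.cast_sum, Finset.sum_div, Finset.sum_filter]
      refine Finset.sum_congr rfl fun y _ => ?_
      by_cases hy : PermOrbit.mk τ y = o'.1
      · have hyl : h y < h o.1.rep := by rwa [← F.height_rep, hy]
        have hpv : ratPivot h M t y = ratPivot h M t o'.1.rep :=
          PermOrbit.eq_of_invariant (F.ratPivot_apply t) (by rw [hy, PermOrbit.mk_rep])
        simp only [hy, hyl, true_and, if_true, hpv]
        split_ifs <;> simp
      · simp [hy]
    · refine Finset.sum_eq_zero fun y hy => if_neg fun h2 => hl ?_
      rw [← (Finset.mem_filter.1 hy).2, F.height_rep]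
      exact h2.1
  · intro y hy
    refine if_neg fun h2 => hy (hP o.1.rep y ?_ h2.1 h2.2)
    rw [PermOrbit.mk_rep]
    exact o.2

/-- The order of the kernel of an orbit form over `𝔽₂` in terms of pivots. -/
theorem card_ker_orbitForm (F : IsForestForm τ θ h M) {Bad : X → Prop}
    (hBad : ∀ x, Bad (τ x) ↔ Bad x) {P : PermOrbit τ → Prop} [DecidablePred P]
    (hPB : ∀ x, P (PermOrbit.mk τ x) → Bad x)
    (hP : ∀ x y, P (PermOrbit.mk τ x) → h y < h x → M x y ≠ 0 → Bad y → P (PermOrbit.mk τ y))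
    (hodd : ∀ o o' : {o // P o}, h o'.1.rep < h o.1.rep → childCount M o.1 o'.1 ≠ 0 →
      (childCount M o.1 o'.1 : ZMod 2) = 1)
    {N : Matrix {o // P o} {o // P o} (ZMod 2)} (hN : IsOrbitForm h M N) :
    (Nat.card (LinearMap.ker N.mulVecLin) : ℚ) =
      ∏ o : {o // P o}, (2 : ℚ) ^ pivotExp (twoPivot h M Bad o.1.rep) := by
  classical
  have hcc : ∀ o o' : {o // P o}, h o'.1.rep < h o.1.rep →
      N o o' = (childCount M o.1 o'.1 : ZMod 2) := by
    intro o o' hl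
    rw [← hN.prod o o' hl]
    by_cases h0 : N o o' = 0
    · rw [h0, zero_mul]
    · rw [ZMod.two_eq_one_of_ne_zero h0, ZMod.two_eq_one_of_ne_zero (hN.rooted.symm _ _ h0)]
      rfl
  have hinv : ∀ (o : PermOrbit τ) y, PermOrbit.mk τ y = o →
      twoPivot h M Bad y = twoPivot h M Bad o.rep := fun o y hy =>
    PermOrbit.eq_of_invariant (F.twoPivot_apply hBad) (by rw [hy, PermOrbit.mk_rep])
  refine hN.rooted.card_ker_two (fun o => twoPivot h M Bad o.1.rep) fun o => ⟨?_, fun hex => ?_⟩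
  · rintro ⟨o', -, hl, hne, hp⟩
    rw [hcc o o' hl] at hne
    obtain ⟨y, hy, hM⟩ := exists_of_childCount_ne_zero fun h0 => hne (by rw [h0, Nat.cast_zero])
    refine twoPivot_eq_none (y := y) ?_ hM (hPB y (by rw [hy]; exact o'.2)) ?_
    · rwa [← F.height_rep, hy]
    · exact (hinv _ y hy).trans hp
  · push Not at hex
    have hPo : P (PermOrbit.mk τ o.1.rep) := by rw [PermOrbit.mk_rep]; exact o.2
    change twoPivot h M Bad o.1.rep = some (_ + _)
    rw [twoPivot_eq_some, hN.diag]
    · congr 2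
      rw [sum_orbit_subtype (τ := τ) (X := X) P, Finset.sum_filter]
      · refine Finset.sum_congr rfl fun o' _ => ?_
        split_ifs with hl
        · rw [hcc o o' hl.1, childCount, Finset.card_filter, Nat.cast_sum, Finset.sum_filter]
          refine Finset.sum_congr rfl fun y _ => ?_
          by_cases hy : PermOrbit.mk τ y = o'.1
          · have hyl : h y < h o.1.rep := by rw [← F.height_rep, hy]; exact hl.1
            have hyB : Bad y := hPB y (by rw [hy]; exact o'.2)
            simp only [hy, hyl, hyB, hinv _ y hy, hl.2, true_and, and_true, if_true]
            split_ifs <;> simp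
          · simp [hy]
        · refine Finset.sum_eq_zero fun y hy => if_neg fun h2 => hl ?_
          change h o'.1.rep < h o.1.rep ∧ twoPivot h M Bad o'.1.rep = some 1
          rw [← (Finset.mem_filter.1 hy).2, F.height_rep]
          refine ⟨h2.1, ?_⟩
          rw [← hinv _ y rfl]
          exact h2.2.2.2
      · intro y hy
        exact if_neg fun h2 => hy (hP o.1.rep y hPo h2.1 h2.2.1 h2.2.2.1)
    · intro y h1 h2 h3 h4
      have hPy := hP _ _ hPo h1 h2 h3
      have hl : h (PermOrbit.mk τ y).rep < h o.1.rep := by rwa [F.height_rep]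
      refine hex ⟨_, hPy⟩ (Finset.mem_univ _) hl ?_ ?_
      · rw [hcc o ⟨_, hPy⟩ hl, hodd o ⟨_, hPy⟩ hl]
        · exact one_ne_zero
        · have := F.childCount_ne_zero h2
          rwa [PermOrbit.mk_rep] at this
      · rw [← hinv _ y rfl, h4]

end IsForestForm

/-- An integer matrix on the set of orbits with the same pivots as the matrices induced by `M`. -/
noncomputable def quotMatrix (τ : Equiv.Perm X) (h : X → ℕ) (M : Matrix X X ℤ) :
    Matrix (PermOrbit τ) (PermOrbit τ) ℤ :=
  Matrix.of fun o o' => if o = o' then M o.rep o.rep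
    else if h o'.rep < h o.rep then childCount M o o'
    else if childCount M o o' = 0 then 0 else 1

/-- Pivots see only diagonal entries and products of opposite entries, so the gauge can be dispensed
with by putting the child count on one side and `1` on the other. This matrix makes sense on any set
of orbits, good or bad. -/
theorem IsForestForm.isOrbitForm_quotMatrix {τ : Equiv.Perm X} {θ : X → ℤˣ} {h : X → ℕ}
    {M : Matrix X X ℤ} {R : Type*} [CommRing R] (F : IsForestForm τ θ h M)
    (P : PermOrbit τ → Prop)
    (hcast : ∀ o o' : {o // P o}, h o'.1.rep < h o.1.rep → childCount M o.1 o'.1 ≠ 0 →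
      (childCount M o.1 o'.1 : R) ≠ 0) :
    IsOrbitForm h M (((quotMatrix τ h M).submatrix (Subtype.val : {o // P o} → _)
      Subtype.val).map (Int.cast : ℤ → R)) := by
  refine F.isOrbitForm ?_ ?_ ?_ hcast
  · intro o
    simp [quotMatrix]
  · intro o o' hl
    have hoo : o.1 ≠ o'.1 := by rintro h1; rw [h1] at hl; exact lt_irrefl _ hl
    simp only [quotMatrix, Matrix.map_apply, Matrix.submatrix_apply, Matrix.of_apply, if_neg hoo,
      if_neg hoo.symm, if_pos hl, if_neg hl.not_gt]
    by_cases hc : childCount M o.1 o'.1 = 0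
    · simp [hc]
    · rw [if_neg (F.childCount_ne_zero_symm hc)]
      simp
  · intro o o' hoo hN hc
    have hoo' : o.1 ≠ o'.1 := fun h1 => hoo (Subtype.ext h1)
    simp [quotMatrix, hoo', hc] at hN

end Pivots

/-! ### Orbits of powers -/

section PowOrbits

variable {X : Type*} (τ : Equiv.Perm X) (θ : X → ℤˣ)

theorem Equiv.Perm.minimalPeriod_pow {f : ℕ} (hf : 0 < f) (x : X) :
    Function.minimalPeriod (τ ^ f) x =
      Function.minimalPeriod τ x / (Function.minimalPeriod τ x).gcd f := by
  rw [Equiv.Perm.coe_pow, Function.minimalPeriod_iterate_eq_div_gcd hf.ne']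

variable [Fintype X]

/-- With `n` the `τ`-period of `x`, its orbit under `τ ^ f` takes `f · n / gcd(n, f)` steps of `τ`,
that is `f / gcd(n, f)` turns round the `τ`-orbit. -/
theorem orbitSign_pow {f : ℕ} (hf : 0 < f) (x : X) :
    orbitSign (τ ^ f) (signProd τ θ f) x =
      orbitSign τ θ x ^ (f / (Function.minimalPeriod τ x).gcd f) := by
  have hn := τ.minimalPeriod_pos x
  rw [orbitSign, signProd_pow, τ.minimalPeriod_pow hf]
  set n := Function.minimalPeriod τ x
  have h1 : f * (n / n.gcd f) = n * (f / n.gcd f) := by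
    rw [← Nat.mul_div_assoc _ (Nat.gcd_dvd_left n f), ← Nat.mul_div_assoc _ (Nat.gcd_dvd_right n f),
      mul_comm]
  rw [h1, signProd_eq_orbitSign_pow τ θ ⟨_, rfl⟩, Nat.mul_div_cancel_left _ hn]

theorem PermOrbit.card_pow_fiber {f : ℕ} (hf : 0 < f) (O : PermOrbit τ) :
    (Finset.univ.filter fun o : PermOrbit (τ ^ f) => PermOrbit.mk τ o.rep = O).card =
      (Function.minimalPeriod τ O.rep).gcd f := by
  set n := Function.minimalPeriod τ O.rep with hn
  have hmk : ∀ x, PermOrbit.mk τ (PermOrbit.mk (τ ^ f) x).rep = PermOrbit.mk τ x := fun x =>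
    PermOrbit.eq_of_invariant (τ := τ ^ f) (F := PermOrbit.mk τ) (PermOrbit.mk_pow f)
      (PermOrbit.mk_rep _)
  have h1 : ∑ o : PermOrbit (τ ^ f) with PermOrbit.mk τ o.rep = O,
      (Finset.univ.filter fun y => PermOrbit.mk (τ ^ f) y = o).card = n := by
    rw [hn, ← PermOrbit.card_fiber (τ := τ), PermOrbit.mk_rep,
      Finset.card_eq_sum_card_fiberwise (f := PermOrbit.mk (τ ^ f))
        (t := Finset.univ.filter fun o : PermOrbit (τ ^ f) => PermOrbit.mk τ o.rep = O)]
    · refine Finset.sum_congr rfl fun o ho => ?_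
      rw [Finset.filter_filter]
      congr 1
      ext y
      simp only [Finset.mem_filter, Finset.mem_univ, true_and]
      constructor
      · rintro rfl
        exact ⟨by rw [← hmk]; exact (Finset.mem_filter.1 ho).2, rfl⟩
      · exact fun h => h.2
    · intro y hy
      simpa [hmk] using hy
  rw [Finset.sum_const_nat (m := n / n.gcd f)] at h1
  · have hg : 0 < n.gcd f := Nat.gcd_pos_of_pos_right _ hf
    have h2 : n.gcd f * (n / n.gcd f) = n := Nat.mul_div_cancel' (Nat.gcd_dvd_left n f)
    have h3 : 0 < n / n.gcd f :=
      Nat.div_pos (Nat.le_of_dvd (τ.minimalPeriod_pos _) (Nat.gcd_dvd_left n f)) hg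
    exact Nat.eq_of_mul_eq_mul_right h3 (h1.trans h2.symm)
  · intro o ho
    have h2 : PermOrbit.mk τ o.rep = PermOrbit.mk τ O.rep := by
      rw [PermOrbit.mk_rep]
      exact (Finset.mem_filter.1 ho).2
    have h3 := PermOrbit.card_fiber (τ := τ ^ f) o.rep
    rw [PermOrbit.mk_rep] at h3
    rw [h3, τ.minimalPeriod_pow hf, τ.minimalPeriod_eq_of_orbit h2]

theorem PermOrbit.prod_pow {f : ℕ} (hf : 0 < f) {K : Type*} [CommMonoid K] (ψ : X → K)
    (hψ : ∀ x, ψ (τ x) = ψ x) :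
    ∏ o : PermOrbit (τ ^ f), ψ o.rep =
      ∏ O : PermOrbit τ, ψ O.rep ^ (Function.minimalPeriod τ O.rep).gcd f := by
  rw [← Finset.prod_fiberwise Finset.univ (fun o : PermOrbit (τ ^ f) => PermOrbit.mk τ o.rep)]
  refine Finset.prod_congr rfl fun O _ => ?_
  rw [← PermOrbit.card_pow_fiber τ hf, Finset.prod_eq_pow_card]
  intro o ho
  refine PermOrbit.eq_of_invariant hψ ?_
  rw [PermOrbit.mk_rep]
  exact (Finset.mem_filter.1 ho).2

end PowOrbits

/-! ### Sums of values of the totient function -/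

section Totient

theorem Nat.sum_totient_dvd (n : ℕ) {f : ℕ} (hf : 0 < f) :
    ∑ d ∈ f.divisors with d ∣ n, d.totient = n.gcd f := by
  have : f.divisors.filter (· ∣ n) = (n.gcd f).divisors := by
    ext d
    simp only [Finset.mem_filter, Nat.mem_divisors, Nat.dvd_gcd_iff]
    simp [hf.ne', and_comm]
  rw [this, Nat.sum_totient]

theorem Nat.gcd_two_mul (n : ℕ) {f : ℕ} (hf : 0 < f) :
    (2 * n).gcd f = if Even (f / n.gcd f) then 2 * n.gcd f else n.gcd f := by
  obtain ⟨n', f', hco, hn, hf'⟩ := Nat.exists_coprime n f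
  have hg : 0 < n.gcd f := Nat.gcd_pos_of_pos_right _ hf
  set g := n.gcd f
  have h1 : f / g = f' := by rw [hf', Nat.mul_div_cancel _ hg]
  have h2 : (2 * n).gcd f = Nat.gcd 2 f' * g := by
    rw [hn, hf', ← mul_assoc, Nat.gcd_mul_right, Nat.Coprime.gcd_mul_right_cancel _ hco]
  rw [h1, h2]
  split_ifs with he
  · rw [Nat.gcd_eq_left he.two_dvd]
  · rw [Nat.not_even_iff_odd] at he
    rw [(Nat.coprime_two_left.2 he).gcd_eq_one, one_mul]

theorem Nat.sum_totient_dvd_two_mul (n : ℕ) {f : ℕ} (hf : 0 < f) :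
    ∑ d ∈ f.divisors with d ∣ 2 * n ∧ ¬ d ∣ n, d.totient =
      if Even (f / n.gcd f) then n.gcd f else 0 := by
  have h1 := Nat.sum_totient_dvd (2 * n) hf
  rw [← Finset.sum_filter_add_sum_filter_not _ (fun d => d ∣ n), Finset.filter_filter,
    Finset.filter_filter] at h1
  have h2 : f.divisors.filter (fun d => d ∣ 2 * n ∧ d ∣ n) = f.divisors.filter (· ∣ n) :=
    Finset.filter_congr fun d _ => ⟨fun h => h.2, fun h => ⟨h.mul_left 2, h⟩⟩
  rw [h2, Nat.sum_totient_dvd n hf, Nat.gcd_two_mul n hf] at h1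
  split_ifs at h1 ⊢ <;> omega

/-- The condition on the sign `u` and the length `n` of an orbit for it to contribute to the
eigenspaces of primitive `d`-th roots of unity. -/
def HasRoots (u : ℤˣ) (n d : ℕ) : Prop := (u = 1 ∧ d ∣ n) ∨ (u ≠ 1 ∧ d ∣ 2 * n ∧ ¬ d ∣ n)

open Classical in
-- A signed cycle of length `n` and sign `u` has characteristic polynomial `X^n - u`, and `HasRoots`
-- says that primitive `d`th roots of unity are among its roots. Both sides count the roots `ζ` with
-- `ζ^f = 1`, equivalently the good orbits of the `f`th power.
theorem sum_totient_hasRoots (u : ℤˣ) (n : ℕ) {f : ℕ} (hf : 0 < f) :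
    ∑ d ∈ f.divisors with HasRoots u n d, d.totient =
      if u ^ (f / n.gcd f) = 1 then n.gcd f else 0 := by
  by_cases hu : u = 1
  · rw [if_pos (by rw [hu, one_pow]), ← Nat.sum_totient_dvd n hf]
    refine Finset.sum_congr (Finset.filter_congr fun d _ => ?_) fun _ _ => rfl
    simp [HasRoots, hu]
  · have h1 : u ^ (f / n.gcd f) = 1 ↔ Even (f / n.gcd f) := by
      rw [(Int.units_eq_one_or u).resolve_left hu]
      constructor
      · intro h
        by_contra hodd
        rw [(Nat.not_even_iff_odd.1 hodd).neg_one_pow] at h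
        exact absurd h (by decide)
      · exact fun h => h.neg_one_pow
    simp only [h1]
    rw [← Nat.sum_totient_dvd_two_mul n hf]
    refine Finset.sum_congr (Finset.filter_congr fun d _ => ?_) fun _ _ => rfl
    simp [HasRoots, hu]

open Classical in
-- Bad orbits are all `gcd(n, f)` orbits minus the good ones. The subtraction is what produces
-- quotients in `twoRatio`.
theorem sum_totient_bad (u : ℤˣ) (n : ℕ) {f : ℕ} (hf : 0 < f) :
    (∑ d ∈ f.divisors with u ≠ 1 ∧ d ∣ n, (d.totient : ℤ)) -
      ∑ d ∈ f.divisors with u ≠ 1 ∧ d ∣ 2 * n ∧ ¬ d ∣ n, (d.totient : ℤ) =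
      if u ^ (f / n.gcd f) = 1 then 0 else (n.gcd f : ℤ) := by
  by_cases hu : u = 1
  · simp [hu]
  · have h1 : u ^ (f / n.gcd f) = 1 ↔ Even (f / n.gcd f) := by
      rw [(Int.units_eq_one_or u).resolve_left hu]
      constructor
      · intro h
        by_contra hodd
        rw [(Nat.not_even_iff_odd.1 hodd).neg_one_pow] at h
        exact absurd h (by decide)
      · exact fun h => h.neg_one_pow
    simp only [h1, ne_eq, hu, not_false_eq_true, true_and]
    have h2 := Nat.sum_totient_dvd n hf
    have h3 := Nat.sum_totient_dvd_two_mul n hf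
    rw [← Nat.cast_sum, ← Nat.cast_sum, h2, h3]
    split_ifs <;> simp

/-- In polynomial terms, `X^n - u` divides `X^(kn) - u^k`. So the set of orbits attached to `d`
contains the children of its members and elimination can be restricted to it. -/
theorem HasRoots.child {u v : ℤˣ} {n m k d : ℕ} (hm : m = k * n) (hv : v = u ^ k)
    (h : HasRoots u n d) : HasRoots v m d := by
  subst hm hv
  rcases h with ⟨rfl, h⟩ | ⟨hu, h2, h1⟩
  · exact Or.inl ⟨one_pow _, h.mul_left k⟩
  · rcases Nat.even_or_odd k with hk | hk
    · refine Or.inl ⟨?_, ?_⟩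
      · rw [(Int.units_eq_one_or u).resolve_left hu, hk.neg_one_pow]
      · exact h2.trans (mul_dvd_mul_right hk.two_dvd n)
    · refine Or.inr ⟨?_, ?_, fun h3 => h1 ?_⟩
      · rw [(Int.units_eq_one_or u).resolve_left hu, hk.neg_one_pow]
        decide
      · exact h2.trans ⟨k, by ring⟩
      · have h4 := Nat.dvd_gcd h2 h3
        rwa [Nat.gcd_mul_right, (Nat.coprime_two_left.2 hk).gcd_eq_one, one_mul] at h4

/-- Here `X^n - u` divides `X^N - 1`, so its roots have order dividing `N`. -/
theorem HasRoots.dvd {u : ℤˣ} {n d N : ℕ} (h : HasRoots u n d) (hn : n ∣ N)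
    (hN : u ^ (N / n) = 1) (h0 : 0 < n) : d ∣ N := by
  rcases h with ⟨-, h⟩ | ⟨hu, h2, -⟩
  · exact h.trans hn
  · obtain ⟨m, rfl⟩ := hn
    rw [Nat.mul_div_cancel_left _ h0, (Int.units_eq_one_or u).resolve_left hu] at hN
    have hm : Even m := by
      by_contra hodd
      rw [(Nat.not_even_iff_odd.1 hodd).neg_one_pow] at hN
      exact absurd hN (by decide)
    refine h2.trans ?_
    rw [mul_comm]
    exact mul_dvd_mul_left n hm.two_dvd

end Totient

/-! ### Products over powers of a signed permutation -/

section Product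

variable {X : Type*} [Fintype X] {τ : Equiv.Perm X} {θ : X → ℤˣ} {h : X → ℕ} {M : Matrix X X ℤ}

/-- The orbits contributing to the eigenspaces of primitive `d`-th roots of unity. -/
def PermOrbit.IsRoot (τ : Equiv.Perm X) (θ : X → ℤˣ) (d : ℕ) (o : PermOrbit τ) : Prop :=
  HasRoots (orbitSign τ θ o.rep) (Function.minimalPeriod τ o.rep) d

noncomputable instance (d : ℕ) : DecidablePred (PermOrbit.IsRoot τ θ d) :=
  Classical.decPred _

/-- The matrix of `M` on the orbits contributing to primitive `d`-th roots of unity. -/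
noncomputable def rootMatrix (τ : Equiv.Perm X) (θ : X → ℤˣ) (h : X → ℕ) (M : Matrix X X ℤ)
    (d : ℕ) : Matrix {o // PermOrbit.IsRoot τ θ d o} {o // PermOrbit.IsRoot τ θ d o} ℤ :=
  (quotMatrix τ h M).submatrix Subtype.val Subtype.val

theorem Matrix.eval_charpoly_neg {Y R : Type*} [Fintype Y] [DecidableEq Y] [CommRing R]
    (N : Matrix Y Y R) (t : R) : (-N).charpoly.eval t = (N + t • (1 : Matrix Y Y R)).det := by
  rw [Matrix.eval_charpoly, sub_neg_eq_add, add_comm, Matrix.scalar_apply,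
    Matrix.smul_one_eq_diagonal]

theorem prod_subtype_ite {Y K : Type*} [Fintype Y] [CommMonoid K] (P : Y → Prop) [DecidablePred P]
    (ψ : Y → K) : ∏ y : {y // P y}, ψ y = ∏ y, if P y then ψ y else 1 := by
  rw [← Finset.prod_filter]
  exact (Finset.prod_subtype _ (by simp) ψ).symm

theorem prod_goodOrbit_pow {f : ℕ} (hf : 0 < f) {K : Type*} [CommMonoid K] (ψ : X → K)
    (hψ : ∀ x, ψ (τ x) = ψ x) :
    ∏ o : GoodOrbit (τ ^ f) (signProd τ θ f), ψ o.1.rep =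
      ∏ d ∈ f.divisors, (∏ o : {o // PermOrbit.IsRoot τ θ d o}, ψ o.1.rep) ^ d.totient := by
  classical
  rw [prod_subtype_ite (fun o : PermOrbit (τ ^ f) =>
    orbitSign (τ ^ f) (signProd τ θ f) o.rep = 1) fun o => ψ o.rep]
  have hsf : ∀ x, orbitSign (τ ^ f) (signProd τ θ f) (τ x) =
      orbitSign (τ ^ f) (signProd τ θ f) x := by
    intro x
    rw [orbitSign_pow τ θ hf, orbitSign_pow τ θ hf, orbitSign_apply, τ.minimalPeriod_apply_self]
  rw [PermOrbit.prod_pow τ hf (fun x => if orbitSign (τ ^ f) (signProd τ θ f) x = 1 then ψ x else 1)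
    fun x => by rw [hsf, hψ]]
  have h1 : ∀ d ∈ f.divisors,
      (∏ o : {o // PermOrbit.IsRoot τ θ d o}, ψ o.1.rep) ^ d.totient =
      ∏ O : PermOrbit τ, if PermOrbit.IsRoot τ θ d O then ψ O.rep ^ d.totient else 1 := by
    intro d _
    rw [prod_subtype_ite (PermOrbit.IsRoot τ θ d) fun o => ψ o.rep, ← Finset.prod_pow]
    refine Finset.prod_congr rfl fun O _ => ?_
    split_ifs <;> simp
  rw [Finset.prod_congr rfl h1, Finset.prod_comm]
  refine Finset.prod_congr rfl fun O _ => ?_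
  rw [← Finset.prod_filter, Finset.prod_pow_eq_pow_sum]
  have h2 := sum_totient_hasRoots (orbitSign τ θ O.rep) (Function.minimalPeriod τ O.rep) hf
  have h3 : ∑ d ∈ f.divisors with PermOrbit.IsRoot τ θ d O, d.totient =
      if orbitSign τ θ O.rep ^ (f / (Function.minimalPeriod τ O.rep).gcd f) = 1 then
        (Function.minimalPeriod τ O.rep).gcd f else 0 := by
    convert h2 using 2
    exact Finset.filter_congr fun d _ => Iff.rfl
  rw [h3, orbitSign_pow τ θ hf]
  split_ifs <;> simp

namespace IsForestForm

theorem isRoot_child (F : IsForestForm τ θ h M) (d : ℕ) {x y : X}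
    (hx : PermOrbit.IsRoot τ θ d (PermOrbit.mk τ x)) (hyx : h y < h x) (hxy : M x y ≠ 0) :
    PermOrbit.IsRoot τ θ d (PermOrbit.mk τ y) := by
  rw [PermOrbit.IsRoot, orbitSign_rep, τ.minimalPeriod_eq_of_orbit (PermOrbit.mk_rep _)] at hx ⊢
  exact hx.child (F.child_period hyx hxy).1 (F.child_period hyx hxy).2

/-- The determinant of the good part of a power as a product over divisors. -/
theorem det_goodMatrix_pow (F : IsForestForm τ θ h M) {f : ℕ} (hf : 0 < f) :
    (goodMatrix (τ ^ f) (signProd τ θ f) M).det =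
      ∏ d ∈ f.divisors, (rootMatrix τ θ h M d).det ^ d.totient := by
  classical
  set A := (goodMatrix (τ ^ f) (signProd τ θ f) M).map (Int.cast : ℤ → ℚ) with hA
  set B := fun d => (rootMatrix τ θ h M d).map (Int.cast : ℤ → ℚ) with hB
  have hAo : IsOrbitForm h M A := by
    have h0 := (F.pow f).isOrbitForm_goodMatrix
    exact
      { rooted :=
          { symm := fun o o' h1 => by
              have := h0.rooted.symm o o' (by simpa [hA] using h1)
              simpa [hA] using this
            ne := fun o o' h1 => h0.rooted.ne o o' (by simpa [hA] using h1)
            uniq := fun o o' o'' h1 h2 h3 h4 =>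
              h0.rooted.uniq o o' o'' h1 h2 (by simpa [hA] using h3) (by simpa [hA] using h4) }
        diag := fun o => by
          have := h0.diag o
          simp [hA, this]
        prod := fun o o' hl => by
          have := h0.prod o o' hl
          simp only [hA, Matrix.map_apply]
          exact_mod_cast this }
  have hBo : ∀ d, IsOrbitForm h M (B d) := fun d =>
    F.isOrbitForm_quotMatrix (R := ℚ) (PermOrbit.IsRoot τ θ d) fun o o' _ hc => by exact_mod_cast hc
  -- Pivots may vanish for `M` itself. The identity is proved for `M + t` at all large integers `t`,
  -- which makes it one of characteristic polynomials, and is then evaluated at `0`.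
  obtain ⟨b, hb⟩ := exists_ratPivot_ne_zero h M
  have key : ∀ t : ℕ, b ≤ t → (-A).charpoly.eval (t : ℚ) =
      (∏ d ∈ f.divisors, (-B d).charpoly ^ d.totient).eval (t : ℚ) := by
    intro t ht
    rw [Polynomial.eval_prod]
    simp only [Polynomial.eval_pow, Matrix.eval_charpoly_neg]
    rw [(F.pow f).det_add_smul_one ?_ hAo _ (hb t ht)]
    · rw [prod_goodOrbit_pow hf _ (F.ratPivot_apply t)]
      refine Finset.prod_congr rfl fun d _ => ?_
      rw [F.det_add_smul_one (fun x y => F.isRoot_child d) (hBo d) _ (hb t ht)]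
    · intro x y hx hl hM
      rw [orbitSign_rep] at hx ⊢
      exact (F.pow f).good_of_child hl hM hx
  have hpoly : (-A).charpoly = ∏ d ∈ f.divisors, (-B d).charpoly ^ d.totient := by
    refine Polynomial.eq_of_infinite_eval_eq _ _ ?_
    refine Set.Infinite.mono (s := (Nat.cast : ℕ → ℚ) '' Set.Ici b) ?_ ?_
    · rintro _ ⟨t, ht, rfl⟩
      exact key t ht
    · exact (Set.Ici_infinite b).image Nat.cast_injective.injOn
  have h0 := congrArg (Polynomial.eval 0) hpoly
  rw [Polynomial.eval_prod] at h0
  simp only [Polynomial.eval_pow, Matrix.eval_charpoly_neg, zero_smul, add_zero, hA, hB,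
    ← Int.cast_det] at h0
  exact_mod_cast h0

end IsForestForm

/-- The orbits of total sign `-1` for which `d` divides twice the period but not the period. -/
def PermOrbit.IsBadRoot (τ : Equiv.Perm X) (θ : X → ℤˣ) (d : ℕ) (o : PermOrbit τ) : Prop :=
  orbitSign τ θ o.rep ≠ 1 ∧ d ∣ 2 * Function.minimalPeriod τ o.rep ∧
    ¬ d ∣ Function.minimalPeriod τ o.rep

/-- The orbits of total sign `-1` for which `d` divides the period. -/
def PermOrbit.IsBadDvd (τ : Equiv.Perm X) (θ : X → ℤˣ) (d : ℕ) (o : PermOrbit τ) : Prop :=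
  orbitSign τ θ o.rep ≠ 1 ∧ d ∣ Function.minimalPeriod τ o.rep

noncomputable instance (d : ℕ) : DecidablePred (PermOrbit.IsBadRoot τ θ d) :=
  Classical.decPred _

noncomputable instance (d : ℕ) : DecidablePred (PermOrbit.IsBadDvd τ θ d) :=
  Classical.decPred _

theorem prod_badOrbit_pow {f : ℕ} (hf : 0 < f) {K : Type*} [Field K] (ψ : X → K)
    (hψ : ∀ x, ψ (τ x) = ψ x) (hne : ∀ x, ψ x ≠ 0) :
    ∏ o : BadOrbit (τ ^ f) (signProd τ θ f), ψ o.1.rep =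
      ∏ d ∈ f.divisors, ((∏ o : {o // PermOrbit.IsBadDvd τ θ d o}, ψ o.1.rep) /
        ∏ o : {o // PermOrbit.IsBadRoot τ θ d o}, ψ o.1.rep) ^ d.totient := by
  classical
  rw [prod_subtype_ite (fun o : PermOrbit (τ ^ f) =>
    ¬ orbitSign (τ ^ f) (signProd τ θ f) o.rep = 1) fun o => ψ o.rep]
  have hsf : ∀ x, orbitSign (τ ^ f) (signProd τ θ f) (τ x) =
      orbitSign (τ ^ f) (signProd τ θ f) x := by
    intro x
    rw [orbitSign_pow τ θ hf, orbitSign_pow τ θ hf, orbitSign_apply, τ.minimalPeriod_apply_self]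
  rw [PermOrbit.prod_pow τ hf
    (fun x => if ¬ orbitSign (τ ^ f) (signProd τ θ f) x = 1 then ψ x else 1)
    fun x => by rw [hsf, hψ]]
  have h1 : ∀ d ∈ f.divisors, ((∏ o : {o // PermOrbit.IsBadDvd τ θ d o}, ψ o.1.rep) /
        ∏ o : {o // PermOrbit.IsBadRoot τ θ d o}, ψ o.1.rep) ^ d.totient =
      ∏ O : PermOrbit τ, (if PermOrbit.IsBadDvd τ θ d O then ψ O.rep ^ d.totient else 1) /
        if PermOrbit.IsBadRoot τ θ d O then ψ O.rep ^ d.totient else 1 := by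
    intro d _
    rw [prod_subtype_ite (PermOrbit.IsBadDvd τ θ d) fun o => ψ o.rep,
      prod_subtype_ite (PermOrbit.IsBadRoot τ θ d) fun o => ψ o.rep, ← Finset.prod_div_distrib,
      ← Finset.prod_pow]
    refine Finset.prod_congr rfl fun O _ => ?_
    rw [div_pow]
    congr 1 <;> split_ifs <;> simp
  rw [Finset.prod_congr rfl h1, Finset.prod_comm]
  refine Finset.prod_congr rfl fun O _ => ?_
  rw [Finset.prod_div_distrib, ← Finset.prod_filter, ← Finset.prod_filter,
    Finset.prod_pow_eq_pow_sum, Finset.prod_pow_eq_pow_sum]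
  have h2 := sum_totient_bad (orbitSign τ θ O.rep) (Function.minimalPeriod τ O.rep) hf
  have h3 : ((∑ d ∈ f.divisors with PermOrbit.IsBadDvd τ θ d O, d.totient : ℕ) : ℤ) -
      (∑ d ∈ f.divisors with PermOrbit.IsBadRoot τ θ d O, d.totient : ℕ) =
      if orbitSign τ θ O.rep ^ (f / (Function.minimalPeriod τ O.rep).gcd f) = 1 then 0 else
        ((Function.minimalPeriod τ O.rep).gcd f : ℤ) := by
    push_cast
    convert h2 using 3 <;> exact Finset.filter_congr fun d _ => Iff.rfl
  have h4 : ∀ m n : ℕ, ψ O.rep ^ m / ψ O.rep ^ n = ψ O.rep ^ ((m : ℤ) - n) := fun m n => by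
    rw [zpow_sub₀ (hne _), zpow_natCast, zpow_natCast]
  rw [h4, h3, orbitSign_pow τ θ hf]
  split_ifs <;> simp_all

/-- The ratio of the orders of the kernels over `𝔽₂` attached to `d`. -/
noncomputable def twoRatio (τ : Equiv.Perm X) (θ : X → ℤˣ) (h : X → ℕ) (M : Matrix X X ℤ) (d : ℕ) :
    ℚ :=
  (∏ o : {o // PermOrbit.IsBadDvd τ θ d o},
      (2 : ℚ) ^ pivotExp (twoPivot h M (fun x => orbitSign τ θ x ≠ 1) o.1.rep)) /
    ∏ o : {o // PermOrbit.IsBadRoot τ θ d o},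
      (2 : ℚ) ^ pivotExp (twoPivot h M (fun x => orbitSign τ θ x ≠ 1) o.1.rep)

namespace IsForestForm

/-- One set of pivots, with badness taken for `τ`, serves every `f`. An orbit bad for `τ ^ f` is bad
for `τ`; and below it a child bad for `τ` is still bad for `τ ^ f`, because its child count is odd,
so its number of turns divides that of its parent, which is odd. -/
theorem card_ker_badMatrix_pow (F : IsForestForm τ θ h M) {f : ℕ} (hf : 0 < f) :
    (Nat.card (LinearMap.ker (badMatrix (τ ^ f) (signProd τ θ f) M).mulVecLin) : ℚ) =
      ∏ d ∈ f.divisors, twoRatio τ θ h M d ^ d.totient := by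
  classical
  have hinv : ∀ x, orbitSign τ θ (τ x) ≠ 1 ↔ orbitSign τ θ x ≠ 1 := fun x => by
    rw [orbitSign_apply]
  rw [(F.pow f).card_ker_orbitForm (Bad := fun x => orbitSign τ θ x ≠ 1) ?_ ?_ ?_ ?_
    (F.pow f).isOrbitForm_badMatrix]
  · exact prod_badOrbit_pow hf
      (fun x => (2 : ℚ) ^ pivotExp (twoPivot h M (fun x => orbitSign τ θ x ≠ 1) x))
      (fun x => by rw [F.twoPivot_apply hinv]) fun x => zpow_ne_zero _ two_ne_zero
  · intro x
    rw [orbitSign_eq_of_orbit τ θ (PermOrbit.mk_pow f x)]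
  · intro x hx hx1
    rw [orbitSign_rep, orbitSign_pow τ θ hf, hx1, one_pow] at hx
    exact hx rfl
  · intro x y hx hl hM hy
    rw [orbitSign_rep, orbitSign_pow τ θ hf] at hx ⊢
    obtain ⟨hm, hv⟩ := F.child_period hl hM
    have hodd := F.odd_childCount hl hM hy
    set k := childCount M (PermOrbit.mk τ x) (PermOrbit.mk τ y)
    have hu : orbitSign τ θ x = -1 := (Int.units_eq_one_or _).resolve_left fun h1 => hx (by simp [h1])
    have hv' : orbitSign τ θ y = -1 := (Int.units_eq_one_or _).resolve_left hy
    rw [hu] at hx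
    rw [hv']
    intro h1
    have h2 : Odd (f / (Function.minimalPeriod τ x).gcd f) := by
      by_contra he
      exact hx (Nat.not_odd_iff_even.1 he).neg_one_pow
    have h3 : Odd (f / (Function.minimalPeriod τ y).gcd f) := by
      refine h2.of_dvd_nat (Nat.div_dvd_div_left ?_ ?_)
      · exact Nat.gcd_dvd_right _ _
      · rw [hm]
        exact Nat.gcd_dvd_gcd_mul_left_left _ _ _
    rw [h3.neg_one_pow] at h1
    exact absurd h1 (by decide)
  · intro o o' hl hc
    exact (F.pow f).natCast_childCount o'.2 hl hc

/-- Shows that numerator and denominator of `twoRatio` are orders of finite groups, hence positive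
integers. -/
theorem card_ker_quotMatrix (F : IsForestForm τ θ h M) (P : PermOrbit τ → Prop) [DecidablePred P]
    (hPB : ∀ o, P o → orbitSign τ θ o.rep ≠ 1)
    (hP : ∀ x y, P (PermOrbit.mk τ x) → h y < h x → M x y ≠ 0 → orbitSign τ θ y ≠ 1 →
      P (PermOrbit.mk τ y)) :
    (Nat.card (LinearMap.ker (((quotMatrix τ h M).submatrix (Subtype.val : {o // P o} → _)
      (Subtype.val : {o // P o} → _)).map (Int.cast : ℤ → ZMod 2)).mulVecLin) : ℚ) =
      ∏ o : {o // P o},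
        (2 : ℚ) ^ pivotExp (twoPivot h M (fun x => orbitSign τ θ x ≠ 1) o.1.rep) := by
  have hodd : ∀ o o' : {o // P o}, h o'.1.rep < h o.1.rep → childCount M o.1 o'.1 ≠ 0 →
      (childCount M o.1 o'.1 : ZMod 2) = 1 := fun o o' => F.natCast_childCount (hPB _ o'.2)
  refine F.card_ker_orbitForm ?_ ?_ hP hodd ?_
  · intro x
    rw [orbitSign_apply]
  · intro x hx
    rw [← orbitSign_rep]
    exact hPB _ hx
  · refine F.isOrbitForm_quotMatrix P fun o o' hl hc => ?_
    rw [hodd o o' hl hc]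
    exact one_ne_zero

theorem isBadDvd_child (F : IsForestForm τ θ h M) (d : ℕ) {x y : X}
    (hx : PermOrbit.IsBadDvd τ θ d (PermOrbit.mk τ x)) (hyx : h y < h x) (hxy : M x y ≠ 0)
    (hy : orbitSign τ θ y ≠ 1) : PermOrbit.IsBadDvd τ θ d (PermOrbit.mk τ y) := by
  rw [PermOrbit.IsBadDvd, orbitSign_rep, τ.minimalPeriod_eq_of_orbit (PermOrbit.mk_rep _)] at hx ⊢
  refine ⟨hy, ?_⟩
  rw [(F.child_period hyx hxy).1]
  exact hx.2.mul_left _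

theorem isBadRoot_child (F : IsForestForm τ θ h M) (d : ℕ) {x y : X}
    (hx : PermOrbit.IsBadRoot τ θ d (PermOrbit.mk τ x)) (hyx : h y < h x) (hxy : M x y ≠ 0)
    (hy : orbitSign τ θ y ≠ 1) : PermOrbit.IsBadRoot τ θ d (PermOrbit.mk τ y) := by
  rcases F.isRoot_child d (Or.inr hx) hyx hxy with h1 | h1
  · rw [orbitSign_rep] at h1
    exact absurd h1.1 hy
  · exact h1

/-- The determinant of the root matrix times the ratio of kernel orders over `𝔽₂` is a positive
integer. -/
theorem exists_det_rootMatrix (F : IsForestForm τ θ h M) (d : ℕ)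
    (hdet : (rootMatrix τ θ h M d).det ≠ 0) :
    ∃ a : ℕ+, (a : ℚ) = (rootMatrix τ θ h M d).det.natAbs * twoRatio τ θ h M d := by
  classical
  set B := rootMatrix τ θ h M d with hB
  set D := ((quotMatrix τ h M).submatrix
    (Subtype.val : {o // PermOrbit.IsBadRoot τ θ d o} → _)
    (Subtype.val : {o // PermOrbit.IsBadRoot τ θ d o} → _)).map
    (Int.cast : ℤ → ZMod 2) with hD
  set D' := ((quotMatrix τ h M).submatrix
    (Subtype.val : {o // PermOrbit.IsBadDvd τ θ d o} → _)
    (Subtype.val : {o // PermOrbit.IsBadDvd τ θ d o} → _)).map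
    (Int.cast : ℤ → ZMod 2) with hD'
  have hDc := F.card_ker_quotMatrix (PermOrbit.IsBadRoot τ θ d) (fun o ho => ho.1)
    fun x y => F.isBadRoot_child d
  have hDc' := F.card_ker_quotMatrix (PermOrbit.IsBadDvd τ θ d) (fun o ho => ho.1)
    fun x y => F.isBadDvd_child d
  rw [← hD] at hDc
  rw [← hD'] at hDc'
  rw [twoRatio, ← hDc, ← hDc']
  let ι : {o // PermOrbit.IsBadRoot τ θ d o} → {o // PermOrbit.IsRoot τ θ d o} :=
    fun o => ⟨o.1, Or.inr o.2⟩
  have hι : Function.Injective ι := fun o o' hoo => Subtype.ext (congrArg (fun x => x.1) hoo)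
  let Dl : ({o // PermOrbit.IsBadRoot τ θ d o} → ZMod 2) →ₗ[ℤ]
      ({o // PermOrbit.IsBadRoot τ θ d o} → ZMod 2) := D.mulVecLin.restrictScalars ℤ
  let p : ({o // PermOrbit.IsRoot τ θ d o} → ℤ) →ₗ[ℤ]
      ({o // PermOrbit.IsBadRoot τ θ d o} → ZMod 2) :=
    { toFun := fun v o => (v (ι o) : ZMod 2)
      map_add' := fun v w => funext fun o => by simp
      map_smul' := fun k v => funext fun o => by simp }
  have hp : Function.Surjective p := by
    intro w
    refine ⟨fun o => if ho : PermOrbit.IsBadRoot τ θ d o.1 then ((w ⟨o.1, ho⟩).val : ℤ) else 0,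
      funext fun o => ?_⟩
    change (((if ho : PermOrbit.IsBadRoot τ θ d o.1 then ((w ⟨o.1, ho⟩).val : ℤ) else 0 : ℤ)) :
      ZMod 2) = w o
    rw [dif_pos o.2]
    simp
  -- Modulo `2` a row of `B` at a bad orbit has no entries at good orbits: a good neighbour must lie
  -- below, and its child count is even.
  have hcomm : ∀ v, p (B.mulVecLin v) = Dl (p v) := by
    intro v
    funext o
    change ((∑ o', B (ι o) o' * v o' : ℤ) : ZMod 2) = ∑ o', D o o' * ((v (ι o') : ℤ) : ZMod 2)
    rw [Int.cast_sum]
    symm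
    refine Fintype.sum_of_injective ι hι _ _ ?_ ?_
    · intro o' ho'
      have hgood : orbitSign τ θ o'.1.rep = 1 := by
        rcases o'.2 with h1 | h1
        · exact h1.1
        · exact absurd ⟨⟨o'.1, h1⟩, rfl⟩ ho'
      have hne : (ι o).1 ≠ o'.1 := by
        intro h1
        exact o.2.1 (by rw [← hgood, ← h1])
      have h0 : ((B (ι o) o' : ℤ) : ZMod 2) = 0 := by
        change (((if o.1 = o'.1 then _ else if h o'.1.rep < h o.1.rep then
          (childCount M o.1 o'.1 : ℤ) else if childCount M o.1 o'.1 = 0 then 0 else 1 : ℤ)) :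
          ZMod 2) = 0
        rw [if_neg hne]
        by_cases hc : childCount M o.1 o'.1 = 0
        · simp [hc]
        · obtain ⟨y, hy, hMy⟩ := exists_of_childCount_ne_zero hc
          have hys : orbitSign τ θ y = 1 := by rw [orbitSign_of_mk_eq τ θ hy, hgood]
          have hhy : h o'.1.rep = h y := by rw [← hy, F.height_rep]
          have hno : ¬ h o.1.rep < h y := fun hl => o.2.1 (F.good_of_child hl (F.ne_zero_symm hMy) hys)
          have hne' : h o.1.rep ≠ h y := F.ne _ _ hMy fun h1 => o.2.1 (by rw [h1, hys])
          have hl : h y < h o.1.rep := by omega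
          rw [if_pos (hhy ▸ hl)]
          have he := F.even_childCount hl hMy o.2.1 hys
          rw [PermOrbit.mk_rep, hy] at he
          rw [Int.cast_natCast]
          exact (ZMod.natCast_eq_zero_iff_even).2 he
      rw [Int.cast_mul, h0, zero_mul]
    · intro o'
      rw [Int.cast_mul]
      rfl
  -- The cokernel of `B` has order `|det B|` and surjects onto the cokernel of `D`, which has as
  -- many elements as its kernel.
  have hdvd : Nat.card (LinearMap.ker D.mulVecLin) ∣ B.det.natAbs := by
    rw [← card_quotient_range_mulVecLin B hdet]
    have h1 : Nat.card (LinearMap.ker D.mulVecLin) = (LinearMap.range Dl).toAddSubgroup.index :=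
      (LinearMap.index_range_eq_card_ker Dl).symm
    rw [h1]
    refine AddSubgroup.card_dvd_of_surjective (Submodule.mapQ (LinearMap.range B.mulVecLin)
      (LinearMap.range Dl) p ?_).toAddMonoidHom ?_
    · rintro _ ⟨v, rfl⟩
      exact ⟨p v, (hcomm v).symm⟩
    · intro z
      obtain ⟨w, rfl⟩ := Submodule.Quotient.mk_surjective _ z
      obtain ⟨v, rfl⟩ := hp w
      exact ⟨Submodule.Quotient.mk v, rfl⟩
  obtain ⟨m, hm⟩ := hdvd
  have h1 : 0 < Nat.card (LinearMap.ker D.mulVecLin) := Nat.card_pos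
  have h2 : 0 < Nat.card (LinearMap.ker D'.mulVecLin) := Nat.card_pos
  have hm0 : 0 < m := Nat.pos_of_ne_zero fun h0 => hdet (by simpa [h0] using hm)
  refine ⟨⟨m * Nat.card (LinearMap.ker D'.mulVecLin), Nat.mul_pos hm0 h2⟩, ?_⟩
  have h3 : (Nat.card (LinearMap.ker D.mulVecLin) : ℚ) ≠ 0 := by exact_mod_cast h1.ne'
  rw [hm]
  change ((m * Nat.card (LinearMap.ker D'.mulVecLin) : ℕ) : ℚ) = _
  push_cast
  field_simp

end IsForestForm

end Product

/-! ### Families of matrices with scaled diagonal -/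

section Family

variable {X : Type*} [Fintype X]

/-- A left null vector of the good matrix, pulled back along `goodProj`, is a functional killing the
image of `M`, that is, by symmetry, a null vector of `M`. Surjectivity of `goodProj` then kills the
original vector. -/
theorem goodMatrix_det_ne_zero {τ : Equiv.Perm X} {θ : X → ℤˣ} {M : Matrix X X ℤ}
    (hM : ∀ x y, M (τ x) (τ y) = θ x * θ y * M x y) (hsymm : ∀ x y, M x y = M y x)
    (hinj : ∀ u, M.mulVec u = 0 → u = 0) : (goodMatrix τ θ M).det ≠ 0 := by
  classical
  intro h0
  obtain ⟨w, hw, hw0⟩ := Matrix.exists_vecMul_eq_zero_iff.2 h0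
  let ℓ : (X → ℤ) →ₗ[ℤ] ℤ := (LinearMap.lsum ℤ (fun _ => ℤ) ℤ fun o => LinearMap.lsmul ℤ ℤ (w o)) ∘ₗ
    goodProj τ θ
  have hℓ : ∀ u, ℓ u = w ⬝ᵥ goodProj τ θ u := by
    intro u
    simp [ℓ, dotProduct]
  let z : X → ℤ := fun x => ℓ (Pi.single x 1)
  have hz : ∀ u, ℓ u = z ⬝ᵥ u := by
    intro u
    conv_lhs => rw [← Finset.univ_sum_single u, map_sum]
    refine Finset.sum_congr rfl fun x _ => ?_
    have : (Pi.single x (u x) : X → ℤ) = u x • Pi.single x 1 := by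
      rw [← Pi.single_smul, smul_eq_mul, mul_one]
    rw [this, map_smul, smul_eq_mul, mul_comm]
  have h1 : ∀ u, z ⬝ᵥ M.mulVec u = 0 := by
    intro u
    rw [← hz, hℓ, goodProj_mulVec hM, Matrix.dotProduct_mulVec, hw0, zero_dotProduct]
  have h2 : M.mulVec z = 0 := by
    have hT : M.transpose = M := by
      ext x y
      exact hsymm y x
    have h3 : Matrix.vecMul z M = 0 := by
      refine dotProduct_eq_zero _ fun u => ?_
      rw [← Matrix.dotProduct_mulVec]
      exact h1 u
    rwa [← Matrix.mulVec_transpose, hT] at h3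
  have h3 := hinj z h2
  refine hw (dotProduct_eq_zero _ fun v => ?_)
  obtain ⟨u, rfl, -⟩ := exists_proj_eq τ θ v 0
  rw [← hℓ, hz, h3, zero_dotProduct]

/-- A family of matrices on a forest in which the diagonal is scaled by the parameter and vanishes
on one of the two classes of a bipartition. -/
structure IsForestFamily (τ : Equiv.Perm X) (θ : X → ℤˣ) (h : X → ℕ) (κ : X → Prop)
    (M : ℕ → Matrix X X ℤ) : Prop where
  form : ∀ e, IsForestForm τ θ h (M e)
  diag : ∀ e x, M e x x = e * M 1 x x
  offdiag : ∀ e x y, x ≠ y → M e x y = M 1 x y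
  invariant : ∀ x, κ (τ x) ↔ κ x
  vertex : ∀ x, κ x → M 1 x x = 0
  bipartite : ∀ x y, x ≠ y → M 1 x y ≠ 0 → (κ x ↔ ¬ κ y)
  nondegenerate : ∀ e, 0 < e → ∀ u, (M e).mulVec u = 0 → u = 0

namespace IsForestFamily

variable {τ : Equiv.Perm X} {θ : X → ℤˣ} {h : X → ℕ} {κ : X → Prop} {M : ℕ → Matrix X X ℤ}

theorem ne_zero_iff (F : IsForestFamily τ θ h κ M) (e : ℕ) {x y : X} (hl : h y < h x) :
    M e x y ≠ 0 ↔ M 1 x y ≠ 0 := by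
  rw [F.offdiag e x y (by rintro rfl; exact lt_irrefl _ hl)]

theorem childCount_eq (F : IsForestFamily τ θ h κ M) (e : ℕ) {o o' : PermOrbit τ} (hoo : o ≠ o') :
    childCount (M e) o o' = childCount (M 1) o o' := by
  rw [childCount, childCount]
  congr 1
  refine Finset.filter_congr fun y _ => and_congr_right fun hy => ?_
  rw [F.offdiag e]
  rintro rfl
  exact hoo (by rw [← hy, PermOrbit.mk_rep])

theorem quotMatrix_apply (F : IsForestFamily τ θ h κ M) (e : ℕ) (o o' : PermOrbit τ) :
    quotMatrix τ h (M e) o o' = if o = o' then (e : ℤ) * quotMatrix τ h (M 1) o o' else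
      quotMatrix τ h (M 1) o o' := by
  rw [quotMatrix, quotMatrix, Matrix.of_apply, Matrix.of_apply]
  by_cases hoo : o = o'
  · rw [if_pos hoo, if_pos hoo, if_pos hoo, F.diag]
  · rw [if_neg hoo, if_neg hoo, if_neg hoo, F.childCount_eq e hoo]

theorem quotMatrix_bipartite (F : IsForestFamily τ θ h κ M) {o o' : PermOrbit τ} (hoo : o ≠ o')
    (h0 : quotMatrix τ h (M 1) o o' ≠ 0) : κ o.rep ↔ ¬ κ o'.rep := by
  have hc : childCount (M 1) o o' ≠ 0 := by
    intro hc
    simp [quotMatrix, hoo, hc] at h0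
  obtain ⟨y, rfl, hy⟩ := IsForestForm.exists_of_childCount_ne_zero hc
  rw [F.bipartite _ _ (by rintro h1; exact hoo (by rw [← h1, PermOrbit.mk_rep])) hy]
  have : κ (PermOrbit.mk τ y).rep = κ y :=
    PermOrbit.eq_of_invariant (F := κ) (fun x => propext (F.invariant x)) (PermOrbit.mk_rep _)
  rw [this]

theorem det_ne_zero (F : IsForestFamily τ θ h κ M) {e : ℕ} (he : 0 < e) (f : ℕ) :
    (goodMatrix (τ ^ f) (signProd τ θ f) (M e)).det ≠ 0 :=
  goodMatrix_det_ne_zero ((F.form e).pow f).equivariant (F.form e).symm (F.nondegenerate e he)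

theorem det_rootMatrix_ne_zero (F : IsForestFamily τ θ h κ M) {e : ℕ} (he : 0 < e) {d : ℕ}
    (hd : 0 < d) : (rootMatrix τ θ h (M e) d).det ≠ 0 := by
  have h1 := F.det_ne_zero he d
  rw [(F.form e).det_goodMatrix_pow hd, Finset.prod_ne_zero_iff] at h1
  intro h0
  refine h1 d (Nat.mem_divisors_self d hd.ne') ?_
  rw [h0, zero_pow (Nat.totient_pos.2 hd).ne']

/-- The determinants in the family depend on the parameter through a power. -/
theorem exists_det_rootMatrix_eq (F : IsForestFamily τ θ h κ M) {d : ℕ} (hd : 0 < d) :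
    ∃ r : ℕ, ∀ e : ℕ, 0 < e →
      (rootMatrix τ θ h (M e) d).det = e ^ r * (rootMatrix τ θ h (M 1) d).det := by
  classical
  set Y := {o // PermOrbit.IsRoot τ θ d o}
  set v : ℕ := (Finset.univ.filter fun o : Y => κ o.1.rep).card with hv
  set w : ℕ := (Finset.univ.filter fun o : Y => ¬ κ o.1.rep).card with hw
  -- Scaling by `e` the rows in `κ` of the matrix for `e`, or the columns outside `κ` of the matrix
  -- for `1`, gives the same matrix: off-diagonal entries join the two classes, and diagonal entries
  -- in `κ` vanish.
  have key : ∀ e : ℕ, (e : ℤ) ^ v * (rootMatrix τ θ h (M e) d).det =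
      (e : ℤ) ^ w * (rootMatrix τ θ h (M 1) d).det := by
    intro e
    have h1 := Matrix.det_mul_column (fun o : Y => if κ o.1.rep then (e : ℤ) else 1)
      (rootMatrix τ θ h (M e) d)
    have h2 := Matrix.det_mul_row (fun o : Y => if ¬ κ o.1.rep then (e : ℤ) else 1)
      (rootMatrix τ θ h (M 1) d)
    rw [← Finset.prod_filter, Finset.prod_const] at h1 h2
    rw [← h1, ← h2]
    congr 1
    ext o o'
    rw [Matrix.of_apply, Matrix.of_apply, rootMatrix, rootMatrix, Matrix.submatrix_apply,
      Matrix.submatrix_apply, F.quotMatrix_apply e]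
    by_cases hoo : o.1 = o'.1
    · rw [if_pos hoo, ← hoo]
      by_cases hk : κ o.1.rep
      · have h0 : quotMatrix τ h (M 1) o.1 o.1 = 0 := by
          simpa [quotMatrix] using F.vertex _ hk
        simp [h0]
      · simp [hk]
    · rw [if_neg hoo]
      by_cases h0 : quotMatrix τ h (M 1) o.1 o'.1 = 0
      · simp [h0]
      · have := F.quotMatrix_bipartite hoo h0
        by_cases hk : κ o.1.rep
        · rw [if_pos hk, if_pos (this.1 hk)]
        · rw [if_neg hk, if_neg (by tauto)]
  have hd1 := F.det_rootMatrix_ne_zero one_pos hd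
  -- Otherwise every positive `e` would divide the nonzero determinant at `1`, which fails for `e`
  -- exceeding its absolute value.
  have hvw : v ≤ w := by
    by_contra hlt
    push Not at hlt
    set e := (rootMatrix τ θ h (M 1) d).det.natAbs + 1 with he
    have h1 := key e
    have h2 : (e : ℤ) ^ v = (e : ℤ) ^ w * (e : ℤ) ^ (v - w) := by
      rw [← pow_add]
      congr 1
      omega
    rw [h2, mul_assoc] at h1
    have h3 := mul_left_cancel₀ (pow_ne_zero _ (by positivity)) h1
    have h4 : (e : ℤ) ∣ (rootMatrix τ θ h (M 1) d).det := by
      rw [← h3]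
      exact (dvd_pow_self _ (by omega)).mul_right _
    have h5 := Nat.le_of_dvd (Int.natAbs_pos.2 hd1) (Int.natCast_dvd.1 h4)
    omega
  refine ⟨w - v, fun e he => ?_⟩
  have h1 := key e
  have h2 : (e : ℤ) ^ w = (e : ℤ) ^ v * (e : ℤ) ^ (w - v) := by
    rw [← pow_add]
    congr 1
    omega
  rw [h2, mul_assoc] at h1
  exact mul_left_cancel₀ (pow_ne_zero _ (by positivity)) h1

theorem twoRatio_congr (F : IsForestFamily τ θ h κ M) {e e' : ℕ} (he : (e : ZMod 2) = e') (d : ℕ) :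
    twoRatio τ θ h (M e) d = twoRatio τ θ h (M e') d := by
  have h1 : ∀ x, twoPivot h (M e) (fun x => orbitSign τ θ x ≠ 1) x =
      twoPivot h (M e') (fun x => orbitSign τ θ x ≠ 1) x := by
    refine twoPivot_congr (fun x y hl => ?_) fun x => ?_
    · rw [F.ne_zero_iff e hl, F.ne_zero_iff e' hl]
    · rw [F.diag e, F.diag e']
      push_cast
      rw [he]
  simp only [twoRatio, h1]

/-- The ratio is a power of `2` depending only on the parity of `e`. As `gcd(e, 2)` takes the values
`1` and `2`, the exponent is the difference between the cases `e = 2` and `e = 1`. -/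
theorem exists_twoRatio_eq (F : IsForestFamily τ θ h κ M) (d : ℕ) :
    ∃ s : ℤ, ∀ e : ℕ, twoRatio τ θ h (M e) d =
      twoRatio τ θ h (M 1) d * ((Nat.gcd e 2 : ℕ) : ℚ) ^ s := by
  have hpow : ∀ e, ∃ s : ℤ, twoRatio τ θ h (M e) d = 2 ^ s := by
    have hprod : ∀ {Y : Type _} (t : Finset Y) (g : Y → ℤ),
        ∃ s : ℤ, ∏ y ∈ t, (2 : ℚ) ^ g y = 2 ^ s := by
      intro Y t g
      induction t using Finset.cons_induction with
      | empty => exact ⟨0, by simp⟩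
      | cons y t hy ih =>
        obtain ⟨s, hs⟩ := ih
        exact ⟨g y + s, by rw [Finset.prod_cons, hs, zpow_add₀ two_ne_zero]⟩
    intro e
    obtain ⟨s, hs⟩ := hprod (Y := {o // PermOrbit.IsBadDvd τ θ d o}) Finset.univ _
    obtain ⟨t, ht⟩ := hprod (Y := {o // PermOrbit.IsBadRoot τ θ d o}) Finset.univ _
    exact ⟨s - t, by rw [twoRatio, hs, ht, zpow_sub₀ two_ne_zero]⟩
  obtain ⟨s1, h1⟩ := hpow 1
  obtain ⟨s2, h2⟩ := hpow 2
  refine ⟨s2 - s1, fun e => ?_⟩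
  rcases Nat.even_or_odd e with he | he
  · rw [F.twoRatio_congr (e' := 2), Nat.gcd_eq_right he.two_dvd, h1, h2, Nat.cast_ofNat,
      ← zpow_add₀ two_ne_zero]
    · congr 1
      ring
    · rw [(ZMod.natCast_eq_zero_iff_even).2 he]
      rfl
  · rw [F.twoRatio_congr (e' := 1), (Nat.coprime_two_right.2 he).gcd_eq_one, Nat.cast_one,
      one_zpow, mul_one]
    rw [(ZMod.natCast_eq_one_iff_odd).2 he]
    rfl

/-- The orders of the coinvariants of the cokernels of a forest family along all powers of a signed
permutation of finite order. -/
theorem exists_card_coinvariants (F : IsForestFamily τ θ h κ M) {N : ℕ}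
    (hN : signedPerm τ θ ^ N = 1) :
    ∃ (a : ℕ → ℕ+) (r : ℕ → ℕ) (s : ℕ → ℤ),
      (∀ d : ℕ, 0 < d → ¬ d ∣ N → a d = 1 ∧ r d = 0 ∧ s d = 0) ∧
      ∀ e f : ℕ, 0 < e → 0 < f →
        (Nat.card ((X → ℤ) ⧸ (LinearMap.range (M e).mulVecLin ⊔
          LinearMap.range (signedPerm τ θ ^ f - 1))) : ℚ) =
        ∏ d ∈ Nat.divisors f,
          (((a d : ℕ) : ℚ) * (e : ℚ) ^ r d * ((Nat.gcd e 2 : ℕ) : ℚ) ^ s d) ^ Nat.totient d := by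
  classical
  have hex : ∀ d, ∃ (a : ℕ+) (r : ℕ) (s : ℤ), 0 < d →
      (¬ d ∣ N → a = 1 ∧ r = 0 ∧ s = 0) ∧ ∀ e : ℕ, 0 < e →
        ((rootMatrix τ θ h (M e) d).det.natAbs : ℚ) * twoRatio τ θ h (M e) d =
          (a : ℕ) * (e : ℚ) ^ r * ((Nat.gcd e 2 : ℕ) : ℚ) ^ s := by
    intro d
    by_cases hd : 0 < d
    swap
    · exact ⟨1, 0, 0, fun h0 => absurd h0 hd⟩
    by_cases hdN : d ∣ N
    · obtain ⟨a, ha⟩ := (F.form 1).exists_det_rootMatrix d (F.det_rootMatrix_ne_zero one_pos hd)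
      obtain ⟨r, hr⟩ := F.exists_det_rootMatrix_eq hd
      obtain ⟨s, hs⟩ := F.exists_twoRatio_eq d
      refine ⟨a, r, s, fun _ => ⟨fun h0 => absurd hdN h0, fun e he => ?_⟩⟩
      rw [hr e he, hs e, Int.natAbs_mul, Int.natAbs_pow, Int.natAbs_natCast]
      push_cast
      rw [ha]
      ring
    -- No orbit is attached to such a `d`, so the determinant is that of an empty matrix and the
    -- products are empty.
    · refine ⟨1, 0, 0, fun _ => ⟨fun _ => ⟨rfl, rfl, rfl⟩, fun e _ => ?_⟩⟩
      have hper : ∀ x, Function.minimalPeriod τ x ∣ N ∧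
          orbitSign τ θ x ^ (N / Function.minimalPeriod τ x) = 1 := by
        intro x
        have h2 := signedPerm_apply (τ ^ N) (signProd τ θ N) (Pi.single x 1) x
        rw [← signedPerm_pow, hN, Module.End.one_apply, Pi.single_eq_same, mul_one] at h2
        have h3 : (τ ^ N) x = x := by
          by_contra hne
          rw [Pi.single_eq_of_ne hne] at h2
          exact (Units.ne_zero _) h2.symm
        rw [h3, Pi.single_eq_same] at h2
        have h5 : signProd τ θ N x = 1 := Units.ext h2.symm
        have h4 := (τ.pow_apply_eq_self_iff _ _).1 h3
        exact ⟨h4, by rw [← signProd_eq_orbitSign_pow τ θ h4, h5]⟩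
      have hroot : ∀ o, ¬ PermOrbit.IsRoot τ θ d o := fun o ho =>
        hdN (HasRoots.dvd ho (hper _).1 (hper _).2 (τ.minimalPeriod_pos _))
      have hbad : ∀ o, ¬ PermOrbit.IsBadDvd τ θ d o := fun o ho =>
        hdN (ho.2.trans (hper _).1)
      have hbad' : ∀ o, ¬ PermOrbit.IsBadRoot τ θ d o := fun o ho => hroot o (Or.inr ho)
      have : IsEmpty {o // PermOrbit.IsRoot τ θ d o} := ⟨fun o => hroot _ o.2⟩
      have : IsEmpty {o // PermOrbit.IsBadDvd τ θ d o} := ⟨fun o => hbad _ o.2⟩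
      have : IsEmpty {o // PermOrbit.IsBadRoot τ θ d o} := ⟨fun o => hbad' _ o.2⟩
      simp [twoRatio]
  choose a r s has using hex
  refine ⟨a, r, s, fun d hd => (has d hd).1, fun e f he hf => ?_⟩
  rw [signedPerm_pow, card_coinvariants ((F.form e).pow f).equivariant (F.det_ne_zero he f)]
  push_cast
  rw [(F.form e).card_ker_badMatrix_pow hf, (F.form e).det_goodMatrix_pow hf]
  have h1 : ((∏ d ∈ f.divisors, (rootMatrix τ θ h (M e) d).det ^ d.totient).natAbs : ℚ) =
      ∏ d ∈ f.divisors, ((rootMatrix τ θ h (M e) d).det.natAbs : ℚ) ^ d.totient := by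
    rw [← Int.natAbsHom_apply, map_prod]
    push_cast
    simp
  rw [h1, ← Finset.prod_mul_distrib]
  refine Finset.prod_congr rfl fun d hd => ?_
  rw [← mul_pow, (has d (Nat.pos_of_mem_divisors hd)).2 e he]

end IsForestFamily

end Family

/-! ### Component groups of lattices presented as kernels -/

section ComponentGroup

theorem Submodule.card_quotient_congr {A B C : Type*} [AddCommGroup A] [AddCommGroup B]
    [AddCommGroup C] (f : A →ₗ[ℤ] B) (g : A →ₗ[ℤ] C) (hf : Function.Surjective f)
    (hg : Function.Surjective g) (h : ∀ a, f a = 0 ↔ g a = 0) : Nat.card B = Nat.card C := by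
  have hk : LinearMap.ker f = LinearMap.ker g := by
    ext a
    exact h a
  exact Nat.card_congr ((f.quotKerEquivOfSurjective hf).symm.trans
    ((Submodule.quotEquivOfEq _ _ hk).trans (g.quotKerEquivOfSurjective hg))).toEquiv

variable {E V Λ : Type*} [Fintype E] [AddCommGroup Λ]

/-- The functional on a lattice with coordinates `ι` defined by a vector. -/
noncomputable def coordDual (ι : Λ →ₗ[ℤ] (E → ℤ)) : (E → ℤ) →ₗ[ℤ] Module.Dual ℤ Λ :=
  LinearMap.mk₂ ℤ (fun a c => a ⬝ᵥ ι c) (fun a b c => add_dotProduct _ _ _)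
    (fun k a c => smul_dotProduct _ _ _) (fun a b c => by rw [map_add, dotProduct_add])
    fun k a c => by rw [map_smul, dotProduct_smul]

@[simp] theorem coordDual_apply (ι : Λ →ₗ[ℤ] (E → ℤ)) (a : E → ℤ) (c : Λ) :
    coordDual ι a c = a ⬝ᵥ ι c := rfl

theorem LinearMap.exists_dotProduct_eq (ξ : (E → ℤ) →ₗ[ℤ] ℤ) : ∃ a : E → ℤ, ∀ x, ξ x = a ⬝ᵥ x := by
  classical
  refine ⟨fun i => ξ (Pi.single i 1), fun x => ?_⟩
  conv_lhs => rw [← Finset.univ_sum_single x, map_sum]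
  refine Finset.sum_congr rfl fun i _ => ?_
  have : (Pi.single i (x i) : E → ℤ) = x i • Pi.single i 1 := by
    rw [← Pi.single_smul, smul_eq_mul, mul_one]
  rw [this, map_smul, smul_eq_mul, mul_comm]

variable {ι : Λ →ₗ[ℤ] (E → ℤ)} {N : Matrix V E ℤ}

/-- The section `s` makes `ker N` a direct summand, so functionals on it extend to `ℤ^E`. With
`coordDual_eq_zero_iff` this presents `Λ^∨` as `ℤ^E` modulo the image of `Nᵀ`. -/
theorem coordDual_surjective (hι : Function.Injective ι)
    (hrange : LinearMap.range ι = LinearMap.ker N.mulVecLin)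
    {s : (V → ℤ) →ₗ[ℤ] (E → ℤ)} (hs : ∀ b, N.mulVec (s b) = b) :
    Function.Surjective (coordDual ι) := by
  intro ξ
  let κ := LinearEquiv.ofInjective ι hι
  have hmem : ∀ x, x - s (N.mulVec x) ∈ LinearMap.range ι := by
    intro x
    rw [hrange, LinearMap.mem_ker, map_sub, Matrix.mulVecLin_apply, Matrix.mulVecLin_apply, hs,
      sub_self]
  let p : (E → ℤ) →ₗ[ℤ] LinearMap.range ι :=
    (LinearMap.id - s ∘ₗ N.mulVecLin).codRestrict _ hmem
  obtain ⟨a, ha⟩ := LinearMap.exists_dotProduct_eq (ξ ∘ₗ κ.symm.toLinearMap ∘ₗ p)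
  refine ⟨a, LinearMap.ext fun c => ?_⟩
  rw [coordDual_apply, ← ha]
  have h1 : p (ι c) = κ c := by
    refine Subtype.ext ?_
    have h2 : N.mulVec (ι c) = 0 := by
      have : ι c ∈ LinearMap.ker N.mulVecLin := hrange ▸ ⟨c, rfl⟩
      exact this
    change ι c - s (N.mulVec (ι c)) = ι c
    rw [h2, map_zero, sub_zero]
  rw [LinearMap.comp_apply, LinearMap.comp_apply, h1, LinearEquiv.coe_coe,
    LinearEquiv.symm_apply_apply]

variable [Fintype V]

theorem coordDual_eq_zero_iff
    (hrange : LinearMap.range ι = LinearMap.ker N.mulVecLin)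
    {s : (V → ℤ) →ₗ[ℤ] (E → ℤ)} (hs : ∀ b, N.mulVec (s b) = b) (a : E → ℤ) :
    coordDual ι a = 0 ↔ ∃ y, a = Matrix.vecMul y N := by
  constructor
  · intro h
    obtain ⟨y, hy⟩ := LinearMap.exists_dotProduct_eq (coordDual LinearMap.id a ∘ₗ s)
    have hy' : ∀ b, a ⬝ᵥ s b = y ⬝ᵥ b := fun b => hy b
    refine ⟨y, ?_⟩
    rw [← sub_eq_zero]
    refine dotProduct_eq_zero _ fun x => ?_
    have hmem : x - s (N.mulVec x) ∈ LinearMap.range ι := by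
      rw [hrange, LinearMap.mem_ker, map_sub, Matrix.mulVecLin_apply, Matrix.mulVecLin_apply, hs,
        sub_self]
    obtain ⟨c, hc⟩ := hmem
    have h1 : a ⬝ᵥ ι c = 0 := LinearMap.congr_fun h c
    rw [hc, dotProduct_sub, hy', Matrix.dotProduct_mulVec] at h1
    rw [sub_dotProduct, h1]
  · rintro ⟨y, rfl⟩
    refine LinearMap.ext fun c => ?_
    have h2 : N.mulVec (ι c) = 0 := by
      have : ι c ∈ LinearMap.ker N.mulVecLin := hrange ▸ ⟨c, rfl⟩
      exact this
    rw [coordDual_apply, ← Matrix.dotProduct_mulVec, h2, dotProduct_zero, LinearMap.zero_apply]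

/-- The symmetric matrix `(ℓ, Nᵀ; N, 0)`. -/
def saddleMatrix [DecidableEq E] (ℓ : E → ℤ) (N : Matrix V E ℤ) : Matrix (E ⊕ V) (E ⊕ V) ℤ :=
  Matrix.fromBlocks (Matrix.diagonal ℓ) N.transpose N 0

variable [DecidableEq E]

theorem saddleMatrix_mulVec (ℓ : E → ℤ) (N : Matrix V E ℤ) (x : E → ℤ) (y : V → ℤ) :
    (saddleMatrix ℓ N).mulVec (Sum.elim x y) =
      Sum.elim (fun e => ℓ e * x e + Matrix.vecMul y N e) (N.mulVec x) := by
  rw [saddleMatrix, Matrix.fromBlocks_mulVec]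
  congr 1
  · funext e
    simp [Matrix.mulVec_diagonal, Matrix.mulVec_transpose]
  · simp

/-- Pairing the edge equations with `x`, and using `N x = 0`, leaves `∑ ℓ x² = 0`, so `x = 0` by
positivity; then `y` vanishes because `N` is onto. -/
theorem saddleMatrix_injective {ℓ : E → ℤ} (hℓ : ∀ e, 0 < ℓ e)
    (hN : Function.Surjective N.mulVec) (u : E ⊕ V → ℤ) (hu : (saddleMatrix ℓ N).mulVec u = 0) :
    u = 0 := by
  obtain ⟨x, y, rfl⟩ : ∃ x y, u = Sum.elim x y := ⟨_, _, (Sum.elim_comp_inl_inr u).symm⟩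
  rw [saddleMatrix_mulVec] at hu
  have h1 : ∀ e, ℓ e * x e + Matrix.vecMul y N e = 0 := fun e => congrFun hu (Sum.inl e)
  have h2 : N.mulVec x = 0 := funext fun v => congrFun hu (Sum.inr v)
  have h3 : ∑ e, ℓ e * (x e * x e) = 0 := by
    have h4 : Matrix.vecMul y N ⬝ᵥ x = 0 := by
      rw [← Matrix.dotProduct_mulVec, h2, dotProduct_zero]
    have h5 : ∑ e, (ℓ e * x e + Matrix.vecMul y N e) * x e = 0 :=
      Finset.sum_eq_zero fun e _ => by rw [h1 e, zero_mul]
    simp only [add_mul, Finset.sum_add_distrib] at h5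
    rw [dotProduct] at h4
    rw [h4, add_zero] at h5
    simpa only [mul_assoc] using h5
  have hx : x = 0 := by
    funext e
    have h4 := (Finset.sum_eq_zero_iff_of_nonneg fun e _ =>
      mul_nonneg (hℓ e).le (mul_self_nonneg (x e))).1 h3 e (Finset.mem_univ e)
    simpa [(hℓ e).ne'] using h4
  have hy : y = 0 := by
    refine dotProduct_eq_zero _ fun b => ?_
    obtain ⟨z, rfl⟩ := hN b
    rw [Matrix.dotProduct_mulVec]
    have : Matrix.vecMul y N = 0 := by
      funext e
      have := h1 e
      rw [hx] at this
      simpa using this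
    rw [this, zero_dotProduct]
  rw [hx, hy]
  funext i
  rcases i with i | i <;> rfl

variable {ℓ : E → ℤ} {D : Λ →ₗ[ℤ] Module.Dual ℤ Λ} {R : Module.Dual ℤ Λ →ₗ[ℤ] Module.Dual ℤ Λ}
  {ρ : (Module.Dual ℤ Λ ⧸ LinearMap.range D) →ₗ[ℤ] (Module.Dual ℤ Λ ⧸ LinearMap.range D)}
  {SE : (E → ℤ) →ₗ[ℤ] (E → ℤ)} {SV : (V → ℤ) →ₗ[ℤ] (V → ℤ)}
  {S : (E ⊕ V → ℤ) →ₗ[ℤ] (E ⊕ V → ℤ)}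

/-- Both sides are quotients of `ℤ^E` by the same relations. The column `Nᵀ` of the saddle matrix
gives the relations defining `Λ^∨`, the column `(ℓ, N)` restricted to `ker N` gives the image of
`Λ`, and the rest of that column eliminates `ℤ^V`. -/
theorem card_componentGroup_coinvariants (hι : Function.Injective ι)
    (hrange : LinearMap.range ι = LinearMap.ker N.mulVecLin)
    (hN : Function.Surjective N.mulVec)
    (hD : ∀ a, D a = coordDual ι fun e => ℓ e * ι a e)
    (hR : ∀ p, R (coordDual ι p) = coordDual ι (SE p))
    (hρ : ∀ ξ, ρ (Submodule.Quotient.mk ξ) = Submodule.Quotient.mk (R ξ))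
    (hcomm : ∀ x, N.mulVec (SE x) = SV (N.mulVec x))
    (hdiag : ∀ x, (fun e => ℓ e * SE x e) = SE fun e => ℓ e * x e)
    (hS : ∀ x y, S (Sum.elim x y) = Sum.elim (SE x) (SV y)) :
    Nat.card ((Module.Dual ℤ Λ ⧸ LinearMap.range D) ⧸ LinearMap.range (ρ - 1)) =
      Nat.card ((E ⊕ V → ℤ) ⧸ (LinearMap.range (saddleMatrix ℓ N).mulVecLin ⊔
        LinearMap.range (S - 1))) := by
  obtain ⟨s, hs'⟩ := Module.projective_lifting_property N.mulVecLin LinearMap.id hN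
  have hs : ∀ b, N.mulVec (s b) = b := fun b => LinearMap.congr_fun hs' b
  set W := LinearMap.range (saddleMatrix ℓ N).mulVecLin ⊔ LinearMap.range (S - 1) with hW
  let inlMap : (E → ℤ) →ₗ[ℤ] (E ⊕ V → ℤ) :=
    { toFun := fun x => Sum.elim x 0
      map_add' := fun x y => by funext i; rcases i with i | i <;> simp
      map_smul' := fun k x => by funext i; rcases i with i | i <;> simp }
  have hS1 : ∀ x y, (S - 1) (Sum.elim x y) = Sum.elim (SE x - x) (SV y - y) := by
    intro x y
    rw [LinearMap.sub_apply, hS, Module.End.one_apply]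
    funext i
    rcases i with i | i <;> rfl
  refine Submodule.card_quotient_congr
    ((LinearMap.range (ρ - 1)).mkQ ∘ₗ (LinearMap.range D).mkQ ∘ₗ coordDual ι) (W.mkQ ∘ₗ inlMap)
    ?_ ?_ fun a => ?_
  · exact (Submodule.mkQ_surjective _).comp
      ((Submodule.mkQ_surjective _).comp (coordDual_surjective hι hrange hs))
  · intro z
    obtain ⟨u, rfl⟩ := Submodule.mkQ_surjective _ z
    obtain ⟨x, y, rfl⟩ : ∃ x y, u = Sum.elim x y := ⟨_, _, (Sum.elim_comp_inl_inr u).symm⟩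
    -- Subtracting the saddle image of `(s y, 0)`, which is `(ℓ · s y, y)`, clears the vertex part.
    refine ⟨fun e => x e - ℓ e * s y e, ?_⟩
    rw [LinearMap.comp_apply, ← sub_eq_zero, ← map_sub, Submodule.mkQ_apply,
      Submodule.Quotient.mk_eq_zero]
    refine Submodule.mem_sup_left ⟨Sum.elim (-s y) 0, ?_⟩
    rw [Matrix.mulVecLin_apply, saddleMatrix_mulVec, Matrix.mulVec_neg, hs, Matrix.zero_vecMul]
    funext i
    rcases i with i | i <;> simp [inlMap]
  · have h1 : ((LinearMap.range (ρ - 1)).mkQ ∘ₗ (LinearMap.range D).mkQ ∘ₗ coordDual ι) a = 0 ↔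
        ∃ p k, coordDual ι a = coordDual ι (SE p) - coordDual ι p + D k := by
      rw [LinearMap.comp_apply, Submodule.mkQ_apply, Submodule.Quotient.mk_eq_zero]
      constructor
      · rintro ⟨q, hq⟩
        obtain ⟨ξ, rfl⟩ := Submodule.Quotient.mk_surjective _ q
        obtain ⟨p, rfl⟩ := coordDual_surjective hι hrange hs ξ
        rw [LinearMap.sub_apply, hρ, Module.End.one_apply, hR, ← Submodule.Quotient.mk_sub,
          LinearMap.comp_apply, Submodule.mkQ_apply, eq_comm, Submodule.Quotient.eq] at hq
        obtain ⟨k, hk⟩ := hq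
        exact ⟨p, k, by rw [hk]; abel⟩
      · rintro ⟨p, k, hpk⟩
        refine ⟨Submodule.Quotient.mk (coordDual ι p), ?_⟩
        rw [LinearMap.sub_apply, hρ, Module.End.one_apply, hR, ← Submodule.Quotient.mk_sub,
          LinearMap.comp_apply, Submodule.mkQ_apply, eq_comm, Submodule.Quotient.eq]
        exact ⟨k, by rw [hpk]; abel⟩
    rw [h1, LinearMap.comp_apply, Submodule.mkQ_apply, Submodule.Quotient.mk_eq_zero, hW,
      Submodule.mem_sup]
    constructor
    · rintro ⟨p, k, hpk⟩
      rw [hD, ← map_sub, ← map_add, ← sub_eq_zero, ← map_sub, coordDual_eq_zero_iff hrange hs] at hpk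
      obtain ⟨y, hy⟩ := hpk
      have h2 : N.mulVec (ι k) = 0 := by
        have : ι k ∈ LinearMap.ker N.mulVecLin := hrange ▸ ⟨k, rfl⟩
        exact this
      refine ⟨_, ⟨Sum.elim (ι k) y, rfl⟩, _, ⟨Sum.elim p 0, rfl⟩, ?_⟩
      rw [Matrix.mulVecLin_apply, saddleMatrix_mulVec, hS1, h2, map_zero, sub_zero]
      funext i
      rcases i with i | i
      · have := congrFun hy i
        simp only [Pi.sub_apply, Pi.add_apply] at this
        simp only [inlMap, LinearMap.coe_mk, AddHom.coe_mk, Pi.add_apply, Sum.elim_inl,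
          Pi.sub_apply]
        linarith
      · simp [inlMap]
    · rintro ⟨_, ⟨u, rfl⟩, _, ⟨v, rfl⟩, huv⟩
      obtain ⟨x, y, rfl⟩ : ∃ x y, u = Sum.elim x y := ⟨_, _, (Sum.elim_comp_inl_inr u).symm⟩
      obtain ⟨p, q, rfl⟩ : ∃ x y, v = Sum.elim x y := ⟨_, _, (Sum.elim_comp_inl_inr v).symm⟩
      rw [Matrix.mulVecLin_apply, saddleMatrix_mulVec, hS1] at huv
      have h2 : N.mulVec x + (SV q - q) = 0 := funext fun v => congrFun huv (Sum.inr v)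
      have h3 : x + (SE (s q) - s q) ∈ LinearMap.range ι := by
        rw [hrange, LinearMap.mem_ker, Matrix.mulVecLin_apply, Matrix.mulVec_add,
          Matrix.mulVec_sub, hcomm, hs, h2]
      obtain ⟨k, hk⟩ := h3
      -- The vertex part `q` is moved to the edges through `s`; the error in the saddle relation is
      -- absorbed by the cycle `k`.
      refine ⟨p - fun e => ℓ e * s q e, k, ?_⟩
      rw [hD, ← map_sub, ← map_add, ← sub_eq_zero, ← map_sub, coordDual_eq_zero_iff hrange hs]
      refine ⟨y, funext fun e => ?_⟩
      have h4 : (ℓ e * x e + Matrix.vecMul y N e) + (SE p e - p e) = a e :=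
        congrFun huv (Sum.inl e)
      have h5 : ℓ e * SE (s q) e = SE (fun e => ℓ e * s q e) e := congrFun (hdiag (s q)) e
      rw [hk, map_sub]
      simp only [Pi.sub_apply, Pi.add_apply]
      rw [← h4, ← h5]
      ring

/-- Passing from coinvariants to invariants only needs finiteness, and this follows from the
coinvariant count itself. -/
theorem card_componentGroup_invariants (hι : Function.Injective ι)
    (hrange : LinearMap.range ι = LinearMap.ker N.mulVecLin)
    (hN : Function.Surjective N.mulVec) (hℓ : ∀ e, 0 < ℓ e)
    (hD : ∀ a, D a = coordDual ι fun e => ℓ e * ι a e)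
    (hR : ∀ p, R (coordDual ι p) = coordDual ι (SE p))
    (hρ : ∀ ξ, ρ (Submodule.Quotient.mk ξ) = Submodule.Quotient.mk (R ξ))
    (hcomm : ∀ x, N.mulVec (SE x) = SV (N.mulVec x))
    (hdiag : ∀ x, (fun e => ℓ e * SE x e) = SE fun e => ℓ e * x e)
    (hS : ∀ x y, S (Sum.elim x y) = Sum.elim (SE x) (SV y)) :
    Nat.card (LinearMap.ker (ρ - 1)) =
      Nat.card ((E ⊕ V → ℤ) ⧸ (LinearMap.range (saddleMatrix ℓ N).mulVecLin ⊔
        LinearMap.range (S - 1))) := by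
  classical
  have hdet : (saddleMatrix ℓ N).det ≠ 0 := by
    intro h0
    obtain ⟨v, hv, hv0⟩ := Matrix.exists_mulVec_eq_zero_iff.2 h0
    exact hv (saddleMatrix_injective hℓ hN v hv0)
  have hfin : Finite (Module.Dual ℤ Λ ⧸ LinearMap.range D) := by
    -- For the trivial action the coinvariants are the whole group, which thus has order `|det|` of
    -- the saddle matrix.
    have h1 := card_componentGroup_coinvariants (ρ := 1) (R := 1) (SE := 1) (SV := 1) (S := 1)
      hι hrange hN hD (fun _ => rfl) (fun _ => rfl) (fun _ => rfl) (fun _ => rfl) (fun _ _ => rfl)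
    have h2 : LinearMap.range (1 - 1 : Module.End ℤ (Module.Dual ℤ Λ ⧸ LinearMap.range D)) = ⊥ := by
      rw [sub_self, LinearMap.range_zero]
    have h3 : LinearMap.range (1 - 1 : Module.End ℤ (E ⊕ V → ℤ)) = ⊥ := by
      rw [sub_self, LinearMap.range_zero]
    rw [h3, sup_bot_eq, card_quotient_range_mulVecLin _ hdet] at h1
    have h4 := Nat.finite_of_card_ne_zero (h1.trans_ne (Int.natAbs_ne_zero.2 hdet))
    exact Finite.of_equiv _ (Submodule.quotEquivOfEqBot _ h2).toEquiv
  rw [← card_componentGroup_coinvariants hι hrange hN hD hR hρ hcomm hdiag hS,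
    ← LinearMap.index_range_eq_card_ker]
  rfl

end ComponentGroup

/-! ### Height functions on finite forests -/

section Height

namespace SimpleGraph

variable {V : Type*}

/-- The end of a longest path works: a neighbour off the path would lengthen it, and one on the path
other than the penultimate vertex would close a cycle. -/
theorem IsAcyclic.exists_forall_adj_eq [Finite V] [Nonempty V] {G : SimpleGraph V}
    (hG : G.IsAcyclic) : ∃ v, ∀ u w, G.Adj v u → G.Adj v w → u = w := by
  classical
  have := Fintype.ofFinite V
  let s : Set ℕ := {n | ∃ (u v : V) (p : G.Walk u v), p.IsPath ∧ p.length = n}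
  have hne : s.Nonempty := ⟨0, Classical.arbitrary V, _, Walk.nil, Walk.IsPath.nil, rfl⟩
  have hbdd : BddAbove s := ⟨Fintype.card V, by
    rintro n ⟨u, v, p, hp, rfl⟩
    exact hp.length_lt.le⟩
  obtain ⟨u, v, p, hp, hlen⟩ := Nat.sSup_mem hne hbdd
  refine ⟨v, ?_⟩
  have key : ∀ w, G.Adj v w → w = p.penultimate := by
    intro w hw
    refine hG.eq_penultimate_of_adj_end hp hw ?_
    by_contra hsupp
    have h1 : p.length + 1 ∈ s := ⟨u, w, p.concat hw, hp.concat hsupp hw, p.length_concat hw⟩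
    have h2 := le_csSup hbdd h1
    omega
  intro x y hx hy
  rw [key x hx, key y hy]

/-- Vertices with at most one remaining neighbour are stripped in successive rounds, and the height
is the round of removal. Nothing is chosen, so automorphisms preserve it. Adjacent vertices may fall
in the same round, which is why the inequalities are weak. -/
theorem IsAcyclic.exists_height_aux {G : SimpleGraph V} (hG : G.IsAcyclic) (n : ℕ) :
    ∀ Y : Set V, Y.Finite → Y.ncard = n → ∃ h : V → ℕ,
      (∀ v ∈ Y, ∀ u ∈ Y, ∀ w ∈ Y, G.Adj v u → G.Adj v w → h v ≤ h u → h v ≤ h w → u = w) ∧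
      ∀ F : G ≃g G, (∀ v, F v ∈ Y ↔ v ∈ Y) → ∀ v ∈ Y, h (F v) = h v := by
  classical
  induction n using Nat.strong_induction_on with
  | _ n ih =>
  intro Y hY hn
  let Y' : Set V := {v ∈ Y | ∃ u ∈ Y, ∃ w ∈ Y, G.Adj v u ∧ G.Adj v w ∧ u ≠ w}
  have hsub : Y' ⊆ Y := fun v hv => hv.1
  rcases Y.eq_empty_or_nonempty with rfl | hne
  · exact ⟨fun _ => 0, by simp, by simp⟩
  have hlt : Y'.ncard < n := by
    rw [← hn]
    refine Set.ncard_lt_ncard (LE.le.ssubset_of_ne hsub fun heq => ?_) hY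
    have hfin := hY.to_subtype
    have hnon := hne.to_subtype
    obtain ⟨v, hv⟩ := (hG.induce Y).exists_forall_adj_eq
    have hv' : v.1 ∈ Y' := heq.symm.subset v.2
    obtain ⟨-, u, hu, w, hw, hvu, hvw, huw⟩ := hv'
    exact huw (congrArg Subtype.val (hv ⟨u, hu⟩ ⟨w, hw⟩ hvu hvw))
  obtain ⟨h, h1, h2⟩ := ih _ hlt Y' (hY.subset hsub) rfl
  refine ⟨fun v => if v ∈ Y' then h v + 1 else 0, ?_, ?_⟩
  · intro v hv u hu w hw hvu hvw hhu hhw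
    by_cases hv' : v ∈ Y'
    · have hmem : ∀ x, (if v ∈ Y' then h v + 1 else 0) ≤ (if x ∈ Y' then h x + 1 else 0) →
          x ∈ Y' ∧ h v ≤ h x := by
        intro x hx
        rw [if_pos hv'] at hx
        by_cases hx' : x ∈ Y'
        · rw [if_pos hx'] at hx
          exact ⟨hx', by omega⟩
        · rw [if_neg hx'] at hx
          omega
      exact h1 v hv' u (hmem u hhu).1 w (hmem w hhw).1 hvu hvw (hmem u hhu).2 (hmem w hhw).2
    · by_contra huw
      exact hv' ⟨hv, u, hu, w, hw, hvu, hvw, huw⟩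
  · intro F hF v hv
    have hF' : ∀ v, F v ∈ Y' ↔ v ∈ Y' := by
      intro v
      constructor
      · rintro ⟨hv, u, hu, w, hw, hvu, hvw, huw⟩
        refine ⟨(hF v).1 hv, F.symm u, (hF _).1 ?_, F.symm w, (hF _).1 ?_, ?_, ?_, ?_⟩
        · rwa [RelIso.apply_symm_apply]
        · rwa [RelIso.apply_symm_apply]
        · rwa [← F.map_adj_iff, RelIso.apply_symm_apply]
        · rwa [← F.map_adj_iff, RelIso.apply_symm_apply]
        · exact fun h => huw (F.symm.injective h)
      · rintro ⟨hv, u, hu, w, hw, hvu, hvw, huw⟩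
        exact ⟨(hF v).2 hv, F u, (hF _).2 hu, F w, (hF _).2 hw, F.map_adj_iff.2 hvu,
          F.map_adj_iff.2 hvw, fun h => huw (F.injective h)⟩
    change (if F v ∈ Y' then h (F v) + 1 else 0) = if v ∈ Y' then h v + 1 else 0
    by_cases hv' : v ∈ Y'
    · rw [if_pos hv', if_pos ((hF' v).2 hv'), h2 F hF' v hv']
    · rw [if_neg hv', if_neg (mt (hF' v).1 hv')]

/-- A finite forest has a height function, invariant under automorphisms, for which every vertex
has at most one neighbour of at least the same height. -/
theorem IsAcyclic.exists_height [Finite V] {G : SimpleGraph V} (hG : G.IsAcyclic) :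
    ∃ h : V → ℕ, (∀ v u w, G.Adj v u → G.Adj v w → h v ≤ h u → h v ≤ h w → u = w) ∧
      ∀ F : G ≃g G, ∀ v, h (F v) = h v := by
  obtain ⟨h, h1, h2⟩ := hG.exists_height_aux _ Set.univ Set.finite_univ rfl
  exact ⟨h, fun v u w => h1 v trivial u trivial w trivial, fun F v => h2 F (by simp) v trivial⟩

end SimpleGraph

end Height

/-! ### The boundary matrix of a BY pair -/

namespace BYPair

section Geometry

variable {V : Type*} (P : BYPair V)

/-- A vertex whose connected component in the forest meets the subgraph. -/
def IsAnchored (v : V) : Prop := ∃ s ∈ P.sub.verts, P.graph.Reachable v s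

/-- The tail of an edge, for a chosen orientation. -/
noncomputable def tail (e : P.graph.edgeSet) : V := (Quot.out e.1).1

/-- The head of an edge, for a chosen orientation. -/
noncomputable def head (e : P.graph.edgeSet) : V := (Quot.out e.1).2

theorem mk_tail_head (e : P.graph.edgeSet) : s(P.tail e, P.head e) = e.1 := Quot.out_eq e.1

theorem adj_tail_head (e : P.graph.edgeSet) : P.graph.Adj (P.tail e) (P.head e) := by
  rw [← SimpleGraph.mem_edgeSet, mk_tail_head]
  exact e.2

theorem tail_head_cases {e : P.graph.edgeSet} {u v : V} (h : e.1 = s(u, v)) :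
    (P.tail e = u ∧ P.head e = v) ∨ (P.tail e = v ∧ P.head e = u) := by
  rw [← mk_tail_head, Sym2.eq_iff] at h
  exact h

variable {P}

theorem IsAnchored.of_adj {u v : V} (hu : P.IsAnchored u) (h : P.graph.Adj u v) :
    P.IsAnchored v := by
  obtain ⟨s, hs, hr⟩ := hu
  exact ⟨s, hs, h.reachable.symm.trans hr⟩

theorem isAnchored_apply (F : P.isoGroup) (v : V) : P.IsAnchored (F.1 v) ↔ P.IsAnchored v := by
  constructor
  · rintro ⟨s, hs, hr⟩
    refine ⟨F.1.symm s, ?_, ?_⟩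
    · rwa [← F.2.2.1, RelIso.apply_symm_apply]
    · have := hr.map F.1.symm.toHom
      simpa using this
  · rintro ⟨s, hs, hr⟩
    exact ⟨F.1 s, (F.2.2.1 s).2 hs, hr.map F.1.toHom⟩

variable (P)

/-- The edges outside the subgraph, in components of the forest meeting the subgraph. -/
def AnchoredEdge : Type _ :=
  {e : P.graph.edgeSet // P.OpenEdge (P.tail e) (P.head e) ∧ P.IsAnchored (P.tail e)}

/-- The vertices outside the subgraph, in components of the forest meeting the subgraph. -/
def AnchoredVertex : Type _ := {v : V // v ∉ P.sub.verts ∧ P.IsAnchored v}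

noncomputable instance [Fintype V] : Fintype P.AnchoredEdge := by
  classical exact inferInstanceAs (Fintype {e : P.graph.edgeSet // _})

noncomputable instance [Fintype V] : Fintype P.AnchoredVertex := by
  classical exact inferInstanceAs (Fintype {v : V // _})

noncomputable instance : DecidableEq P.AnchoredEdge := Classical.decEq _

noncomputable instance : DecidableEq P.AnchoredVertex := Classical.decEq _

theorem openEdge_tail_head_iff {e : P.graph.edgeSet} {u v : V} (h : e.1 = s(u, v)) :
    P.OpenEdge (P.tail e) (P.head e) ↔ P.OpenEdge u v := by
  rcases P.tail_head_cases h with ⟨h1, h2⟩ | ⟨h1, h2⟩ <;> rw [h1, h2]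
  exact ⟨fun h => h.symm, fun h => h.symm⟩

theorem isAnchored_tail_iff {e : P.graph.edgeSet} {u v : V} (h : e.1 = s(u, v)) :
    P.IsAnchored (P.tail e) ↔ P.IsAnchored u := by
  have he := P.adj_tail_head e
  rcases P.tail_head_cases h with ⟨h1, h2⟩ | ⟨h1, h2⟩
  · rw [h1]
  · rw [h1, h2] at he
    rw [h1]
    exact ⟨fun h => h.of_adj he, fun h => h.of_adj he.symm⟩

/-- The anchored edge spanned by two adjacent vertices. -/
def anchoredEdge {u v : V} (h : P.OpenEdge u v) (hu : P.IsAnchored u) : P.AnchoredEdge :=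
  ⟨⟨s(u, v), h.1⟩, (P.openEdge_tail_head_iff rfl).2 h, (P.isAnchored_tail_iff rfl).2 hu⟩

variable {P}

theorem mapEdgeSet_val (F : P.isoGroup) (e : P.graph.edgeSet) :
    (F.1.mapEdgeSet e).1 = s(F.1 (P.tail e), F.1 (P.head e)) := by
  change Sym2.map F.1 e.1 = _
  rw [← mk_tail_head, Sym2.map_mk]

/-- The permutation of the anchored edges. -/
noncomputable def edgePerm (F : P.isoGroup) : Equiv.Perm P.AnchoredEdge :=
  Equiv.Perm.subtypePerm (F.1.mapEdgeSet : Equiv.Perm P.graph.edgeSet) fun e => by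
    change P.OpenEdge (P.tail (F.1.mapEdgeSet e)) (P.head (F.1.mapEdgeSet e)) ∧
      P.IsAnchored (P.tail (F.1.mapEdgeSet e)) ↔ _
    rw [P.openEdge_tail_head_iff (mapEdgeSet_val F e), P.isAnchored_tail_iff (mapEdgeSet_val F e),
      isoGroup_openEdge, isAnchored_apply]

theorem edgePerm_val (F : P.isoGroup) (e : P.AnchoredEdge) :
    (edgePerm F e).1 = F.1.mapEdgeSet e.1 := rfl

/-- The permutation of the anchored vertices. -/
noncomputable def vertexPerm (F : P.isoGroup) : Equiv.Perm P.AnchoredVertex :=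
  Equiv.Perm.subtypePerm F.1.toEquiv fun v => by
    change F.1 v ∉ P.sub.verts ∧ P.IsAnchored (F.1 v) ↔ _
    rw [F.2.2.1, isAnchored_apply]

open Classical in
/-- Whether an automorphism preserves the chosen orientation at an edge. -/
noncomputable def orientSign (F : P.isoGroup) (e : P.graph.edgeSet) : ℤˣ :=
  if F.1 (P.tail e) = P.tail (F.1.mapEdgeSet e) then 1 else -1

theorem apply_tail_head (F : P.isoGroup) (e : P.graph.edgeSet) {c : V → V → ℤ}
    (hc : ∀ u v, c v u = -c u v) :
    c (P.tail (F.1.mapEdgeSet e)) (P.head (F.1.mapEdgeSet e)) =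
      orientSign F e * c (F.1 (P.tail e)) (F.1 (P.head e)) := by
  rcases P.tail_head_cases (mapEdgeSet_val F e) with ⟨h1, h2⟩ | ⟨h1, h2⟩
  · rw [orientSign, if_pos h1.symm, h1, h2, Units.val_one, one_mul]
  · rw [orientSign, if_neg, h1, h2, hc]
    · simp
    · rw [h1]
      exact fun h => (P.adj_tail_head e).ne (F.1.injective h)

/-- The sign of a signed automorphism at an anchored edge. -/
noncomputable def SignedAut.signEdge (σ : P.SignedAut) (e : P.AnchoredEdge) : ℤˣ :=
  σ.sign (P.edgeComponent e.2.1) * orientSign σ.iso e.1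

/-- The sign of a signed automorphism at an anchored vertex. -/
def SignedAut.signVertex (σ : P.SignedAut) (v : P.AnchoredVertex) : ℤˣ :=
  σ.sign (P.vertexComponent v.2.1)

variable (P)

/-- The coordinates of a chain at the anchored edges. -/
noncomputable def chainCoord : P.chains →ₗ[ℤ] (P.AnchoredEdge → ℤ) where
  toFun c e := c.1 (P.tail e.1) (P.head e.1)
  map_add' _ _ := rfl
  map_smul' _ _ := rfl

theorem chainCoord_apply (c : P.chains) (e : P.AnchoredEdge) :
    P.chainCoord c e = c.1 (P.tail e.1) (P.head e.1) := rfl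

theorem chainCoord_chainRep (σ : P.SignedAut) (c : P.chains) :
    P.chainCoord (P.chainRep σ c) = signedPerm (edgePerm σ.iso) σ.signEdge (P.chainCoord c) := by
  funext e
  obtain ⟨e, rfl⟩ := (edgePerm σ.iso).surjective e
  rw [signedPerm_apply, chainCoord_apply, chainCoord_apply, edgePerm_val,
    apply_tail_head σ.iso e.1 (P.chainRep σ c).2.1, chainRep_apply, σ.edgeSign_of e.2.1,
    SignedAut.signEdge, Units.val_mul]
  ring

open Classical in
/-- The boundary matrix on the anchored edges and vertices. -/
noncomputable def boundaryMatrix : Matrix P.AnchoredVertex P.AnchoredEdge ℤ :=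
  Matrix.of fun v e => (if v.1 = P.head e.1 then 1 else 0) - if v.1 = P.tail e.1 then 1 else 0

open Classical in
theorem boundaryMatrix_apply (v : P.AnchoredVertex) (e : P.AnchoredEdge) :
    P.boundaryMatrix v e =
      (if v.1 = P.head e.1 then 1 else 0) - if v.1 = P.tail e.1 then 1 else 0 := rfl

theorem boundaryMatrix_ne_zero {v : P.AnchoredVertex} {e : P.AnchoredEdge}
    (h : P.boundaryMatrix v e ≠ 0) :
    (v.1 = P.head e.1 ∧ v.1 ≠ P.tail e.1) ∨ (v.1 = P.tail e.1 ∧ v.1 ≠ P.head e.1) := by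
  rw [boundaryMatrix_apply] at h
  by_cases h1 : v.1 = P.head e.1
  · exact Or.inl ⟨h1, fun h2 => (P.adj_tail_head e.1).ne (h2.symm.trans h1)⟩
  · refine Or.inr ⟨?_, h1⟩
    by_contra h2
    rw [if_neg h1, if_neg h2] at h
    exact h rfl

theorem boundaryMatrix_mul_self {v : P.AnchoredVertex} {e : P.AnchoredEdge}
    (h : P.boundaryMatrix v e ≠ 0) : P.boundaryMatrix v e * P.boundaryMatrix v e = 1 := by
  rw [boundaryMatrix_apply]
  rcases P.boundaryMatrix_ne_zero h with ⟨h1, h2⟩ | ⟨h1, h2⟩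
  · rw [if_pos h1, if_neg h2]
    rfl
  · rw [if_neg h2, if_pos h1]
    rfl

theorem boundaryMatrix_equivariant (σ : P.SignedAut) (v : P.AnchoredVertex) (e : P.AnchoredEdge) :
    P.boundaryMatrix (vertexPerm σ.iso v) (edgePerm σ.iso e) =
      σ.signVertex v * σ.signEdge e * P.boundaryMatrix v e := by
  classical
  have h1 := apply_tail_head σ.iso e.1 (c := fun x y =>
    (if σ.iso.1 v.1 = y then 1 else 0) - if σ.iso.1 v.1 = x then 1 else 0) fun x y => by ring
  simp only [σ.iso.1.injective.eq_iff] at h1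
  have h2 : P.boundaryMatrix (vertexPerm σ.iso v) (edgePerm σ.iso e) =
      orientSign σ.iso e.1 * P.boundaryMatrix v e := h1
  rw [h2]
  by_cases h0 : P.boundaryMatrix v e = 0
  · rw [h0, mul_zero, mul_zero]
  -- Incident cells lie in one component of `T ∖ S`, so the two values of the sign function cancel
  -- and only the orientation sign is left.
  · have h3 : P.edgeComponent e.2.1 = P.vertexComponent v.2.1 := by
      obtain ⟨v, hv⟩ := v
      rcases P.boundaryMatrix_ne_zero h0 with ⟨h4, -⟩ | ⟨h4, -⟩
      · have h4 : v = P.head e.1 := h4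
        subst h4
        exact P.edgeComponent_eq e.2.1 hv.1
      · have h4 : v = P.tail e.1 := h4
        subst h4
        rw [← P.edgeComponent_symm e.2.1]
        exact P.edgeComponent_eq e.2.1.symm hv.1
    rw [SignedAut.signVertex, SignedAut.signEdge, h3, ← Units.val_mul, ← mul_assoc,
      Int.units_mul_self, one_mul]

variable [Fintype V]

theorem boundaryMatrix_mulVec_chainCoord (c : P.chains) (v : P.AnchoredVertex) :
    P.boundaryMatrix.mulVec (P.chainCoord c) v = ∑ u, c.1 u v.1 := by
  classical
  have h1 : ∀ e : P.AnchoredEdge, P.boundaryMatrix v e * P.chainCoord c e =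
      ∑ u, ((if v.1 = P.head e.1 ∧ u = P.tail e.1 then 1 else 0) +
        if v.1 = P.tail e.1 ∧ u = P.head e.1 then 1 else 0) * c.1 u v.1 := by
    intro e
    simp only [add_mul, Finset.sum_add_distrib, ite_and, ite_mul, one_mul, zero_mul]
    rw [boundaryMatrix_apply, chainCoord_apply]
    by_cases h1 : v.1 = P.head e.1 <;> by_cases h2 : v.1 = P.tail e.1
    · exact absurd (h2.symm.trans h1) (P.adj_tail_head e.1).ne
    · simp [h1, (P.adj_tail_head e.1).ne']
    · simp [h2, (P.adj_tail_head e.1).ne]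
      exact (c.2.1 _ _).symm
    · simp [h1, h2]
  rw [Matrix.mulVec, dotProduct, Finset.sum_congr rfl fun e _ => h1 e, Finset.sum_comm]
  refine Finset.sum_congr rfl fun u _ => ?_
  rw [← Finset.sum_mul]
  by_cases hu : P.OpenEdge u v.1
  · have hau : P.IsAnchored u := v.2.2.of_adj hu.1.symm
    rw [Finset.sum_eq_single (P.anchoredEdge hu hau)]
    · have he := P.tail_head_cases (e := (P.anchoredEdge hu hau).1) (u := u) (v := v.1) rfl
      have hne := hu.1.ne
      rcases he with ⟨h2, h3⟩ | ⟨h2, h3⟩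
      · rw [h2, h3]
        simp [hne]
      · rw [h2, h3]
        simp [hne]
    · intro e _ hne
      rw [if_neg, if_neg, add_zero]
      · rintro ⟨h2, h3⟩
        refine hne (Subtype.ext (Subtype.ext ?_))
        rw [← mk_tail_head, ← h2, ← h3]
        exact Sym2.eq_swap
      · rintro ⟨h2, h3⟩
        refine hne (Subtype.ext (Subtype.ext ?_))
        rw [← mk_tail_head, ← h2, ← h3]
        rfl
    · simp
  · rw [c.2.2 u v.1 hu, mul_zero]

open Classical in
/-- The chain with given coordinates at the anchored edges, and vanishing elsewhere. -/
noncomputable def chainOf (a : P.AnchoredEdge → ℤ) : P.chains :=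
  ⟨fun u v => ∑ e, a e * ((if u = P.tail e.1 ∧ v = P.head e.1 then 1 else 0) -
      if u = P.head e.1 ∧ v = P.tail e.1 then 1 else 0), by
    refine ⟨fun u v => ?_, fun u v huv => Finset.sum_eq_zero fun e _ => ?_⟩
    · beta_reduce
      rw [← Finset.sum_neg_distrib]
      refine Finset.sum_congr rfl fun e _ => ?_
      simp only [and_comm (a := v = _)]
      ring
    · rw [if_neg, if_neg, sub_zero, mul_zero]
      · rintro ⟨rfl, rfl⟩
        exact huv e.2.1.symm
      · rintro ⟨rfl, rfl⟩
        exact huv e.2.1⟩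

theorem chainOf_of_not_isAnchored (a : P.AnchoredEdge → ℤ) (u : V) {v : V}
    (hv : ¬ P.IsAnchored v) : (P.chainOf a).1 u v = 0 := by
  classical
  refine Finset.sum_eq_zero fun e _ => ?_
  rw [if_neg, if_neg, sub_zero, mul_zero]
  · rintro ⟨rfl, rfl⟩
    exact hv e.2.2
  · rintro ⟨rfl, rfl⟩
    exact hv (e.2.2.of_adj (P.adj_tail_head _))

theorem chainCoord_chainOf (a : P.AnchoredEdge → ℤ) : P.chainCoord (P.chainOf a) = a := by
  classical
  funext e'
  rw [chainCoord_apply]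
  change ∑ e, a e * ((if P.tail e'.1 = P.tail e.1 ∧ P.head e'.1 = P.head e.1 then 1 else 0) -
    if P.tail e'.1 = P.head e.1 ∧ P.head e'.1 = P.tail e.1 then 1 else 0) = a e'
  rw [Finset.sum_eq_single e']
  · rw [if_pos ⟨rfl, rfl⟩, if_neg fun h => (P.adj_tail_head e'.1).ne h.1, sub_zero, mul_one]
  · intro e _ hne
    rw [if_neg, if_neg, sub_zero, mul_zero]
    · rintro ⟨h2, h3⟩
      refine hne (Subtype.ext (Subtype.ext ?_))
      rw [← mk_tail_head, ← mk_tail_head, h2, h3]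
      exact Sym2.eq_swap
    · rintro ⟨h2, h3⟩
      refine hne (Subtype.ext (Subtype.ext ?_))
      rw [← mk_tail_head, ← mk_tail_head, h2, h3]
  · simp

/-- The basis vector at `v` is, up to orientation, the boundary of a walk from `v` into `S`, since
vertices of `S` are not counted. Anchoring provides the walk. -/
theorem boundaryMatrix_surjective : Function.Surjective P.boundaryMatrix.mulVec := by
  classical
  have key : ∀ (v s : V) (p : P.graph.Walk v s), s ∈ P.sub.verts →
      ∃ a : P.AnchoredEdge → ℤ, ∀ w : P.AnchoredVertex,
        P.boundaryMatrix.mulVec a w = if w.1 = v then 1 else 0 := by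
    intro v s p hs
    induction p with
    | nil =>
      refine ⟨0, fun w => ?_⟩
      rw [Matrix.mulVec_zero, if_neg, Pi.zero_apply]
      rintro h
      exact w.2.1 (h ▸ hs)
    | @cons v v' s h p ih =>
      obtain ⟨a, ha⟩ := ih hs
      by_cases hv : v ∈ P.sub.verts
      · refine ⟨0, fun w => ?_⟩
        rw [Matrix.mulVec_zero, if_neg, Pi.zero_apply]
        rintro h
        exact w.2.1 (h ▸ hv)
      · have ho : P.OpenEdge v v' := ⟨h, fun h' => hv h'.fst_mem⟩
        have hv' : P.IsAnchored v := ⟨s, hs, ⟨SimpleGraph.Walk.cons h p⟩⟩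
        set e := P.anchoredEdge ho hv'
        rcases P.tail_head_cases (e := e.1) (u := v) (v := v') rfl with ⟨h2, h3⟩ | ⟨h2, h3⟩
        · refine ⟨a - Pi.single e 1, fun w => ?_⟩
          rw [Matrix.mulVec_sub, Pi.sub_apply, ha, Matrix.mulVec_single_one, Matrix.col_apply,
            boundaryMatrix_apply, h2, h3]
          ring
        · refine ⟨a + Pi.single e 1, fun w => ?_⟩
          rw [Matrix.mulVec_add, Pi.add_apply, ha, Matrix.mulVec_single_one, Matrix.col_apply,
            boundaryMatrix_apply, h2, h3]
          ring
  have key' : ∀ v : P.AnchoredVertex, ∃ a : P.AnchoredEdge → ℤ,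
      P.boundaryMatrix.mulVec a = Pi.single v 1 := by
    intro v
    obtain ⟨s, hs, ⟨p⟩⟩ := v.2.2
    obtain ⟨a, ha⟩ := key v.1 s p hs
    refine ⟨a, funext fun w => ?_⟩
    rw [ha, Pi.single_apply]
    by_cases hw : w = v
    · rw [if_pos hw, if_pos (congrArg Subtype.val hw)]
    · rw [if_neg hw, if_neg fun h => hw (Subtype.ext h)]
  choose a ha using key'
  intro b
  refine ⟨∑ v, b v • a v, ?_⟩
  rw [Matrix.mulVec_sum]
  simp only [Matrix.mulVec_smul, ha]
  conv_rhs => rw [← Finset.univ_sum_single b]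
  refine Finset.sum_congr rfl fun v _ => ?_
  rw [← Pi.single_smul, smul_eq_mul, mul_one]

/-- Relative cycles vanish on components not meeting the subgraph. -/
theorem lattice_eq_zero_of_not_isAnchored (c : P.lattice) {u v : V} (hu : ¬ P.IsAnchored u) :
    c.1.1 u v = 0 := by
  obtain ⟨h, h1, -⟩ := P.acyclic.exists_height
  -- Induction from the leaves: in the cycle condition at `u` the edges to lower neighbours already
  -- carry zero, and at most one other edge remains.
  have key : ∀ n u v, h u = n → ¬ P.IsAnchored u → P.graph.Adj u v → h u ≤ h v →
      c.1.1 v u = 0 := by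
    intro n
    induction n using Nat.strong_induction_on with
    | _ n ih =>
    rintro u v rfl hu huv hle
    have hus : u ∉ P.sub.verts := fun h => hu ⟨u, h, SimpleGraph.Reachable.refl u⟩
    have h0 : ∑ w, c.1.1 w u = 0 := congrFun (LinearMap.mem_ker.1 c.2) ⟨u, hus⟩
    rw [Finset.sum_eq_single v] at h0
    · exact h0
    · intro w _ hwv
      by_cases huw : P.graph.Adj u w
      · have hlt : h w < h u := by
          by_contra hle'
          exact hwv (h1 u w v huw huv (not_lt.1 hle') hle)
        rw [c.1.2.1, ih _ hlt w u rfl (fun hw => hu (hw.of_adj huw.symm)) huw.symm hlt.le, neg_zero]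
      · exact c.1.2.2 _ _ fun ho => huw ho.1.symm
    · simp
  by_cases huv : P.graph.Adj u v
  · rcases le_total (h u) (h v) with hle | hle
    · rw [c.1.2.1, key _ u v rfl hu huv hle, neg_zero]
    · exact key _ v u rfl (fun hv => hu (hv.of_adj huv.symm)) huv.symm hle
  · exact c.1.2.2 _ _ fun ho => huv ho.1

/-- The coordinates of a relative cycle. -/
noncomputable def latticeCoord : P.lattice →ₗ[ℤ] (P.AnchoredEdge → ℤ) :=
  P.chainCoord ∘ₗ P.lattice.subtype

theorem latticeCoord_injective : Function.Injective P.latticeCoord := by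
  rw [← LinearMap.ker_eq_bot, LinearMap.ker_eq_bot']
  intro c hc
  refine Subtype.ext (Subtype.ext (funext fun u => funext fun v => ?_))
  change c.1.1 u v = 0
  by_cases hu : P.IsAnchored u
  · by_cases ho : P.OpenEdge u v
    · have h0 : c.1.1 (P.tail (P.anchoredEdge ho hu).1) (P.head (P.anchoredEdge ho hu).1) = 0 :=
        congrFun hc (P.anchoredEdge ho hu)
      rcases P.tail_head_cases (e := (P.anchoredEdge ho hu).1) (u := u) (v := v) rfl with
        ⟨h2, h3⟩ | ⟨h2, h3⟩
      · rwa [h2, h3] at h0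
      · rw [h2, h3] at h0
        rw [c.1.2.1, h0, neg_zero]
    · exact c.1.2.2 _ _ ho
  · exact P.lattice_eq_zero_of_not_isAnchored c hu

theorem range_latticeCoord :
    LinearMap.range P.latticeCoord = LinearMap.ker P.boundaryMatrix.mulVecLin := by
  ext a
  constructor
  · rintro ⟨c, rfl⟩
    refine LinearMap.mem_ker.2 (funext fun v => ?_)
    have h1 := P.boundaryMatrix_mulVec_chainCoord c.1 v
    exact h1.trans (congrFun (LinearMap.mem_ker.1 c.2) ⟨v.1, v.2.1⟩)
  · intro ha
    refine ⟨⟨P.chainOf a, LinearMap.mem_ker.2 (funext fun v => ?_)⟩, P.chainCoord_chainOf a⟩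
    change ∑ u, (P.chainOf a).1 u v.1 = 0
    by_cases hv : P.IsAnchored v.1
    · have h1 := P.boundaryMatrix_mulVec_chainCoord (P.chainOf a) ⟨v.1, v.2, hv⟩
      rw [chainCoord_chainOf] at h1
      exact h1.symm.trans (congrFun (LinearMap.mem_ker.1 ha) _)
    · exact Finset.sum_eq_zero fun u _ => P.chainOf_of_not_isAnchored a u hv

theorem toDual_eq (a : P.lattice) :
    P.toDual a = coordDual P.latticeCoord fun e => (P.len e.1 : ℤ) * P.latticeCoord a e := by
  classical
  refine LinearMap.ext fun b => ?_
  change ∑ e : P.graph.edgeSet, (P.len e : ℤ) *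
      Sym2.lift ⟨fun u v => a.1.1 u v * b.1.1 u v, _⟩ e.1 =
    ∑ e : P.AnchoredEdge, (P.len e.1 : ℤ) * a.1.1 (P.tail e.1) (P.head e.1) *
      b.1.1 (P.tail e.1) (P.head e.1)
  symm
  refine Fintype.sum_of_injective (fun e : P.AnchoredEdge => e.1) Subtype.val_injective _ _ ?_ ?_
  · intro e he
    rw [← mk_tail_head, Sym2.lift_mk]
    have h0 : a.1.1 (P.tail e) (P.head e) = 0 := by
      by_cases ho : P.OpenEdge (P.tail e) (P.head e)
      · refine P.lattice_eq_zero_of_not_isAnchored a fun hA => he ⟨⟨e, ho, hA⟩, rfl⟩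
      · exact a.1.2.2 _ _ ho
    change _ * (a.1.1 (P.tail e) (P.head e) * _) = 0
    rw [h0, zero_mul, mul_zero]
  · intro e
    rw [← P.mk_tail_head e.1, Sym2.lift_mk, mul_assoc]

end Geometry

end BYPair

/-! ### The forest family of a BY forest -/

section SignedPerm

variable {X : Type*}

theorem signedPerm_dotProduct [Fintype X] (τ : Equiv.Perm X) (θ : X → ℤˣ) (a b : X → ℤ) :
    signedPerm τ θ a ⬝ᵥ signedPerm τ θ b = a ⬝ᵥ b := by
  rw [dotProduct, ← Equiv.sum_comp τ]
  refine Finset.sum_congr rfl fun x _ => ?_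
  rw [signedPerm_apply, signedPerm_apply, mul_mul_mul_comm, ← Units.val_mul, Int.units_mul_self,
    Units.val_one, one_mul]

theorem signedPerm_pow_mul (τ : Equiv.Perm X) (θ : X → ℤˣ) {ℓ : X → ℤ} (hℓ : ∀ x, ℓ (τ x) = ℓ x)
    (f : ℕ) (u : X → ℤ) :
    (fun x => ℓ x * (signedPerm τ θ ^ f) u x) = (signedPerm τ θ ^ f) fun x => ℓ x * u x := by
  induction f with
  | zero => rfl
  | succ f ih =>
    rw [pow_succ', Module.End.mul_apply, Module.End.mul_apply, ← ih]
    funext x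
    obtain ⟨x, rfl⟩ := τ.surjective x
    rw [signedPerm_apply, signedPerm_apply, hℓ]
    ring

theorem signedPerm_mulVec {Y : Type*} [Fintype X] (τ : Equiv.Perm X) (θ : X → ℤˣ)
    (τ' : Equiv.Perm Y) (θ' : Y → ℤˣ) {N : Matrix Y X ℤ}
    (hN : ∀ y x, N (τ' y) (τ x) = θ' y * θ x * N y x) (u : X → ℤ) :
    N.mulVec (signedPerm τ θ u) = signedPerm τ' θ' (N.mulVec u) := by
  funext y
  obtain ⟨y, rfl⟩ := τ'.surjective y
  rw [signedPerm_apply, Matrix.mulVec, dotProduct, ← Equiv.sum_comp τ, Matrix.mulVec, dotProduct,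
    Finset.mul_sum]
  refine Finset.sum_congr rfl fun x _ => ?_
  have h1 : (θ x : ℤ) * θ x = 1 := by rw [← Units.val_mul, Int.units_mul_self, Units.val_one]
  rw [signedPerm_apply, hN]
  linear_combination (θ' y : ℤ) * N y x * u x * h1

theorem signedPerm_sum {Y : Type*} (τ : Equiv.Perm X) (θ : X → ℤˣ) (τ' : Equiv.Perm Y)
    (θ' : Y → ℤˣ) (x : X → ℤ) (y : Y → ℤ) :
    signedPerm (τ.sumCongr τ') (Sum.elim θ θ') (Sum.elim x y) =
      Sum.elim (signedPerm τ θ x) (signedPerm τ' θ' y) := by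
  funext i
  obtain ⟨i, rfl⟩ := (τ.sumCongr τ').surjective i
  rw [signedPerm_apply]
  rcases i with i | i
  · exact (signedPerm_apply τ θ x i).symm
  · exact (signedPerm_apply τ' θ' y i).symm

theorem signedPerm_sum_pow {Y : Type*} (τ : Equiv.Perm X) (θ : X → ℤˣ) (τ' : Equiv.Perm Y)
    (θ' : Y → ℤˣ) (f : ℕ) (x : X → ℤ) (y : Y → ℤ) :
    (signedPerm (τ.sumCongr τ') (Sum.elim θ θ') ^ f) (Sum.elim x y) =
      Sum.elim ((signedPerm τ θ ^ f) x) ((signedPerm τ' θ' ^ f) y) := by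
  induction f with
  | zero => rfl
  | succ f ih =>
    rw [pow_succ', Module.End.mul_apply, ih, signedPerm_sum, pow_succ', pow_succ']
    rfl

end SignedPerm

/-! ### The saddle matrices on the anchored cells of a BY pair. -/

namespace BYPair

variable {V : Type*} {P : BYPair V}

/-- The permutation of the anchored cells. -/
noncomputable def cellPerm (F : P.isoGroup) : Equiv.Perm (P.AnchoredEdge ⊕ P.AnchoredVertex) :=
  (edgePerm F).sumCongr (vertexPerm F)

/-- The sign of a signed automorphism at an anchored cell. -/
noncomputable def SignedAut.signCell (σ : P.SignedAut) :
    P.AnchoredEdge ⊕ P.AnchoredVertex → ℤˣ :=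
  Sum.elim σ.signEdge σ.signVertex

variable (P)

/-- The height of an anchored cell, for a height function on the vertices. -/
noncomputable def cellHeight (h : V → ℕ) : P.AnchoredEdge ⊕ P.AnchoredVertex → ℕ :=
  Sum.elim (fun e => 2 * min (h (P.tail e.1)) (h (P.head e.1)) + 1) fun v => 2 * h v.1

/-- The matrices of the saddle point problems computing the component groups. -/
noncomputable def cellMatrix (e : ℕ) :
    Matrix (P.AnchoredEdge ⊕ P.AnchoredVertex) (P.AnchoredEdge ⊕ P.AnchoredVertex) ℤ :=
  saddleMatrix (fun a => (e : ℤ) * P.len a.1) P.boundaryMatrix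

theorem cellMatrix_inl_inl (e : ℕ) (a b : P.AnchoredEdge) :
    P.cellMatrix e (.inl a) (.inl b) = if a = b then (e : ℤ) * P.len a.1 else 0 := rfl

theorem cellMatrix_equivariant (σ : P.SignedAut) (e : ℕ)
    (x y : P.AnchoredEdge ⊕ P.AnchoredVertex) :
    P.cellMatrix e (cellPerm σ.iso x) (cellPerm σ.iso y) =
      σ.signCell x * σ.signCell y * P.cellMatrix e x y := by
  rcases x with a | v <;> rcases y with b | w
  · change P.cellMatrix e (.inl (edgePerm σ.iso a)) (.inl (edgePerm σ.iso b)) =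
      σ.signEdge a * σ.signEdge b * _
    rw [cellMatrix_inl_inl, cellMatrix_inl_inl]
    by_cases hab : a = b
    · rw [hab, if_pos rfl, if_pos rfl, edgePerm_val, σ.iso.2.1, ← Units.val_mul,
        Int.units_mul_self, Units.val_one, one_mul]
    · rw [if_neg hab, if_neg fun h => hab ((edgePerm σ.iso).injective h), mul_zero]
  · exact (P.boundaryMatrix_equivariant σ w a).trans
      (congrArg (· * _) (mul_comm _ _))
  · exact P.boundaryMatrix_equivariant σ v b
  · exact (mul_zero _).symm

theorem cellMatrix_symm (e : ℕ) (x y : P.AnchoredEdge ⊕ P.AnchoredVertex) :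
    P.cellMatrix e x y = P.cellMatrix e y x := by
  rcases x with a | v <;> rcases y with b | w
  · rw [cellMatrix_inl_inl, cellMatrix_inl_inl]
    by_cases hab : a = b
    · rw [hab]
    · rw [if_neg hab, if_neg (Ne.symm hab)]
  · rfl
  · rfl
  · rfl

theorem cellMatrix_cases {e : ℕ} {x y : P.AnchoredEdge ⊕ P.AnchoredVertex} (hxy : x ≠ y)
    (h : P.cellMatrix e x y ≠ 0) :
    (∃ a v, x = .inl a ∧ y = .inr v ∧ P.boundaryMatrix v a ≠ 0) ∨
      ∃ a v, x = .inr v ∧ y = .inl a ∧ P.boundaryMatrix v a ≠ 0 := by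
  rcases x with a | v <;> rcases y with b | w
  · rw [cellMatrix_inl_inl, if_neg fun hab => hxy (congrArg _ hab)] at h
    exact absurd rfl h
  · exact Or.inl ⟨a, w, rfl, rfl, h⟩
  · exact Or.inr ⟨b, v, rfl, rfl, h⟩
  · exact absurd rfl h

variable {P}

/-- An endpoint realising the minimum cannot exceed it, so at most one endpoint of an edge lies
above the edge. -/
theorem eq_of_boundaryMatrix_ne_zero {h : V → ℕ} {a : P.AnchoredEdge} {v w : P.AnchoredVertex}
    (hv : min (h (P.tail a.1)) (h (P.head a.1)) < h v.1)
    (hw : min (h (P.tail a.1)) (h (P.head a.1)) < h w.1)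
    (hva : P.boundaryMatrix v a ≠ 0) (hwa : P.boundaryMatrix w a ≠ 0) : v = w := by
  refine Subtype.ext ?_
  rcases P.boundaryMatrix_ne_zero hva with ⟨h1, -⟩ | ⟨h1, -⟩ <;>
    rcases P.boundaryMatrix_ne_zero hwa with ⟨h2, -⟩ | ⟨h2, -⟩ <;> rw [h1] at hv ⊢ <;>
    rw [h2] at hw ⊢ <;> omega

theorem exists_adj_of_boundaryMatrix_ne_zero {h : V → ℕ} {a : P.AnchoredEdge}
    {v : P.AnchoredVertex} (hv : h v.1 ≤ min (h (P.tail a.1)) (h (P.head a.1)))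
    (hva : P.boundaryMatrix v a ≠ 0) :
    ∃ u, P.graph.Adj v.1 u ∧ h v.1 ≤ h u ∧ a.1.1 = s(v.1, u) := by
  have hadj := P.adj_tail_head a.1
  rcases P.boundaryMatrix_ne_zero hva with ⟨h1, -⟩ | ⟨h1, -⟩
  · refine ⟨P.tail a.1, h1 ▸ hadj.symm, hv.trans (min_le_left _ _), ?_⟩
    rw [h1, Sym2.eq_swap, mk_tail_head]
  · refine ⟨P.head a.1, h1 ▸ hadj, hv.trans (min_le_right _ _), ?_⟩
    rw [h1, mk_tail_head]

/-- An edge is placed just above its lower endpoint. Doubling keeps vertex heights even and edge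
heights odd, so incident cells never tie; an edge between vertices of equal height lies above both
and has no parent. -/
theorem isForestForm_cellMatrix (σ : P.SignedAut) {h : V → ℕ}
    (h1 : ∀ v u w, P.graph.Adj v u → P.graph.Adj v w → h v ≤ h u → h v ≤ h w → u = w)
    (h2 : ∀ F : P.graph ≃g P.graph, ∀ v, h (F v) = h v) (e : ℕ) :
    IsForestForm (cellPerm σ.iso) σ.signCell (P.cellHeight h) (P.cellMatrix e) where
  symm := P.cellMatrix_symm e
  equivariant := P.cellMatrix_equivariant σ e
  height := by
    rintro (a | v)
    · change 2 * min (h (P.tail (σ.iso.1.mapEdgeSet a.1))) (h (P.head (σ.iso.1.mapEdgeSet a.1))) +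
        1 = 2 * min (h (P.tail a.1)) (h (P.head a.1)) + 1
      rcases P.tail_head_cases (mapEdgeSet_val σ.iso a.1) with ⟨h3, h4⟩ | ⟨h3, h4⟩
      · rw [h3, h4, h2, h2]
      · rw [h3, h4, h2, h2, min_comm]
    · exact congrArg (2 * ·) (h2 σ.iso.1 v.1)
  ne := by
    intro x y hxy hne
    rcases P.cellMatrix_cases hne hxy with ⟨a, v, rfl, rfl, -⟩ | ⟨a, v, rfl, rfl, -⟩ <;>
      simp only [cellHeight, Sum.elim_inl, Sum.elim_inr] <;> omega
  uniq := by
    intro x y z hxy hxz hMy hMz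
    rcases P.cellMatrix_cases (by rintro rfl; exact lt_irrefl _ hxy) hMy with
      ⟨a, v, rfl, rfl, hv⟩ | ⟨a, v, rfl, rfl, hv⟩
    · rcases P.cellMatrix_cases (by rintro rfl; exact lt_irrefl _ hxz) hMz with
        ⟨b, w, hb, rfl, hw⟩ | ⟨b, w, hb, rfl, hw⟩
      · obtain rfl := Sum.inl_injective hb
        simp only [cellHeight, Sum.elim_inl, Sum.elim_inr] at hxy hxz
        rw [eq_of_boundaryMatrix_ne_zero (h := h) (by omega) (by omega) hv hw]
      · cases hb
    · rcases P.cellMatrix_cases (by rintro rfl; exact lt_irrefl _ hxz) hMz with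
        ⟨b, w, hb, rfl, hw⟩ | ⟨b, w, hb, rfl, hw⟩
      · cases hb
      · obtain rfl := Sum.inr_injective hb
        simp only [cellHeight, Sum.elim_inl, Sum.elim_inr] at hxy hxz
        obtain ⟨u, hu, hle, hau⟩ := exists_adj_of_boundaryMatrix_ne_zero (h := h) (by omega) hv
        obtain ⟨u', hu', hle', hbu⟩ := exists_adj_of_boundaryMatrix_ne_zero (h := h) (by omega) hw
        obtain rfl := h1 _ _ _ hu hu' hle hle'
        refine congrArg Sum.inl (Subtype.ext (Subtype.ext ?_))
        rw [hau, hbu]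
  unit := by
    intro x y hxy hM
    rcases P.cellMatrix_cases hxy hM with ⟨a, v, rfl, rfl, hv⟩ | ⟨a, v, rfl, rfl, hv⟩ <;>
      exact P.boundaryMatrix_mul_self hv

theorem exists_isForestFamily [Fintype V] (σ : P.SignedAut) :
    ∃ h, IsForestFamily (cellPerm σ.iso) σ.signCell h (fun x => x.isRight = true) P.cellMatrix := by
  obtain ⟨h, h1, h2⟩ := P.acyclic.exists_height
  exact ⟨P.cellHeight h,
    { form := isForestForm_cellMatrix σ h1 h2
      diag := by
        rintro e (a | v)
        · rw [cellMatrix_inl_inl, cellMatrix_inl_inl, if_pos rfl, if_pos rfl, Nat.cast_one, one_mul]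
        · exact (mul_zero _).symm
      offdiag := by
        rintro e (a | v) (b | w) hxy
        · rw [cellMatrix_inl_inl, cellMatrix_inl_inl, if_neg fun hab => hxy (congrArg _ hab),
            if_neg fun hab => hxy (congrArg _ hab)]
        · rfl
        · rfl
        · rfl
      invariant := by
        rintro (a | v) <;> rfl
      vertex := by
        rintro (a | v) hx
        · simp at hx
        · rfl
      bipartite := by
        intro x y hxy hM
        rcases P.cellMatrix_cases hxy hM with ⟨a, v, rfl, rfl, -⟩ | ⟨a, v, rfl, rfl, -⟩ <;> simp
      nondegenerate := fun e he =>
        saddleMatrix_injective (fun a => by positivity) P.boundaryMatrix_surjective }⟩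

theorem chainCoord_chainRep_pow (σ : P.SignedAut) (f : ℕ) (c : P.chains) :
    P.chainCoord (P.chainRep (σ ^ f) c) =
      (signedPerm (edgePerm σ.iso) σ.signEdge ^ f) (P.chainCoord c) := by
  induction f with
  | zero => rw [pow_zero, map_one, pow_zero]; rfl
  | succ f ih =>
    rw [pow_succ', map_mul, Module.End.mul_apply, chainCoord_chainRep, ih, pow_succ']
    rfl

variable [Fintype V]

theorem boundaryMatrix_mulVec_pow (σ : P.SignedAut) (f : ℕ) (x : P.AnchoredEdge → ℤ) :
    P.boundaryMatrix.mulVec ((signedPerm (edgePerm σ.iso) σ.signEdge ^ f) x) =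
      (signedPerm (vertexPerm σ.iso) σ.signVertex ^ f) (P.boundaryMatrix.mulVec x) := by
  induction f with
  | zero => rfl
  | succ f ih =>
    rw [pow_succ', pow_succ', Module.End.mul_apply, Module.End.mul_apply, ← ih]
    exact signedPerm_mulVec _ _ _ _ (P.boundaryMatrix_equivariant σ) _

/-- On the edge coordinates this is the action of `εF` on chains; it passes to the vertex
coordinates because the boundary matrix is equivariant and onto. -/
theorem signedPerm_cellPerm_pow_orderOf (σ : P.SignedAut) :
    signedPerm (cellPerm σ.iso) σ.signCell ^ orderOf σ = 1 := by
  have hE : ∀ x, (signedPerm (edgePerm σ.iso) σ.signEdge ^ orderOf σ) x = x := by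
    intro x
    rw [← P.chainCoord_chainOf x, ← chainCoord_chainRep_pow, pow_orderOf_eq_one, map_one]
    rfl
  refine LinearMap.ext fun u => ?_
  obtain ⟨x, y, rfl⟩ : ∃ x y, u = Sum.elim x y := ⟨_, _, (Sum.elim_comp_inl_inr u).symm⟩
  refine (signedPerm_sum_pow _ _ _ _ _ _ _).trans ?_
  obtain ⟨z, rfl⟩ := P.boundaryMatrix_surjective y
  rw [← boundaryMatrix_mulVec_pow, hE, hE]
  rfl

end BYPair

open BYPair in
/-- The Tamagawa numbers in a tower as orders of coinvariants. -/
theorem BYForest.tamagawaNumber_tower {V : Type*} [Fintype V] (T : BYForest V) (e f : ℕ+) :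
    (T.tower e f).tamagawaNumber =
      Nat.card ((T.AnchoredEdge ⊕ T.AnchoredVertex → ℤ) ⧸
        (LinearMap.range (T.cellMatrix e).mulVecLin ⊔
          LinearMap.range (signedPerm (cellPerm T.aut.iso) T.aut.signCell ^ (f : ℕ) - 1))) := by
  set SE := signedPerm (edgePerm T.aut.iso) T.aut.signEdge ^ (f : ℕ) with hSE
  let P' : BYPair V := T.toBYPair.scale e
  let σ' : P'.SignedAut := (T.aut ^ (f : ℕ)).scale e
  let ι : P'.lattice →ₗ[ℤ] (T.AnchoredEdge → ℤ) := T.toBYPair.latticeCoord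
  have hιinj : Function.Injective ι := T.toBYPair.latticeCoord_injective
  have hιrange : LinearMap.range ι = LinearMap.ker T.boundaryMatrix.mulVecLin :=
    T.toBYPair.range_latticeCoord
  have hι : ∀ c, ι (P'.latticeRep σ' c) = SE (ι c) := fun c =>
    chainCoord_chainRep_pow T.aut f c.1
  have hdot : ∀ a b, SE a ⬝ᵥ SE b = a ⬝ᵥ b := by
    intro a b
    rw [hSE, signedPerm_pow]
    exact signedPerm_dotProduct _ _ a b
  refine card_componentGroup_invariants (ι := ι) (N := T.boundaryMatrix)
    (ℓ := fun a => ((e : ℕ) : ℤ) * T.len a.1) (D := P'.toDual) (R := P'.latticeRep.dual σ')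
    (ρ := P'.neronRep σ') (SE := SE)
    (SV := signedPerm (vertexPerm T.aut.iso) T.aut.signVertex ^ (f : ℕ))
    hιinj hιrange T.boundaryMatrix_surjective (fun a => by positivity) (fun a => ?_) (fun p => ?_)
    (fun ξ => rfl) (boundaryMatrix_mulVec_pow T.aut f) (fun x => ?_)
    (signedPerm_sum_pow _ _ _ _ f)
  · refine (P'.toDual_eq a).trans (congrArg (coordDual ι) (funext fun x => ?_))
    change (((e * T.len x.1 : ℕ+) : ℕ) : ℤ) * ι a x = _
    push_cast
    rfl
  · refine LinearMap.ext fun c => ?_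
    -- Signed permutations preserve the dot product, so in coordinates the contragredient action is
    -- again `SE`.
    change p ⬝ᵥ ι (P'.latticeRep σ'⁻¹ c) = SE p ⬝ᵥ ι c
    have hc : c = P'.latticeRep σ' (P'.latticeRep σ'⁻¹ c) := by
      rw [← Module.End.mul_apply, ← map_mul, mul_inv_cancel, map_one, Module.End.one_apply]
    conv_rhs => rw [hc, hι, hdot]
  · refine signedPerm_pow_mul _ _ (fun a => ?_) f x
    rw [edgePerm_val, T.aut.iso.2.1]

theorem mainTheorem1 {V : Type*} [Fintype V] (T : BYForest V) (hA : T.ParityA) (hB : T.ParityB) :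
    ∃ (a : ℕ → ℕ+) (r : ℕ → ℕ) (s : ℕ → ℤ),
      (∀ d : ℕ, 0 < d → ¬ d ∣ orderOf T.aut → a d = 1 ∧ r d = 0 ∧ s d = 0) ∧
      ∀ e f : ℕ+, ((T.tower e f).tamagawaNumber : ℚ) =
        ∏ d ∈ Nat.divisors f,
          (((a d : ℕ) : ℚ) * ((e : ℕ) : ℚ) ^ r d * ((Nat.gcd e 2 : ℕ) : ℚ) ^ s d) ^
            Nat.totient d := by
  obtain ⟨h, F⟩ := BYPair.exists_isForestFamily T.aut
  obtain ⟨a, r, s, h1, h2⟩ :=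
    F.exists_card_coinvariants (BYPair.signedPerm_cellPerm_pow_orderOf T.aut)
  refine ⟨a, r, s, h1, fun e f => ?_⟩
  rw [T.tamagawaNumber_tower]
  exact h2 e f e.pos f.pos
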